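/- **Setting.** Let $m\ge 1$, $n\ge 0$ be integers. Let $\mathcal C$ be the real unital algebra generated by $e_1,\dots,e_m,\grave e_1,\dots,\grave e_{2n}$ with relations $e_je_k+e_ke_j=-2\delta_{jk}$, $\grave e_{2j}\grave e_{2k}=\grave e_{2k}\grave e_{2j}$, $\grave e_{2j-1}\grave e_{2k-1}=\grave e_{2k-1}\grave e_{2j-1}$, $\grave e_{2j-1}\grave e_{2k}-\grave e_{2k}\grave e_{2j-1}=\delta_{jk}$, $e_j\grave e_k=-\grave e_ke_j$. Let $\grave x_1,\dots,\grave x_{2n},\grave y_1,\dots,\grave y_{2n}$ be anticommuting (Grassmann) variables, commuting with $\mathcal C$ and with real-valued functions, and put $\underline{\grave x}=\sum_j\grave x_j\grave e_j$, $\underline{\grave y}=\sum_j\grave y_j\grave e_j$. The super Dirac operator is $$\partial_x=2\sum_{j=1}^n\big(\grave e_{2j}\partial_{\grave x_{2j-1}}-\grave e_{2j-1}\partial_{\grave x_{2j}}\big)-\sum_{j=1}^m e_j\partial_{x_j}$$ and the Berezin integral is $\int_B=\pi^{-n}\partial_{\grave x_{2n}}\cdots\partial_{\grave x_1}$ (left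 derivatives, acting on the $\grave x$ variables). For $\Omega\subset\mathbb R^m$ open, $C^1(\Omega)_{m|2n}$ is the set of $g(x)=\sum_A g_A(\underline x)\grave x_A$ with real-valued $g_A\in C^1(\Omega)$, where $A$ runs over the subsets of $\{1,\dots,2n\}$ and $\grave x_A$ is the product of the $\grave x_a$, $a\in A$, in increasing order; $g(y)=\sum_A g_A(\underline y)\grave y_A$. For $l\ge1$ and $r=|\underline x|$ let $\nu_{2l}$ be the radial fundamental solution of $\big(-\sum_j\partial_{x_j}^2\big)^l$ on $\mathbb R^m$ given by $$\nu_{2l}(\underline x)=\frac{\Gamma(\frac m2-l)}{4^l\pi^{m/2}(l-1)!}\,r^{2l-m}\quad\text{if } m \text{ is odd or } 2l<m,$$ $$\nu_{2l}(\underline x)=\frac{2(-1)^{p+1}}{4^l\pi^{m/2}(l-1)!\,p!}\,r^{2p}\Big(\log r-\tfrac12\big(H_p+H_{l-1}\big)\Big)\quad\text{if } m\text{ is even and } p=l-\tfrac m2\ge0,$$ with $H_k=\sum_{i=1}^k 1/i$, and let $\nu_{2l-1}=-\sum_je_j\partial_{x_j}\nu_{2l}$, a fundamental solution of $\big(-\sum_je_j\partial_{x_j}\big)^{2l-1}$.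 The fundamental solution of the super Dirac operator is $$\nu_1^{m|2n}(x-y)=\pi^n\sum_{k=0}^{n-1}\frac{2\cdot4^kk!}{(n-k-1)!}\nu_{2k+2}(\underline x-\underline y)(\underline{\grave x}-\underline{\grave y})^{2n-2k-1}+\pi^n\sum_{k=0}^{n}\frac{4^kk!}{(n-k)!}\nu_{2k+1}(\underline x-\underline y)(\underline{\grave x}-\underline{\grave y})^{2n-2k}.$$ **Theorem (Cauchy–Pompeiu).** Let $\Omega\subset\mathbb R^m$ be open, let $\Sigma\subset\Omega$ be a compact $m$-dimensional submanifold of $\mathbb R^m$ with smooth boundary, oriented by $\mathbb R^m$, and let $d\sigma_{\underline x}=\sum_jn_j(\underline x)e_j\,dS(\underline x)$ be its vector-valued surface element, with $n(\underline x)$ the outward unit normal and $dS$ the surface measure on $\partial\Sigma$. Let $g\in C^1(\Omega)_{m|2n}$. If $\underline y\in\mathring\Sigma$ or $\underline y\in\Omega\setminus\Sigma$, then both integrals below converge absolutely (coefficientwise) and $$\int_{\partial\Sigma}\int_B\nu_1^{m|2n}(x-y)\,d\sigma_{\underline x}\,g(x)+\int_\Sigma\int_B\nu_1^{m|2n}(x-y)\,(\partial_xg(x))\,dV(\underline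 x)=\begin{cases}-g(y)&\text{if }\underline y\in\mathring\Sigma,\\0&\text{if }\underline y\in\Omega\setminus\Sigma.\end{cases}$$ -/

import Mathlib

open MeasureTheory
open scoped TensorProduct ContDiff

noncomputable section

namespace SuperCauchy

/-! ### The algebra -/

/-- The bosonic space `ℝ^m` with its Euclidean structure. -/
abbrev E (m : ℕ) : Type := EuclideanSpace ℝ (Fin m)

/-- The index of the first member of the `j`-th symplectic pair: `2 j - 1` when counting from
one. -/
def fstIdx {n : ℕ} (j : Fin n) : Fin (2 * n) := ⟨2 * j, by omega⟩

/-- The index of the second member of the `j`-th symplectic pair: `2 j` when counting from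
one. -/
def sndIdx {n : ℕ} (j : Fin n) : Fin (2 * n) := ⟨2 * j + 1, by omega⟩

/-- The free generators standing for the orthogonal Clifford generators `e_1, …, e_m`. -/
def freeB (m n : ℕ) (j : Fin m) : FreeAlgebra ℝ (Fin m ⊕ Fin (2 * n)) :=
  FreeAlgebra.ι ℝ (Sum.inl j)

/-- The free generators standing for the symplectic Clifford generators `è_1, …, è_{2n}`. -/
def freeF (m n : ℕ) (j : Fin (2 * n)) : FreeAlgebra ℝ (Fin m ⊕ Fin (2 * n)) :=
  FreeAlgebra.ι ℝ (Sum.inr j)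

/-- The defining relations of the algebra `𝒞` generated by the `e_j` and the `è_j`. -/
inductive CliffRel (m n : ℕ) : FreeAlgebra ℝ (Fin m ⊕ Fin (2 * n)) →
    FreeAlgebra ℝ (Fin m ⊕ Fin (2 * n)) → Prop
  | ortho (j k : Fin m) : CliffRel m n
      (freeB m n j * freeB m n k + freeB m n k * freeB m n j)
      (algebraMap ℝ _ (if j = k then -2 else 0))
  | symp_snd (j k : Fin n) : CliffRel m n
      (freeF m n (sndIdx j) * freeF m n (sndIdx k) - freeF m n (sndIdx k) * freeF m n (sndIdx j)) 0
  | symp_fst (j k : Fin n) : CliffRel m n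
      (freeF m n (fstIdx j) * freeF m n (fstIdx k) - freeF m n (fstIdx k) * freeF m n (fstIdx j)) 0
  | symp_mix (j k : Fin n) : CliffRel m n
      (freeF m n (fstIdx j) * freeF m n (sndIdx k) - freeF m n (sndIdx k) * freeF m n (fstIdx j))
      (algebraMap ℝ _ (if j = k then 1 else 0))
  | anti (j : Fin m) (k : Fin (2 * n)) : CliffRel m n
      (freeB m n j * freeF m n k + freeF m n k * freeB m n j) 0

/-- The algebra `𝒞` generated by `m` orthogonal and `2n` symplectic Clifford generators. -/
abbrev Cliff (m n : ℕ) : Type := RingQuot (CliffRel m n)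

/-- `Λ_{4n} ⊗ 𝒞`, where `Λ_{4n}` is the Grassmann algebra on the `4n` anticommuting variables
`x̀_1, …, x̀_{2n}, ỳ_1, …, ỳ_{2n}` (the fermionic parts of two points `x` and `y` of superspace).
The Grassmann variables commute with the Clifford generators. -/
abbrev SuperAlg (m n : ℕ) : Type :=
  ExteriorAlgebra ℝ (Fin (2 * n) ⊕ Fin (2 * n) → ℝ) ⊗[ℝ] Cliff m n

variable {m n : ℕ}

/-- The anticommuting variable `x̀_j`. -/
def xVar (j : Fin (2 * n)) : SuperAlg m n :=
  ExteriorAlgebra.ι ℝ (Pi.single (Sum.inl j) (1 : ℝ)) ⊗ₜ[ℝ] 1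

/-- The anticommuting variable `ỳ_j`. -/
def yVar (j : Fin (2 * n)) : SuperAlg m n :=
  ExteriorAlgebra.ι ℝ (Pi.single (Sum.inr j) (1 : ℝ)) ⊗ₜ[ℝ] 1

/-- The orthogonal Clifford generator `e_j`. -/
def eB (j : Fin m) : SuperAlg m n :=
  1 ⊗ₜ[ℝ] RingQuot.mkAlgHom ℝ (CliffRel m n) (freeB m n j)

/-- The symplectic Clifford generator `è_j`. -/
def eF (j : Fin (2 * n)) : SuperAlg m n :=
  1 ⊗ₜ[ℝ] RingQuot.mkAlgHom ℝ (CliffRel m n) (freeF m n j)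

/-- The Clifford vector `∑_j v_j e_j` of a vector `v` in `ℝ^m`. -/
def vecB (v : E m) : SuperAlg m n := ∑ j, v j • eB j

/-- The fermionic vector variable `x̀ = ∑_j x̀_j è_j`. -/
def xF : SuperAlg m n := ∑ j, xVar j * eF j

/-- The fermionic vector variable `ỳ = ∑_j ỳ_j è_j`. -/
def yF : SuperAlg m n := ∑ j, yVar j * eF j

/-- The left derivative `∂_{x̀_j}`: on the Grassmann algebra it is the contraction with the
coordinate functional of `x̀_j`, that is, the odd derivation (from the left) sending `x̀_j` to `1`
and all other variables to `0`; it does not touch the Clifford generators. -/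
def dX (j : Fin (2 * n)) : SuperAlg m n →ₗ[ℝ] SuperAlg m n :=
  TensorProduct.map
    (CliffordAlgebra.contractLeft (Q := (0 : QuadraticForm ℝ (Fin (2 * n) ⊕ Fin (2 * n) → ℝ)))
      (LinearMap.proj (Sum.inl j)))
    LinearMap.id

/-- The Berezin integral over the variables `x̀`:
`∫_B = π^{-n} ∂_{x̀_{2n}} ⋯ ∂_{x̀_1}` (the derivative `∂_{x̀_1}` acts first). -/
def berezin (a : SuperAlg m n) : SuperAlg m n :=
  (Real.pi ^ n)⁻¹ • (List.finRange (2 * n)).foldl (fun b j => dX j b) a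

/-- The fermionic Dirac operator
`2 ∑_j (è_{2j} ∂_{x̀_{2j-1}} - è_{2j-1} ∂_{x̀_{2j}})`, acting from the left. -/
def diracF (a : SuperAlg m n) : SuperAlg m n :=
  (2 : ℝ) • ∑ j : Fin n, (eF (sndIdx j) * dX (fstIdx j) a - eF (fstIdx j) * dX (sndIdx j) a)

/-! ### Superfunctions -/

/-- A superfunction `g = ∑_A g_A x̀_A`, with real-valued coefficient functions `g_A` on `ℝ^m`,
given by its coefficients; `A` runs over the subsets of the set of fermionic indices. -/
abbrev SuperFun (m n : ℕ) : Type := Finset (Fin (2 * n)) → E m → ℝ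

/-- The monomial `ξ_A = ξ_{a_1} ⋯ ξ_{a_k}` for `A = {a_1 < ⋯ < a_k}`. -/
def monomial (ξ : Fin (2 * n) → SuperAlg m n) (A : Finset (Fin (2 * n))) : SuperAlg m n :=
  ((A.sort (· ≤ ·)).map ξ).prod

/-- The value `∑_A g_A(x) ξ_A` at the bosonic point `x` and the fermionic variables `ξ`. -/
def SuperFun.eval (g : SuperFun m n) (x : E m) (ξ : Fin (2 * n) → SuperAlg m n) : SuperAlg m n :=
  ∑ A, g A x • monomial ξ A

/-- `g ∈ C^1(Ω)_{m|2n} = C^1(Ω) ⊗ Λ_{2n}`. -/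
def SuperFun.IsC1On (g : SuperFun m n) (Ω : Set (E m)) : Prop :=
  ∀ A, ContDiffOn ℝ 1 (g A) Ω

/-- The bosonic partial derivative `∂_{x_j} g`, coefficient by coefficient. -/
def SuperFun.dB (j : Fin m) (g : SuperFun m n) : SuperFun m n :=
  fun A x => fderiv ℝ (g A) x (EuclideanSpace.single j 1)

/-- `∂_x g`, where `∂_x = ∂_{x̀} - ∑_j e_j ∂_{x_j}` is the super Dirac operator acting from the
left, at the point `x` (in the fermionic variables `x̀`). -/
def SuperFun.dirac (g : SuperFun m n) (x : E m) : SuperAlg m n :=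
  diracF (g.eval x xVar) - ∑ j, eB j * (SuperFun.dB j g).eval x xVar

/-! ### The fundamental solution -/

/-- The radial fundamental solution `ν_{2l}` (`l ≥ 1`) of `Δ_b^l`, the `l`-th power of the operator
`Δ_b = -∑_j ∂_{x_j}^2` on `ℝ^m`, with `r = ‖x‖`:
* `Γ(m/2 - l) / (4^l π^{m/2} (l-1)!) r^{2l-m}` if `m` is odd or `2l < m`;
* `2 (-1)^{p+1} / (4^l π^{m/2} (l-1)! p!) r^{2p} (log r - (H_p + H_{l-1}) / 2)`,
  with `H` the harmonic numbers, if `m` is even and `p = l - m/2 ≥ 0`.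
The constants are such that `Δ_b ν_2 = δ` and `Δ_b ν_{2l+2} = ν_{2l}`. -/
def nuEven (m l : ℕ) (x : E m) : ℝ :=
  if Odd m ∨ 2 * l < m then
    Real.Gamma ((m : ℝ) / 2 - l) / (4 ^ l * Real.pi ^ ((m : ℝ) / 2) * (l - 1).factorial)
      * ‖x‖ ^ (2 * (l : ℤ) - (m : ℤ))
  else
    2 * (-1) ^ (l - m / 2 + 1)
      / (4 ^ l * Real.pi ^ ((m : ℝ) / 2) * (l - 1).factorial * (l - m / 2).factorial)
      * ‖x‖ ^ (2 * (l - m / 2))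
      * (Real.log ‖x‖ - ((harmonic (l - m / 2) : ℝ) + (harmonic (l - 1) : ℝ)) / 2)

/-- The vector-valued fundamental solution `ν_{2l-1} = -∑_j e_j ∂_{x_j} ν_{2l}` (`l ≥ 1`) of
`(-∑_j e_j ∂_{x_j})^{2l-1}`. -/
def nuOdd (l : ℕ) (x : E m) : SuperAlg m n :=
  -∑ j, fderiv ℝ (nuEven m l) x (EuclideanSpace.single j 1) • eB j

/-- The fundamental solution of the super Dirac operator, with bosonic argument `x` and fermionic
vector argument `z`:
`π^n ∑_{k<n} 2 4^k k!/(n-k-1)! ν_{2k+2}(x) z^{2n-2k-1}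
  + π^n ∑_{k≤n} 4^k k!/(n-k)! ν_{2k+1}(x) z^{2n-2k}`. -/
def nu1 (x : E m) (z : SuperAlg m n) : SuperAlg m n :=
  Real.pi ^ n • ∑ k ∈ Finset.range n,
      (2 * (4 ^ k * (k.factorial : ℝ) / ((n - k - 1).factorial : ℝ)) * nuEven m (k + 1) x)
        • z ^ (2 * n - 2 * k - 1)
    + Real.pi ^ n • ∑ k ∈ Finset.range (n + 1),
      (4 ^ k * (k.factorial : ℝ) / ((n - k).factorial : ℝ))
        • (nuOdd (k + 1) x * z ^ (2 * n - 2 * k))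

/-- The Cauchy kernel `ν_1^{m|2n}(x - y)`: bosonic argument `x - y`, fermionic argument
`x̀ - ỳ`. -/
def cauchyKernel (x y : E m) : SuperAlg m n := nu1 (x - y) (xF - yF)

/-! ### Domains with smooth boundary and integration -/

/-- `v` is the outward unit normal of `S` at `p`: near `p`, the set `S` is `{ρ ≤ 0}` for a smooth
function `ρ` with nonzero gradient at `p`, and `v` is the normalized gradient of `ρ` at `p`. -/
def IsOuterUnitNormal (S : Set (E m)) (p v : E m) : Prop :=
  ∃ (U : Set (E m)) (ρ : E m → ℝ), IsOpen U ∧ p ∈ U ∧ ContDiffOn ℝ ∞ ρ U ∧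
    (∀ x ∈ U, x ∈ S ↔ ρ x ≤ 0) ∧ gradient ρ p ≠ 0 ∧ v = ‖gradient ρ p‖⁻¹ • gradient ρ p

/-- `S` is a compact `m`-dimensional smooth submanifold with boundary of `ℝ^m` (with the
orientation of `ℝ^m`). Its boundary is its topological frontier, and its interior is its
topological interior. -/
structure IsCompactSmoothDomain (S : Set (E m)) : Prop where
  isCompact : IsCompact S
  smooth_boundary : ∀ p ∈ frontier S, ∃ v, IsOuterUnitNormal S p v

open Classical in
/-- The outward unit normal of `S` at `p` (zero where there is none). -/
def outerNormal (S : Set (E m)) (p : E m) : E m :=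
  if h : ∃ v, IsOuterUnitNormal S p v then h.choose else 0

/-- `a` is the integral of `f` over `s`, for functions with values in the (possibly
infinite-dimensional) real vector space `Λ_{4n} ⊗ 𝒞`: integration is coordinatewise, that is,
`ℓ ∘ f` is integrable with integral `ℓ a` for every linear functional `ℓ`. There is at most one
such `a`. -/
def HasIntegralOn (μ : Measure (E m)) (s : Set (E m)) (f : E m → SuperAlg m n)
    (a : SuperAlg m n) : Prop :=
  ∀ ℓ : SuperAlg m n →ₗ[ℝ] ℝ,
    IntegrableOn (fun x => ℓ (f x)) s μ ∧ ∫ x in s, ℓ (f x) ∂μ = ℓ a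

/-- The elementary surface measure `dS` on hypersurfaces of `ℝ^m`: the `(m-1)`-dimensional
Hausdorff measure, normalized as Lebesgue measure on `(m-1)`-dimensional Euclidean space. -/
def surfaceMeasure (m : ℕ) : Measure (E m) := Measure.euclideanHausdorffMeasure (m - 1)

/-- `∫_{∂S} ∫_B ν_1(x - y) dσ_x g(x) = a`, where `dσ_x` is the vector-valued surface element
`∑_j n_j(x) e_j dS(x)` and `n(x)` is the outward unit normal. -/
def HasBoundaryIntegral (S : Set (E m)) (g : SuperFun m n) (y : E m) (a : SuperAlg m n) : Prop :=
  HasIntegralOn (surfaceMeasure m) (frontier S)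
    (fun x => berezin (cauchyKernel x y * vecB (outerNormal S x) * g.eval x xVar)) a

/-- `∫_S ∫_B ν_1(x - y) (∂_x g)(x) dV(x) = b`. -/
def HasVolumeIntegral (S : Set (E m)) (g : SuperFun m n) (y : E m) (b : SuperAlg m n) : Prop :=
  HasIntegralOn volume S (fun x => berezin (cauchyKernel x y * g.dirac x)) b

end SuperCauchy

end

/-!
The integrals take values in an algebra that is in general infinite-dimensional and carries no
topology, so the formula is proved after applying an arbitrary real linear functional `ℓ`. This
loses nothing, since functionals separate points and the integrands are finite sums of fixed
elements with scalar coefficients. Write `ν(x - y)` for the Cauchy kernel and `z = x̀ - ỳ` for its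
fermionic argument. The scalars `F_j(x) = ℓ (∫_B ν(x - y) e_j g(x))` form a vector field
(`fluxField`) whose flux through the boundary is the boundary integral. The Cauchy–Pompeiu formula
is Gauss's theorem for `F`, and rests on two facts about `F`.

* Off the singularity, `div F = -ℓ (∫_B ν(x - y) (∂_x g))` (`div_fluxField`), that is, `ν` is
  annihilated by the super Dirac operator acting from the right (`ber_kernel_diracF`). The square
  `q = z²` is central, so every power of `z` is `q^s` or `q^s z`. Under `∫_B` the fermionic
  derivatives of `g` can be moved to these powers (`ber_even_diracF`, `ber_odd_diracF`), and what
  they produce cancels the bosonic derivatives of the kernel by the recurrence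
  `∑_j ∂_j² ν_{2l+2} = -ν_{2l}`, which starts with `∑_j ∂_j² ν_2 = 0` (`laplacian_nuEven_succ`,
  `laplacian_nuEven_one`).
* At `y`, the flux density `|x - y|^{m-1} ⟨F, (x - y)/|x - y|⟩` tends to `-ℓ (g(y))` divided by the
  area of the unit sphere (`tendsto_fluxField`). Only the term with `∇ν_2` is as singular as
  `|x - y|^{1-m}`. Its fermionic factor is the top power `z^{2n}`, a multiple of
  `∏_j (x̀_j - ỳ_j)`; this is the fermionic delta distribution, which replaces `x̀` by `ỳ` under
  `∫_B` (`ber_top`).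

In particular the kernel is `O(|x - y|^{1-m})`, which makes the volume integral converge absolutely
(`exists_volumeIntegral`). The algebraic part uses only relations between the generators and the
derivatives; it is carried out in an arbitrary algebra with these relations (`SuperCalculus`), of
which `Λ_{4n} ⊗ 𝒞` is an instance (`superCalculus`).

Gauss's theorem for a compact domain with smooth boundary and the Hausdorff surface measure is
`IsCompactSmoothDomain.setIntegral_fderiv`. For a direction `v` transversal to the boundary, the map
that replaces the `v`-coordinate by the defining function `ρ` flattens the boundary. Its derivative
is the identity modulo `v` and multiplies `v` by `∂_v ρ`, which is therefore also its Jacobian, so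
the two factors `∂_v ρ` in the change of variables agree. Hence `∫_S ∂_v f` becomes an integral over
a half-space, evaluated by the fundamental theorem of calculus, and the resulting integral over the
hyperplane `v^⊥` is the flux through the boundary by the area formula for graphs
(`map_euclideanHausdorffMeasure_graph`). All directions are combinations of transversal ones, and
cut-off functions globalize. Multiplying the field by a cut-off that vanishes near `y` and letting
the cut-off tend to `1` gives the version with a point singularity
(`IsCompactSmoothDomain.setIntegral_div_of_singular`).
-/

noncomputable section

namespace SuperCauchy

variable {m n : ℕ}

/-! ### Calculus with Clifford generators and Grassmann variables -/

/-- The relations between the Clifford generators `e_j`, `è_j`, the odd variables `x̀_j`, `ỳ_j` and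
the left derivatives `∂_{x̀_j}` on which the fermionic calculus rests, in an arbitrary real
algebra `A`. Only the differences `z_j = x̀_j - ỳ_j` and the constancy of the `ỳ_j` are needed. -/
structure SuperCalculus (m n : ℕ) (A : Type*) [Ring A] [Algebra ℝ A] where
  eB : Fin m → A
  eF : Fin (2 * n) → A
  x : Fin (2 * n) → A
  y : Fin (2 * n) → A
  dX : Fin (2 * n) → A →ₗ[ℝ] A
  eB_rel (j k : Fin m) : eB j * eB k + eB k * eB j = (if j = k then -2 else 0 : ℝ) • 1
  eB_eF (j : Fin m) (k : Fin (2 * n)) : eB j * eF k = -(eF k * eB j)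
  eF_snd_comm (j k : Fin n) : eF (sndIdx j) * eF (sndIdx k) = eF (sndIdx k) * eF (sndIdx j)
  eF_fst_comm (j k : Fin n) : eF (fstIdx j) * eF (fstIdx k) = eF (fstIdx k) * eF (fstIdx j)
  eF_mix (j k : Fin n) : eF (fstIdx j) * eF (sndIdx k) - eF (sndIdx k) * eF (fstIdx j)
    = (if j = k then 1 else 0 : ℝ) • 1
  z_sq (j : Fin (2 * n)) : (x j - y j) * (x j - y j) = 0
  z_anti (j k : Fin (2 * n)) : (x j - y j) * (x k - y k) = -((x k - y k) * (x j - y j))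
  zz_comm (j k : Fin (2 * n)) (b : A) : Commute ((x j - y j) * (x k - y k)) b
  eF_z (j k : Fin (2 * n)) : eF j * (x k - y k) = (x k - y k) * eF j
  eB_z (j : Fin m) (k : Fin (2 * n)) : eB j * (x k - y k) = (x k - y k) * eB j
  dX_z (j k : Fin (2 * n)) (b : A) :
    dX j ((x k - y k) * b) = (if j = k then 1 else 0 : ℝ) • b - (x k - y k) * dX j b
  dX_y (j k : Fin (2 * n)) (b : A) : dX j (y k * b) = -(y k * dX j b)
  dX_eF (j k : Fin (2 * n)) (b : A) : dX j (eF k * b) = eF k * dX j b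
  dX_eB (j : Fin (2 * n)) (k : Fin m) (b : A) : dX j (eB k * b) = eB k * dX j b
  dX_comm (i j : Fin (2 * n)) (b : A) : dX i (dX j b) = -dX j (dX i b)
  dX_self (j : Fin (2 * n)) (b : A) : dX j (dX j b) = 0
  dX_one (j : Fin (2 * n)) : dX j 1 = 0

/-- A sum over all fermionic indices, grouped in symplectic pairs. -/
lemma sum_pairs {M : Type*} [AddCommMonoid M] (f : Fin (2 * n) → M) :
    ∑ j, f j = ∑ i : Fin n, (f (fstIdx i) + f (sndIdx i)) := by
  rw [← (finProdFinEquiv.trans (finCongr (Nat.mul_comm n 2))).sum_comp, Fintype.sum_prod_type]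
  refine Finset.sum_congr rfl fun i _ => ?_
  rw [Fin.sum_univ_two]
  congr 2 <;> ext <;> simp [fstIdx, sndIdx, finProdFinEquiv]; ring

lemma exists_pair (j : Fin (2 * n)) : ∃ i : Fin n, j = fstIdx i ∨ j = sndIdx i := by
  refine ⟨⟨j / 2, by omega⟩, ?_⟩
  rcases Nat.mod_two_eq_zero_or_one j with h | h
  · left; ext; simp [fstIdx]; omega
  · right; ext; simp [sndIdx]; omega

lemma finRange_eq_flatMap :
    List.finRange (2 * n) = (List.finRange n).flatMap fun i => [fstIdx i, sndIdx i] := by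
  have key : ∀ k, k ≤ n →
      List.range (2 * k) = (List.range k).flatMap fun i => [2 * i, 2 * i + 1] := by
    intro k _
    induction k with
    | zero => rfl
    | succ k ih =>
      rw [List.range_succ, List.flatMap_append, ← ih (by omega), Nat.mul_succ, List.range_succ,
        List.range_succ]
      simp
  apply List.map_injective_iff.2 (Fin.val_injective (n := 2 * n))
  rw [List.map_coe_finRange_eq_range, key n le_rfl, List.map_flatMap,
    ← List.map_coe_finRange_eq_range, List.flatMap_map]
  simp [fstIdx, sndIdx]

namespace SuperCalculus

variable {A : Type*} [Ring A] [Algebra ℝ A] (D : SuperCalculus m n A)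

/-- The odd variable `z_j = x̀_j - ỳ_j`. -/
def z (j : Fin (2 * n)) : A := D.x j - D.y j

/-- The fermionic vector variable `z = x̀ - ỳ = ∑_j z_j è_j`. -/
def zF : A := ∑ j, D.z j * D.eF j

/-- The fermionic Dirac operator. -/
def diracF (a : A) : A :=
  (2 : ℝ) • ∑ j : Fin n,
    (D.eF (sndIdx j) * D.dX (fstIdx j) a - D.eF (fstIdx j) * D.dX (sndIdx j) a)

/-- The commutator of `è_j` with `z`. -/
def w (j : Fin (2 * n)) : A := D.eF j * D.zF - D.zF * D.eF j

lemma eF_comm_z (j k : Fin (2 * n)) : D.eF j * D.z k = D.z k * D.eF j := D.eF_z j k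

lemma w_eq_sum (j : Fin (2 * n)) :
    D.w j = ∑ k, D.z k * (D.eF j * D.eF k - D.eF k * D.eF j) := by
  rw [w, zF, Finset.mul_sum, Finset.sum_mul, ← Finset.sum_sub_distrib]
  refine Finset.sum_congr rfl fun k _ => ?_
  rw [← mul_assoc, eF_comm_z, mul_sub, mul_assoc, mul_assoc]

lemma w_fst (i : Fin n) : D.w (fstIdx i) = D.z (sndIdx i) := by
  rw [w_eq_sum, sum_pairs]
  simp only [D.eF_fst_comm i, sub_self, mul_zero, zero_add, D.eF_mix]
  rw [Finset.sum_eq_single i]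
  · simp
  · intro b _ hb; simp [hb.symm]
  · simp

lemma w_snd (i : Fin n) : D.w (sndIdx i) = -D.z (fstIdx i) := by
  rw [w_eq_sum, sum_pairs]
  have (k : Fin n) : D.eF (sndIdx i) * D.eF (fstIdx k) - D.eF (fstIdx k) * D.eF (sndIdx i)
      = (if k = i then -1 else 0 : ℝ) • 1 := by
    rw [← neg_sub, D.eF_mix]; split_ifs <;> simp
  simp only [D.eF_snd_comm i, sub_self, mul_zero, add_zero, this]
  rw [Finset.sum_eq_single i]
  · simp
  · intro b _ hb; simp [hb]
  · simp

lemma z_anticomm (j k : Fin (2 * n)) : D.z j * D.z k = -(D.z k * D.z j) := D.z_anti j k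

/-- Expanding the left factor of `z²` gives `∑_j z_j è_j z`; expanding the right one gives
`-∑_j z_j z è_j`, because the `z_j` anticommute. The sum of the two expressions involves only the
commutators `w j`, which are again Grassmann variables. -/
lemma zF_mul_zF : D.zF * D.zF = ∑ i : Fin n, D.z (fstIdx i) * D.z (sndIdx i) := by
  have h1 : D.zF * D.zF = ∑ j, D.z j * (D.eF j * D.zF) := by
    conv_lhs => rw [zF, Finset.sum_mul]
    simp only [mul_assoc]
    rfl
  have h2 : D.zF * D.zF = -∑ j, D.z j * (D.zF * D.eF j) := by
    have hz (j : Fin (2 * n)) : D.z j * D.zF = -(D.zF * D.z j) := by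
      rw [zF, Finset.mul_sum, Finset.sum_mul, ← Finset.sum_neg_distrib]
      refine Finset.sum_congr rfl fun k _ => ?_
      rw [← mul_assoc, z_anticomm, mul_assoc, eF_comm_z, neg_mul, mul_assoc]
    conv_lhs => rw [zF, Finset.mul_sum]
    rw [← Finset.sum_neg_distrib]
    refine Finset.sum_congr rfl fun j _ => ?_
    change D.zF * _ = _
    rw [← mul_assoc, ← mul_assoc, hz, neg_mul, neg_neg]
  have h3 : (2 : ℝ) • (D.zF * D.zF) = ∑ j, D.z j * D.w j := by
    rw [two_smul]
    nth_rewrite 1 [h1]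
    rw [h2, ← sub_eq_add_neg, ← Finset.sum_sub_distrib]
    refine Finset.sum_congr rfl fun j _ => ?_
    rw [w, mul_sub]
  have h4 : ∑ j, D.z j * D.w j = (2 : ℝ) • ∑ i : Fin n, D.z (fstIdx i) * D.z (sndIdx i) := by
    rw [sum_pairs, Finset.smul_sum]
    refine Finset.sum_congr rfl fun i _ => ?_
    rw [w_fst, w_snd, mul_neg, ← z_anticomm, two_smul]
  have := congrArg (fun t => (2⁻¹ : ℝ) • t) (h3.trans h4)
  simpa [smul_smul] using this

/-- The square `q = z²`, a central element. -/
def q : A := D.zF * D.zF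

lemma q_comm (b : A) : Commute D.q b := by
  rw [q, zF_mul_zF]
  exact Commute.sum_left _ _ _ fun i _ => D.zz_comm _ _ _

lemma q_pow_comm (s : ℕ) (b : A) : Commute (D.q ^ s) b := (D.q_comm b).pow_left s

lemma zF_pow_even (s : ℕ) : D.zF ^ (2 * s) = D.q ^ s := by
  rw [pow_mul, pow_two, q]

lemma zF_pow_odd (s : ℕ) : D.zF ^ (2 * s + 1) = D.q ^ s * D.zF := by
  rw [pow_succ, zF_pow_even]

lemma eB_mul_zF (j : Fin m) : D.eB j * D.zF = -(D.zF * D.eB j) := by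
  rw [zF, Finset.mul_sum, Finset.sum_mul, ← Finset.sum_neg_distrib]
  refine Finset.sum_congr rfl fun k _ => ?_
  rw [← mul_assoc, z, D.eB_z, mul_assoc, D.eB_eF, mul_neg, mul_assoc]

lemma q_pow_left_comm (s : ℕ) (a b : A) : a * (D.q ^ s * b) = D.q ^ s * (a * b) := by
  rw [← mul_assoc, ← (D.q_pow_comm s a).eq, mul_assoc]

/-! ### Fermionic derivatives and the Berezin integral -/

lemma dX_zF_mul (j : Fin (2 * n)) (b : A) :
    D.dX j (D.zF * b) = D.eF j * b - D.zF * D.dX j b := by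
  rw [zF, Finset.sum_mul, map_sum, Finset.sum_mul]
  have (k : Fin (2 * n)) : D.dX j (D.z k * D.eF k * b)
      = (if j = k then 1 else 0 : ℝ) • (D.eF k * b) - D.z k * D.eF k * D.dX j b := by
    rw [mul_assoc, z, D.dX_z, D.dX_eF, mul_assoc]
  simp only [this, Finset.sum_sub_distrib, ite_smul, one_smul, zero_smul]
  simp

lemma dX_q_mul (j : Fin (2 * n)) (b : A) :
    D.dX j (D.q * b) = D.w j * b + D.q * D.dX j b := by
  rw [q, mul_assoc, dX_zF_mul, dX_zF_mul, w]
  noncomm_ring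

lemma dX_q_pow_mul (j : Fin (2 * n)) (s : ℕ) (b : A) :
    D.dX j (D.q ^ s * b) = (s : ℝ) • (D.q ^ (s - 1) * (D.w j * b)) + D.q ^ s * D.dX j b := by
  induction s with
  | zero => simp
  | succ s ih =>
    rw [pow_succ', mul_assoc, dX_q_mul, ih, mul_add, Nat.add_sub_cancel, D.q_pow_left_comm,
      mul_smul_comm, ← mul_assoc D.q (D.q ^ s)]
    rcases Nat.eq_zero_or_pos s with rfl | hs
    · simp
    · rw [← mul_assoc D.q (D.q ^ (s - 1)), ← pow_succ', Nat.sub_add_cancel hs]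
      push_cast
      rw [add_smul, one_smul]
      abel

/-- The iterated left derivative along a list of fermionic indices, the first index acting
first. -/
def iterD : List (Fin (2 * n)) → A →ₗ[ℝ] A
  | [] => LinearMap.id
  | j :: l => (iterD l).comp (D.dX j)

/-- The Berezin integral as a linear map. -/
def ber : A →ₗ[ℝ] A := (Real.pi ^ n)⁻¹ • D.iterD (List.finRange (2 * n))

lemma foldl_dX (l : List (Fin (2 * n))) (a : A) :
    l.foldl (fun b j => D.dX j b) a = D.iterD l a := by
  induction l generalizing a with
  | nil => rfl
  | cons j l ih => rw [List.foldl_cons, ih]; rfl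

lemma iterD_dX (l : List (Fin (2 * n))) (j : Fin (2 * n)) (hj : j ∈ l) (b : A) :
    D.iterD l (D.dX j b) = 0 := by
  induction l generalizing b with
  | nil => simp at hj
  | cons i l ih =>
    change D.iterD l (D.dX i (D.dX j b)) = 0
    rcases eq_or_ne i j with rfl | h
    · rw [D.dX_self, map_zero]
    · rw [D.dX_comm, map_neg, ih (by simpa [h.symm] using hj), neg_zero]

/-- The Berezin integral of a fermionic derivative vanishes, since it contains each derivative once
and these have square zero. -/
lemma ber_dX (j : Fin (2 * n)) (b : A) : D.ber (D.dX j b) = 0 := by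
  simp [ber, D.iterD_dX _ j (List.mem_finRange j)]

lemma ber_eB_mul (k : Fin m) (b : A) : D.ber (D.eB k * b) = D.eB k * D.ber b := by
  have (l : List (Fin (2 * n))) (b : A) : D.iterD l (D.eB k * b) = D.eB k * D.iterD l b := by
    induction l generalizing b with
    | nil => rfl
    | cons i l ih =>
      change D.iterD l (D.dX i _) = D.eB k * D.iterD l (D.dX i b)
      rw [D.dX_eB, ih]
  simp [ber, this]

lemma sum_w (b : A) :
    ∑ i : Fin n, (D.w (fstIdx i) * (D.eF (sndIdx i) * b) - D.w (sndIdx i) * (D.eF (fstIdx i) * b))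
      = D.zF * b := by
  rw [zF, sum_pairs, Finset.sum_mul]
  refine Finset.sum_congr rfl fun i _ => ?_
  rw [w_fst, w_snd]
  noncomm_ring

/-- Integration by parts against an even power of `z`. -/
lemma ber_even_diracF (s : ℕ) (g : A) :
    D.ber (D.q ^ s * D.diracF g) = -(2 * s : ℝ) • D.ber (D.q ^ (s - 1) * (D.zF * g)) := by
  have key (j k : Fin (2 * n)) : D.q ^ s * (D.eF k * D.dX j g) = D.dX j (D.q ^ s * (D.eF k * g))
      - (s : ℝ) • (D.q ^ (s - 1) * (D.w j * (D.eF k * g))) := by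
    rw [dX_q_pow_mul, D.dX_eF]; abel
  rw [diracF, mul_smul_comm, map_smul, Finset.mul_sum, map_sum]
  simp only [mul_sub, key, map_sub, ber_dX, map_smul, zero_sub, sub_neg_eq_add]
  rw [← sum_w, Finset.mul_sum, map_sum, Finset.smul_sum, Finset.smul_sum]
  refine Finset.sum_congr rfl fun i _ => ?_
  rw [mul_sub, map_sub, smul_sub]
  module

/-- Integration by parts against an odd power of `z`. -/
lemma ber_odd_diracF (s : ℕ) (g : A) :
    D.ber (D.q ^ s * D.zF * D.diracF g) = (2 * n - 2 * s : ℝ) • D.ber (D.q ^ s * g) := by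
  have key (j k : Fin (2 * n)) : D.q ^ s * D.zF * (D.eF k * D.dX j g)
      = D.q ^ s * (D.eF j * D.eF k * g) - D.dX j (D.zF * (D.q ^ s * (D.eF k * g)))
      - (s : ℝ) • (D.q ^ (s - 1) * (D.zF * (D.w j * (D.eF k * g)))) := by
    rw [dX_zF_mul, dX_q_pow_mul, D.dX_eF, mul_add, mul_smul_comm, D.q_pow_left_comm s,
      D.q_pow_left_comm (s - 1), D.q_pow_left_comm s]
    simp only [mul_assoc]
    abel
  have hmix : ∑ i : Fin n, (D.q ^ s * (D.eF (fstIdx i) * D.eF (sndIdx i) * g)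
      - D.q ^ s * (D.eF (sndIdx i) * D.eF (fstIdx i) * g)) = (n : ℝ) • (D.q ^ s * g) := by
    simp only [← mul_sub, ← sub_mul, D.eF_mix]
    simp [← Nat.cast_smul_eq_nsmul ℝ]
  have hw : ∑ i : Fin n,
      ((s : ℝ) • (D.q ^ (s - 1) * (D.zF * (D.w (fstIdx i) * (D.eF (sndIdx i) * g))))
      - (s : ℝ) • (D.q ^ (s - 1) * (D.zF * (D.w (sndIdx i) * (D.eF (fstIdx i) * g)))))
      = (s : ℝ) • (D.q ^ s * g) := by
    simp only [← smul_sub, ← mul_sub]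
    rw [← Finset.smul_sum, ← Finset.mul_sum, ← Finset.mul_sum, sum_w, ← mul_assoc D.zF D.zF]
    change (s : ℝ) • (D.q ^ (s - 1) * (D.q * g)) = _
    rcases Nat.eq_zero_or_pos s with rfl | hs
    · simp
    · rw [← mul_assoc, ← pow_succ, Nat.sub_add_cancel hs]
  rw [diracF, mul_smul_comm, map_smul, Finset.mul_sum, map_sum]
  have hsum : ∀ i : Fin n, D.ber (D.q ^ s * D.zF *
        (D.eF (sndIdx i) * D.dX (fstIdx i) g - D.eF (fstIdx i) * D.dX (sndIdx i) g))
      = D.ber (D.q ^ s * (D.eF (fstIdx i) * D.eF (sndIdx i) * g)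
      - D.q ^ s * (D.eF (sndIdx i) * D.eF (fstIdx i) * g))
      - D.ber ((s : ℝ) • (D.q ^ (s - 1) * (D.zF * (D.w (fstIdx i) * (D.eF (sndIdx i) * g))))
      - (s : ℝ) • (D.q ^ (s - 1) * (D.zF * (D.w (sndIdx i) * (D.eF (fstIdx i) * g))))) := by
    intro i
    rw [mul_sub, key, key]
    simp only [map_sub, ber_dX, sub_zero]
    abel
  rw [Finset.sum_congr rfl fun i _ => hsum i, Finset.sum_sub_distrib, ← map_sum, ← map_sum, hmix,
    hw, map_smul, map_smul]
  module

/-! ### The fermionic delta distribution -/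

/-- The product of the pairs `z_{2i-1} z_{2i}` along a list. -/
def pairs (l : List (Fin n)) : A := (l.map fun i => D.z (fstIdx i) * D.z (sndIdx i)).prod

lemma z_mul_self (j : Fin (2 * n)) : D.z j * D.z j = 0 := D.z_sq j

lemma pair_comm (i : Fin n) (b : A) : Commute (D.z (fstIdx i) * D.z (sndIdx i)) b :=
  D.zz_comm _ _ b

lemma pair_sq (i : Fin n) :
    D.z (fstIdx i) * D.z (sndIdx i) * (D.z (fstIdx i) * D.z (sndIdx i)) = 0 := by
  rw [← mul_assoc, (D.pair_comm i _).eq, ← mul_assoc, z_mul_self, zero_mul, zero_mul]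

lemma _root_.Commute.add_pow_of_sq_zero {R : Type*} [Ring R] {a b : R} (h : Commute a b)
    (hb : b * b = 0) (k : ℕ) : (a + b) ^ (k + 1) = a ^ (k + 1) + (k + 1) • (a ^ k * b) := by
  induction k with
  | zero => simp
  | succ k ih =>
    have h1 : a ^ k * b * a = a ^ (k + 1) * b := by rw [mul_assoc, ← h.eq, ← mul_assoc, pow_succ]
    have h2 : a ^ k * b * b = 0 := by rw [mul_assoc, hb, mul_zero]
    rw [pow_succ, ih, add_mul, mul_add, mul_add, ← pow_succ, smul_mul_assoc, smul_mul_assoc, h1, h2,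
      smul_zero, add_zero, add_assoc, ← succ_nsmul']

/-- The top power of a sum of commuting elements of square zero. -/
lemma sum_pairs_pow (l : List (Fin n)) :
    (l.map fun i => D.z (fstIdx i) * D.z (sndIdx i)).sum ^ l.length
        = l.length.factorial • D.pairs l ∧
      (l.map fun i => D.z (fstIdx i) * D.z (sndIdx i)).sum ^ (l.length + 1) = 0 := by
  induction l with
  | nil => simp [pairs]
  | cons i l ih =>
    obtain ⟨h1, h2⟩ := ih
    rw [List.map_cons, List.sum_cons, add_comm, List.length_cons]
    have hc : Commute (l.map fun i => D.z (fstIdx i) * D.z (sndIdx i)).sum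
      (D.z (fstIdx i) * D.z (sndIdx i)) := (D.pair_comm i _).symm
    rw [hc.add_pow_of_sq_zero (D.pair_sq i), hc.add_pow_of_sq_zero (D.pair_sq i),
      pow_succ _ (_ + 1),
      h2, h1]
    refine ⟨?_, by simp⟩
    rw [pairs, pairs, List.map_cons, List.prod_cons, zero_add, smul_mul_assoc, smul_smul,
      Nat.factorial_succ, (D.pair_comm i _).eq]

lemma pairs_comm (l : List (Fin n)) (b : A) : Commute (D.pairs l) b := by
  induction l with
  | nil => exact Commute.one_left b
  | cons i l ih =>
    rw [pairs, List.map_cons, List.prod_cons]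
    exact (D.pair_comm i b).mul_left ih

lemma pairs_mul_z (l : List (Fin n)) (i : Fin n) (hi : i ∈ l) :
    D.pairs l * D.z (fstIdx i) = 0 ∧ D.pairs l * D.z (sndIdx i) = 0 := by
  induction l with
  | nil => simp at hi
  | cons k l ih =>
    rw [pairs, List.map_cons, List.prod_cons]
    change _ * D.pairs l * _ = 0 ∧ _ * D.pairs l * _ = 0
    rcases List.mem_cons.1 hi with rfl | h
    · rw [(D.pair_comm i _).eq, mul_assoc, (D.pair_comm i _).eq, ← mul_assoc (D.z _), z_mul_self,
        mul_assoc (D.pairs l), mul_assoc (D.z _), z_mul_self]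
      simp
    · rw [mul_assoc, mul_assoc _ _ (D.z (sndIdx i)), (ih h).1, (ih h).2]
      simp

lemma q_pow_top : D.q ^ n = n.factorial • D.pairs (List.finRange n) := by
  have := (D.sum_pairs_pow (List.finRange n)).1
  rw [List.length_finRange] at this
  rw [← this, q, zF_mul_zF]
  rw [← List.ofFn_eq_map, List.sum_ofFn]

lemma pairs_mul_x (j : Fin (2 * n)) :
    D.pairs (List.finRange n) * D.x j = D.pairs (List.finRange n) * D.y j := by
  have : D.pairs (List.finRange n) * D.z j = 0 := by
    obtain ⟨i, rfl | rfl⟩ := exists_pair j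
    · exact (D.pairs_mul_z _ i (List.mem_finRange i)).1
    · exact (D.pairs_mul_z _ i (List.mem_finRange i)).2
  rwa [z, mul_sub, sub_eq_zero] at this

/-- On the top power of `z`, the variables `x̀` may be replaced by `ỳ`. -/
lemma pairs_mul_prod (l : List (Fin (2 * n))) :
    D.pairs (List.finRange n) * (l.map D.x).prod
      = D.pairs (List.finRange n) * (l.map D.y).prod := by
  induction l with
  | nil => simp
  | cons j l ih =>
    rw [List.map_cons, List.prod_cons, List.map_cons, List.prod_cons, ← mul_assoc, pairs_mul_x,
      (D.pairs_comm _ _).eq, mul_assoc, ih, ← mul_assoc, ← (D.pairs_comm _ _).eq, mul_assoc]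

lemma dX_prod_y (j : Fin (2 * n)) (l : List (Fin (2 * n))) : D.dX j (l.map D.y).prod = 0 := by
  induction l with
  | nil => simp [D.dX_one]
  | cons k l ih => rw [List.map_cons, List.prod_cons, D.dX_y, ih, mul_zero, neg_zero]

lemma dX_prod_z (j : Fin (2 * n)) (l : List (Fin (2 * n))) (hj : j ∉ l) (Y : A)
    (hY : D.dX j Y = 0) : D.dX j ((l.map D.z).prod * Y) = 0 := by
  induction l with
  | nil => simpa using hY
  | cons k l ih =>
    rw [List.mem_cons, not_or] at hj
    rw [List.map_cons, List.prod_cons, mul_assoc, z, D.dX_z, ih hj.2]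
    simp [hj.1]

lemma iterD_prod_z (l : List (Fin (2 * n))) (hl : l.Nodup) (Y : A)
    (hY : ∀ j, D.dX j Y = 0) : D.iterD l ((l.map D.z).prod * Y) = Y := by
  induction l with
  | nil => simp [iterD]
  | cons k l ih =>
    rw [List.nodup_cons] at hl
    change D.iterD l (D.dX k _) = Y
    rw [List.map_cons, List.prod_cons, mul_assoc]
    have : D.dX k (D.z k * ((l.map D.z).prod * Y)) = (l.map D.z).prod * Y := by
      rw [z, D.dX_z, D.dX_prod_z k l hl.1 Y (hY k)]
      simp
    rw [this]
    exact ih hl.2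

lemma pairs_finRange : D.pairs (List.finRange n) = ((List.finRange (2 * n)).map D.z).prod := by
  rw [finRange_eq_flatMap, pairs]
  induction List.finRange n with
  | nil => simp
  | cons i l ih =>
    rw [List.map_cons, List.prod_cons, ih, List.flatMap_cons, List.map_append, List.prod_append]
    simp

/-- The top power of `z` is a multiple of the fermionic delta distribution. -/
lemma ber_top (l : List (Fin (2 * n))) :
    D.ber (D.q ^ n * (l.map D.x).prod)
      = (n.factorial * (Real.pi ^ n)⁻¹ : ℝ) • (l.map D.y).prod := by
  rw [q_pow_top, smul_mul_assoc, pairs_mul_prod, pairs_finRange, ber,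
    LinearMap.smul_apply, map_nsmul,
    iterD_prod_z _ _ (List.nodup_finRange _) _ fun j => D.dX_prod_y j l,
    ← Nat.cast_smul_eq_nsmul ℝ, smul_smul, mul_comm (Real.pi ^ n)⁻¹]

/-! ### The Cauchy kernel with arbitrary coefficients -/

/-- The kernel of the same shape as the fundamental solution, with the values `N k` in place of
`ν_{2k+2}` and `dN k i` in place of `∂_i ν_{2k+2}`. -/
def kernel (N : ℕ → ℝ) (dN : ℕ → Fin m → ℝ) : A :=
  Real.pi ^ n • ∑ k ∈ Finset.range n,
      (2 * (4 ^ k * (k.factorial : ℝ) / ((n - k - 1).factorial : ℝ)) * N k)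
        • D.zF ^ (2 * n - 2 * k - 1)
    + Real.pi ^ n • ∑ k ∈ Finset.range (n + 1),
      (4 ^ k * (k.factorial : ℝ) / ((n - k).factorial : ℝ))
        • ((-∑ j, dN k j • D.eB j) * D.zF ^ (2 * n - 2 * k))

/-- A symmetric matrix contracted with the `e_i e_j` gives minus its trace. -/
lemma sum_symm_eB_mul_eB (c : Fin m → Fin m → ℝ) (hc : ∀ i j, c i j = c j i) :
    ∑ i, ∑ j, c i j • (D.eB i * D.eB j) = -(∑ j, c j j) • 1 := by
  have h : (2 : ℝ) • ∑ i, ∑ j, c i j • (D.eB i * D.eB j)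
      = ∑ i, ∑ j, c i j • (D.eB i * D.eB j + D.eB j * D.eB i) := by
    rw [two_smul]
    nth_rewrite 2 [Finset.sum_comm]
    rw [← Finset.sum_add_distrib]
    refine Finset.sum_congr rfl fun i _ => ?_
    rw [← Finset.sum_add_distrib]
    refine Finset.sum_congr rfl fun j _ => ?_
    rw [hc j i, smul_add]
  simp only [D.eB_rel, smul_smul, ← Finset.sum_smul, mul_ite, mul_zero, Finset.sum_ite_eq,
    Finset.mem_univ, if_true] at h
  have := congrArg (fun t => (2⁻¹ : ℝ) • t) h
  simp only [smul_smul] at this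
  rw [← Finset.sum_mul] at this
  norm_num at this
  rw [this]
  module

lemma kernel_eq (N : ℕ → ℝ) (dN : ℕ → Fin m → ℝ) :
    D.kernel N dN = Real.pi ^ n • ∑ k ∈ Finset.range n,
      (2 * (4 ^ k * (k.factorial : ℝ) / ((n - k - 1).factorial : ℝ)) * N k)
        • (D.q ^ (n - k - 1) * D.zF)
    + Real.pi ^ n • ∑ k ∈ Finset.range (n + 1),
      (4 ^ k * (k.factorial : ℝ) / ((n - k).factorial : ℝ))
        • ((-∑ j, dN k j • D.eB j) * D.q ^ (n - k)) := by
  rw [kernel]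
  congr 2
  · refine Finset.sum_congr rfl fun k hk => ?_
    rw [Finset.mem_range] at hk
    rw [← zF_pow_odd, show 2 * (n - k - 1) + 1 = 2 * n - 2 * k - 1 by omega]
  · refine Finset.sum_congr rfl fun k hk => ?_
    rw [← zF_pow_even, show 2 * (n - k) = 2 * n - 2 * k by omega]

/-- Away from the singularity the super Dirac operator annihilates the kernel from the right: the
fermionic part of the operator, moved from `g` to the kernel under the Berezin integral, cancels
the bosonic part. The hypotheses on `ddN` express that the Hessians are symmetric and that
`∑_j ∂_j² ν_{2k+4} = -ν_{2k+2}` and `∑_j ∂_j² ν_2 = 0`. -/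
lemma ber_kernel_diracF (N : ℕ → ℝ) (dN : ℕ → Fin m → ℝ) (ddN : ℕ → Fin m → Fin m → ℝ)
    (hsymm : ∀ k i j, ddN k i j = ddN k j i) (h0 : ∑ j, ddN 0 j j = 0)
    (hsucc : ∀ k, ∑ j, ddN (k + 1) j j = -N k) (g : A) :
    D.ber (D.kernel N dN * D.diracF g)
      = -D.ber ((∑ j, D.kernel (fun k => dN k j) (fun k i => ddN k i j) * D.eB j) * g) := by
  have hL : D.ber (D.kernel N dN * D.diracF g) =
      Real.pi ^ n • ∑ k ∈ Finset.range n,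
        ((2 * (4 ^ k * (k.factorial : ℝ) / ((n - k - 1).factorial : ℝ)) * N k) * (2 * (k + 1)))
          • D.ber (D.q ^ (n - k - 1) * g)
      + Real.pi ^ n • ∑ k ∈ Finset.range n,
        (2 * (4 ^ k * (k.factorial : ℝ) / ((n - k - 1).factorial : ℝ)))
          • ((∑ j, dN k j • D.eB j) * D.ber (D.q ^ (n - k - 1) * (D.zF * g))) := by
    rw [kernel_eq, add_mul, map_add, smul_mul_assoc, smul_mul_assoc, Finset.sum_mul, Finset.sum_mul,
      map_smul, map_smul, map_sum, map_sum]
    congr 2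
    · refine Finset.sum_congr rfl fun k hk => ?_
      rw [Finset.mem_range] at hk
      rw [smul_mul_assoc, map_smul, ber_odd_diracF, smul_smul]
      congr 2
      rw [Nat.sub_sub, Nat.cast_sub (by omega)]
      push_cast; ring
    · rw [Finset.sum_range_succ]
      -- the `k = n` term has no fermionic factor, and the Berezin integral of `D.diracF g` vanishes
      have hlast : D.ber ((4 ^ n * (n.factorial : ℝ) / ((n - n).factorial : ℝ))
          • ((-∑ j, dN n j • D.eB j) * D.q ^ (n - n)) * D.diracF g) = 0 := by
        have h1 := D.ber_even_diracF 0 g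
        simp only [pow_zero, one_mul, Nat.cast_zero, mul_zero, neg_zero, zero_smul] at h1
        rw [smul_mul_assoc, map_smul, Nat.sub_self, pow_zero, mul_one, neg_mul, map_neg,
          Finset.sum_mul, map_sum]
        simp [ber_eB_mul, h1]
      rw [hlast, add_zero]
      refine Finset.sum_congr rfl fun k hk => ?_
      rw [Finset.mem_range] at hk
      have hfac : ((n - k).factorial : ℝ) = (n - k : ℝ) * ((n - k - 1).factorial : ℝ) := by
        rw [← Nat.cast_sub hk.le, ← Nat.cast_mul, Nat.mul_factorial_pred (by omega)]
      have hnk : (n - k : ℝ) ≠ 0 := by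
        rw [sub_ne_zero]; exact_mod_cast hk.ne'
      have h2 : D.ber ((∑ j, dN k j • D.eB j) * (D.q ^ (n - k) * D.diracF g))
          = -(2 * (n - k) : ℝ) •
            ((∑ j, dN k j • D.eB j) * D.ber (D.q ^ (n - k - 1) * (D.zF * g))) := by
        rw [Finset.sum_mul, Finset.sum_mul, map_sum, Finset.smul_sum]
        refine Finset.sum_congr rfl fun j _ => ?_
        rw [smul_mul_assoc, map_smul, ber_eB_mul, ber_even_diracF, Nat.cast_sub hk.le,
          smul_mul_assoc, mul_smul_comm, smul_comm]
      rw [smul_mul_assoc, map_smul, neg_mul, neg_mul, map_neg, mul_assoc, h2, hfac]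
      rw [neg_smul, neg_neg, smul_smul]
      congr 1
      field_simp
  have hR : (∑ j, D.kernel (fun k => dN k j) (fun k i => ddN k i j) * D.eB j) =
      -(Real.pi ^ n • ∑ k ∈ Finset.range n,
        (2 * (4 ^ k * (k.factorial : ℝ) / ((n - k - 1).factorial : ℝ)))
          • ((∑ j, dN k j • D.eB j) * (D.q ^ (n - k - 1) * D.zF)))
      - Real.pi ^ n • ∑ k ∈ Finset.range n,
        ((2 * (4 ^ k * (k.factorial : ℝ) / ((n - k - 1).factorial : ℝ)) * N k) * (2 * (k + 1)))
          • D.q ^ (n - k - 1) := by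
    simp only [kernel_eq, add_mul, Finset.sum_add_distrib, smul_mul_assoc, ← Finset.smul_sum,
      Finset.sum_mul]
    rw [sub_eq_add_neg]
    congr 1
    · rw [← smul_neg, Finset.sum_comm, ← Finset.sum_neg_distrib]
      congr 1
      refine Finset.sum_congr rfl fun k hk => ?_
      rw [← smul_neg, ← Finset.sum_neg_distrib, Finset.smul_sum]
      refine Finset.sum_congr rfl fun j _ => ?_
      have : D.q ^ (n - k - 1) * D.zF * D.eB j = -(D.eB j * (D.q ^ (n - k - 1) * D.zF)) := by
        rw [D.q_pow_left_comm, eB_mul_zF, mul_neg, neg_neg, mul_assoc]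
      rw [this, mul_smul, smul_neg]
    · rw [← smul_neg, Finset.sum_comm, ← Finset.sum_neg_distrib]
      congr 1
      have hk (k : ℕ) : ∑ j, (4 ^ k * (k.factorial : ℝ) / ((n - k).factorial : ℝ)) •
          ((-∑ i, ddN k i j • D.eB i) * D.q ^ (n - k) * D.eB j)
          = ((4 ^ k * (k.factorial : ℝ) / ((n - k).factorial : ℝ)) * ∑ j, ddN k j j)
            • D.q ^ (n - k) := by
        have h1 : ∑ j, (∑ i, ddN k i j • D.eB i) * D.eB j = -(∑ j, ddN k j j) • 1 := by
          rw [← D.sum_symm_eB_mul_eB _ (hsymm k), Finset.sum_comm]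
          refine Finset.sum_congr rfl fun j _ => ?_
          rw [Finset.sum_mul]
          simp only [smul_mul_assoc]
        rw [← Finset.smul_sum]
        simp only [neg_mul, mul_assoc, (D.q_pow_comm _ _).eq]
        rw [Finset.sum_neg_distrib]
        simp only [← mul_assoc]
        rw [← Finset.sum_mul, h1, neg_smul, neg_mul, neg_neg, smul_mul_assoc, one_mul, smul_smul]
      simp only [hk]
      -- the Laplacian lowers the index by one, which matches the two coefficient sequences
      rw [Finset.sum_range_succ', h0, mul_zero, zero_smul, add_zero]
      refine Finset.sum_congr rfl fun k hk => ?_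
      rw [hsucc, ← neg_smul, Nat.sub_sub, pow_succ, Nat.factorial_succ]
      congr 1
      push_cast
      ring
  rw [hL, hR, sub_mul, neg_mul, map_sub, map_neg, sub_eq_add_neg, neg_add, neg_neg, neg_neg,
    add_comm]
  simp only [smul_mul_assoc, Finset.sum_mul, map_smul, map_sum, ber_eB_mul, mul_assoc]

/-- The part of the kernel with `∇ν_2` carries the singularity of order `1 - m`. For
`∇ν_2 = v` and with `v` as the surface element, its Berezin integral turns `∏ x̀_a` into
`|v|² ∏ ỳ_a`. -/
lemma kernel_zero_part (v : Fin m → ℝ) (l : List (Fin (2 * n))) :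
    D.ber (∑ j, v j • (Real.pi ^ n • (1 / (n.factorial : ℝ))
        • ((-∑ i, v i • D.eB i) * D.q ^ n) * D.eB j * (l.map D.x).prod))
      = (∑ j, v j * v j) • (l.map D.y).prod := by
  have h1 : ∑ j, v j • (Real.pi ^ n • (1 / (n.factorial : ℝ))
        • ((-∑ i, v i • D.eB i) * D.q ^ n) * D.eB j * (l.map D.x).prod)
      = (-(Real.pi ^ n * (1 / (n.factorial : ℝ)))) •
        ((∑ i, ∑ j, (v i * v j) • (D.eB i * D.eB j)) * (D.q ^ n * (l.map D.x).prod)) := by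
    rw [Finset.sum_comm]
    simp only [Finset.sum_mul, Finset.smul_sum, neg_mul, smul_mul_assoc, smul_smul, smul_neg,
      neg_smul, Finset.sum_neg_distrib]
    congr 1
    refine Finset.sum_congr rfl fun j _ => Finset.sum_congr rfl fun i _ => ?_
    rw [mul_assoc (D.eB i), (D.q_pow_comm _ _).eq, mul_assoc, mul_assoc, mul_assoc]
    congr 1
    · ring
    · rw [mul_assoc]
  have hpi : Real.pi ^ n ≠ 0 := pow_ne_zero _ Real.pi_ne_zero
  have hf : (n.factorial : ℝ) ≠ 0 := by exact_mod_cast n.factorial_ne_zero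
  rw [h1, D.sum_symm_eB_mul_eB _ fun i j => mul_comm _ _, smul_mul_assoc, one_mul, map_smul,
    map_smul, ber_top, smul_smul, smul_smul]
  congr 1
  field_simp

end SuperCalculus

/-! ### The superalgebra of the Cauchy kernel -/

/-- The odd element of the Grassmann algebra given by a vector `v` of coefficients. -/
def gr (v : Fin (2 * n) ⊕ Fin (2 * n) → ℝ) : SuperAlg m n :=
  ExteriorAlgebra.ι ℝ v ⊗ₜ[ℝ] 1

/-- The embedding of the Clifford algebra `𝒞`. -/
def cl (c : Cliff m n) : SuperAlg m n := 1 ⊗ₜ[ℝ] c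

lemma gr_mul_self (v : Fin (2 * n) ⊕ Fin (2 * n) → ℝ) : (gr v * gr v : SuperAlg m n) = 0 := by
  simp [gr]

lemma gr_anticomm (v w : Fin (2 * n) ⊕ Fin (2 * n) → ℝ) :
    (gr v * gr w : SuperAlg m n) = -(gr w * gr v) := by
  have h : ExteriorAlgebra.ι ℝ v * ExteriorAlgebra.ι ℝ w
      = -(ExteriorAlgebra.ι ℝ w * ExteriorAlgebra.ι ℝ v) :=
    eq_neg_of_add_eq_zero_left (ExteriorAlgebra.ι_add_mul_swap v w)
  simp [gr, h, TensorProduct.neg_tmul]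

lemma gr_cl_comm (v : Fin (2 * n) ⊕ Fin (2 * n) → ℝ) (c : Cliff m n) :
    gr v * cl c = cl c * gr v := by
  simp [gr, cl]

lemma dX_gr_mul (j : Fin (2 * n)) (v : Fin (2 * n) ⊕ Fin (2 * n) → ℝ) (b : SuperAlg m n) :
    dX j (gr v * b) = v (Sum.inl j) • b - gr v * dX j b := by
  induction b using TensorProduct.induction_on with
  | zero => simp
  | add a b ha hb => rw [mul_add, map_add, ha, hb, map_add, mul_add, smul_add]; abel
  | tmul a c =>
    simp only [gr, dX, Algebra.TensorProduct.tmul_mul_tmul, one_mul, TensorProduct.map_tmul,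
      LinearMap.id_coe, id_eq]
    have := CliffordAlgebra.contractLeft_ι_mul
      (Q := (0 : QuadraticForm ℝ (Fin (2 * n) ⊕ Fin (2 * n) → ℝ)))
      (d := LinearMap.proj (Sum.inl j)) v a
    erw [this]
    rw [TensorProduct.sub_tmul, TensorProduct.smul_tmul']
    rfl

lemma dX_cl_mul (j : Fin (2 * n)) (c : Cliff m n) (b : SuperAlg m n) :
    dX j (cl c * b) = cl c * dX j b := by
  induction b using TensorProduct.induction_on with
  | zero => simp
  | add a b ha hb => rw [mul_add, map_add, ha, hb, map_add, mul_add]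
  | tmul a d => simp [cl, dX]

lemma dX_dX_comm (i j : Fin (2 * n)) (b : SuperAlg m n) : dX i (dX j b) = -dX j (dX i b) := by
  induction b using TensorProduct.induction_on with
  | zero => simp
  | add a b ha hb => simp only [map_add, ha, hb]; abel
  | tmul a d =>
    simp only [dX, TensorProduct.map_tmul]
    rw [CliffordAlgebra.contractLeft_comm, TensorProduct.neg_tmul]

lemma dX_dX_self (j : Fin (2 * n)) (b : SuperAlg m n) : dX j (dX j b) = 0 := by
  induction b using TensorProduct.induction_on with
  | zero => simp
  | add a b ha hb => simp only [map_add, ha, hb, add_zero]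
  | tmul a d =>
    simp only [dX, TensorProduct.map_tmul]
    rw [CliffordAlgebra.contractLeft_contractLeft, TensorProduct.zero_tmul]

lemma dX_one (j : Fin (2 * n)) : dX j (1 : SuperAlg m n) = 0 := by
  rw [Algebra.TensorProduct.one_def, dX, TensorProduct.map_tmul]
  have := CliffordAlgebra.contractLeft_one
      (Q := (0 : QuadraticForm ℝ (Fin (2 * n) ⊕ Fin (2 * n) → ℝ)))
      (d := LinearMap.proj (Sum.inl j))
  erw [this]
  simp

lemma xVar_sub_yVar (j : Fin (2 * n)) :
    (xVar j - yVar j : SuperAlg m n) = gr (Pi.single (Sum.inl j) 1 - Pi.single (Sum.inr j) 1) := by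
  simp [xVar, yVar, gr, TensorProduct.sub_tmul]

lemma cl_rel {a b : FreeAlgebra ℝ (Fin m ⊕ Fin (2 * n))} (h : CliffRel m n a b) :
    cl (RingQuot.mkAlgHom ℝ (CliffRel m n) a) = cl (RingQuot.mkAlgHom ℝ (CliffRel m n) b) := by
  rw [RingQuot.mkAlgHom_rel ℝ h]

lemma cl_mul (a b : Cliff m n) : cl (a * b) = cl a * cl b := by simp [cl]

lemma cl_add (a b : Cliff m n) : cl (a + b) = cl a + cl b := by simp [cl, TensorProduct.tmul_add]

lemma cl_sub (a b : Cliff m n) : cl (a - b) = cl a - cl b := by simp [cl, TensorProduct.tmul_sub]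

lemma cl_zero : cl (0 : Cliff m n) = 0 := by simp [cl]

lemma cl_algebraMap (r : ℝ) : cl (algebraMap ℝ (Cliff m n) r) = r • 1 := by
  simp [cl, Algebra.algebraMap_eq_smul_one, Algebra.TensorProduct.one_def]

lemma _root_.Commute.mul_left_of_anticomm {R : Type*} [Ring R] {a b c : R} (ha : a * c = -(c * a))
    (hb : b * c = -(c * b)) : Commute (a * b) c := by
  rw [Commute, SemiconjBy, mul_assoc, hb, mul_neg, ← mul_assoc, ha, neg_mul, neg_neg, mul_assoc]

/-- Products of two odd Grassmann elements are central. -/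
lemma gr_mul_gr_comm (v w : Fin (2 * n) ⊕ Fin (2 * n) → ℝ) (b : SuperAlg m n) :
    Commute (gr v * gr w) b := by
  have hcl (c : Cliff m n) : Commute (gr v * gr w) (cl c) :=
    Commute.mul_left (gr_cl_comm v c) (gr_cl_comm w c)
  have hgr (u : Fin (2 * n) ⊕ Fin (2 * n) → ℝ) : Commute (gr v * gr w : SuperAlg m n) (gr u) := by
    exact Commute.mul_left_of_anticomm (gr_anticomm v u) (gr_anticomm w u)
  induction b using TensorProduct.induction_on with
  | zero => exact Commute.zero_right _
  | add a b ha hb => exact ha.add_right hb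
  | tmul a c =>
    have : (a ⊗ₜ[ℝ] c : SuperAlg m n) = (a ⊗ₜ[ℝ] 1) * cl c := by simp [cl]
    rw [this]
    refine Commute.mul_right ?_ (hcl c)
    induction a using ExteriorAlgebra.induction with
    | algebraMap r =>
      have : (algebraMap ℝ _ r ⊗ₜ[ℝ] 1 : SuperAlg m n) = r • 1 := by
        rw [Algebra.algebraMap_eq_smul_one, Algebra.TensorProduct.one_def,
          TensorProduct.smul_tmul']
      rw [this]
      exact (Commute.one_right _).smul_right r
    | ι u => exact hgr u
    | add a b ha hb =>
      rw [TensorProduct.add_tmul]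
      exact Commute.add_right (ha (by simp [cl])) (hb (by simp [cl]))
    | mul a b ha hb =>
      have : ((a * b) ⊗ₜ[ℝ] 1 : SuperAlg m n) = (a ⊗ₜ[ℝ] 1) * (b ⊗ₜ[ℝ] 1) := by simp
      rw [this]
      exact Commute.mul_right (ha (by simp [cl])) (hb (by simp [cl]))

/-- The calculus in `Λ_{4n} ⊗ 𝒞`. -/
def superCalculus (m n : ℕ) : SuperCalculus m n (SuperAlg m n) where
  eB := eB
  eF := eF
  x := xVar
  y := yVar
  dX := dX
  eB_rel j k := by
    have := cl_rel (CliffRel.ortho (n := n) j k)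
    simp only [map_add, map_mul, cl_add, cl_mul, AlgHom.commutes, cl_algebraMap] at this
    exact this
  eB_eF j k := by
    have := cl_rel (CliffRel.anti (n := n) j k)
    simp only [map_add, map_mul, cl_add, cl_mul, map_zero, cl_zero] at this
    exact eq_neg_of_add_eq_zero_left this
  eF_snd_comm j k := by
    have := cl_rel (CliffRel.symp_snd (m := m) j k)
    simp only [map_sub, map_mul, cl_sub, cl_mul, map_zero, cl_zero] at this
    exact sub_eq_zero.1 this
  eF_fst_comm j k := by
    have := cl_rel (CliffRel.symp_fst (m := m) j k)
    simp only [map_sub, map_mul, cl_sub, cl_mul, map_zero, cl_zero] at this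
    exact sub_eq_zero.1 this
  eF_mix j k := by
    have := cl_rel (CliffRel.symp_mix (m := m) j k)
    simp only [map_sub, map_mul, cl_sub, cl_mul, AlgHom.commutes, cl_algebraMap] at this
    exact this
  z_sq j := by
    have := gr_mul_self (m := m) (Pi.single (Sum.inl j) 1 - Pi.single (Sum.inr j) 1)
    rw [← xVar_sub_yVar] at this
    exact this
  z_anti j k := by
    have := gr_anticomm (m := m) (Pi.single (Sum.inl j) 1 - Pi.single (Sum.inr j) 1)
      (Pi.single (Sum.inl k) 1 - Pi.single (Sum.inr k) 1)
    rw [← xVar_sub_yVar, ← xVar_sub_yVar] at this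
    exact this
  zz_comm j k b := by
    have := gr_mul_gr_comm (m := m) (Pi.single (Sum.inl j) 1 - Pi.single (Sum.inr j) 1)
      (Pi.single (Sum.inl k) 1 - Pi.single (Sum.inr k) 1) b
    rw [← xVar_sub_yVar, ← xVar_sub_yVar] at this
    exact this
  eF_z j k := by
    have := (gr_cl_comm (m := m) (Pi.single (Sum.inl k) 1 - Pi.single (Sum.inr k) 1)
      (RingQuot.mkAlgHom ℝ (CliffRel m n) (freeF m n j))).symm
    rw [← xVar_sub_yVar] at this
    exact this
  eB_z j k := by
    have := (gr_cl_comm (m := m) (Pi.single (Sum.inl k) 1 - Pi.single (Sum.inr k) 1)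
      (RingQuot.mkAlgHom ℝ (CliffRel m n) (freeB m n j))).symm
    rw [← xVar_sub_yVar] at this
    exact this
  dX_z j k b := by
    have := dX_gr_mul (m := m) j (Pi.single (Sum.inl k) 1 - Pi.single (Sum.inr k) 1) b
    rw [← xVar_sub_yVar] at this
    simpa [Pi.single_apply] using this
  dX_y j k b := by
    have := dX_gr_mul (m := m) j (Pi.single (Sum.inr k) 1) b
    simp only [ne_eq, reduceCtorEq, not_false_eq_true, Pi.single_eq_of_ne, zero_smul,
      zero_sub] at this
    exact this
  dX_eF j k b := dX_cl_mul j _ b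
  dX_eB j k b := dX_cl_mul j _ b
  dX_comm := dX_dX_comm
  dX_self := dX_dX_self
  dX_one := dX_one

lemma berezin_eq_ber (a : SuperAlg m n) : berezin a = (superCalculus m n).ber a := by
  rw [berezin]
  have := (superCalculus m n).foldl_dX (List.finRange (2 * n)) a
  exact congrArg (fun t => (Real.pi ^ n)⁻¹ • t) this

lemma xF_sub_yF : (xF - yF : SuperAlg m n) = (superCalculus m n).zF := by
  simp only [xF, yF, SuperCalculus.zF, ← Finset.sum_sub_distrib]
  exact Finset.sum_congr rfl fun j _ => (sub_mul _ _ _).symm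

lemma cauchyKernel_eq (x y : E m) : (cauchyKernel x y : SuperAlg m n) =
    (superCalculus m n).kernel (fun k => nuEven m (k + 1) (x - y))
      (fun k j => fderiv ℝ (nuEven m (k + 1)) (x - y) (EuclideanSpace.single j 1)) := by
  rw [cauchyKernel, xF_sub_yF]
  rfl

/-! ### The radial fundamental solutions -/

open Filter Topology

/-- The profile `s^a (A + B log s)`, where `s = ‖x‖²`, of which all the `ν_{2l}` and their
derivatives are made. -/
def radial (a A B s : ℝ) : ℝ := s ^ a * (A + B * Real.log s)

lemma hasDerivAt_radial (a A B : ℝ) {s : ℝ} (hs : 0 < s) :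
    HasDerivAt (radial a A B) (radial (a - 1) (a * A + B) (a * B) s) s := by
  have h := (Real.hasDerivAt_rpow_const (p := a) (Or.inl hs.ne')).mul
    (((Real.hasDerivAt_log hs.ne').const_mul B).const_add A)
  refine h.congr_deriv ?_
  have : s ^ a = s ^ (a - 1) * s := by
    rw [← Real.rpow_add_one hs.ne', sub_add_cancel]
  rw [radial, this]
  field_simp
  ring

lemma contDiffAt_radial (a A B : ℝ) {s : ℝ} (hs : 0 < s) : ContDiffAt ℝ ∞ (radial a A B) s :=
  (Real.contDiffAt_rpow_const_of_ne hs.ne').mul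
    (contDiffAt_const.add (contDiffAt_const.mul (Real.contDiffAt_log.2 hs.ne')))

lemma radial_mul_rpow (a A B b : ℝ) {s : ℝ} (hs : 0 < s) :
    s ^ b * radial a A B s = radial (a + b) A B s := by
  rw [radial, radial, Real.rpow_add hs]; ring

lemma tendsto_radial_zero {a : ℝ} (ha : 0 < a) (A B : ℝ) :
    Tendsto (radial a A B) (𝓝[>] 0) (𝓝 0) := by
  have h1 : Tendsto (fun s : ℝ => s ^ a) (𝓝[>] 0) (𝓝 0) := by
    have := (Real.continuousAt_rpow_const (0 : ℝ) a (Or.inr ha.le)).tendsto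
    rw [Real.zero_rpow ha.ne'] at this
    exact this.mono_left nhdsWithin_le_nhds
  have h2 := tendsto_log_mul_rpow_nhdsGT_zero ha
  have h3 := (h1.mul_const A).add (h2.const_mul B)
  rw [zero_mul, mul_zero, add_zero] at h3
  refine h3.congr fun s => ?_
  rw [radial]; ring

/-- The coefficient `A` of `ν_{2l} = s^{l - m/2} (A + B log s)`, `s = ‖x‖²`. -/
def nuA (m l : ℕ) : ℝ :=
  if Odd m ∨ 2 * l < m then
    Real.Gamma ((m : ℝ) / 2 - l) / (4 ^ l * Real.pi ^ ((m : ℝ) / 2) * (l - 1).factorial)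
  else
    2 * (-1) ^ (l - m / 2 + 1)
      / (4 ^ l * Real.pi ^ ((m : ℝ) / 2) * (l - 1).factorial * (l - m / 2).factorial)
      * -(((harmonic (l - m / 2) : ℝ) + (harmonic (l - 1) : ℝ)) / 2)

/-- The coefficient `B` of `ν_{2l} = s^{l - m/2} (A + B log s)`, `s = ‖x‖²`. -/
def nuB (m l : ℕ) : ℝ :=
  if Odd m ∨ 2 * l < m then 0
  else
    2 * (-1) ^ (l - m / 2 + 1)
      / (4 ^ l * Real.pi ^ ((m : ℝ) / 2) * (l - 1).factorial * (l - m / 2).factorial) / 2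

lemma nuEven_eq_radial (l : ℕ) {x : E m} (hx : x ≠ 0) :
    nuEven m l x = radial (l - m / 2) (nuA m l) (nuB m l) (‖x‖ ^ 2) := by
  have hx' : 0 < ‖x‖ := norm_pos_iff.2 hx
  rw [nuEven, nuA, nuB, radial]
  split_ifs with h
  · have : ‖x‖ ^ (2 * (l : ℤ) - (m : ℤ)) = (‖x‖ ^ 2) ^ ((l : ℝ) - m / 2) := by
      rw [← Real.rpow_natCast ‖x‖ 2, ← Real.rpow_mul hx'.le, ← Real.rpow_intCast]
      congr 1
      push_cast
      ring
    rw [this]; ring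
  · rw [not_or, Nat.not_odd_iff_even, not_lt] at h
    obtain ⟨⟨k, rfl⟩, h2⟩ := h
    have hk : (k + k) / 2 = k := by omega
    have hkl : k ≤ l := by omega
    have : ‖x‖ ^ (2 * (l - (k + k) / 2)) = (‖x‖ ^ 2) ^ ((l : ℝ) - ((k + k : ℕ) : ℝ) / 2) := by
      rw [pow_mul, hk, ← Real.rpow_natCast (‖x‖ ^ 2), Nat.cast_sub hkl]
      congr 1
      push_cast
      ring
    rw [this, Real.log_pow]
    push_cast
    ring

/-- The recurrence behind `∑_j ∂_j² ν_{2l+2} = -ν_{2l}`, coefficient of `1`. -/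
lemma nuA_rec (m : ℕ) {l : ℕ} (hl : 1 ≤ l) :
    4 * l * (((l + 1 : ℕ) - (m : ℝ) / 2) * nuA m (l + 1) + nuB m (l + 1))
      + 4 * (((l + 1 : ℕ) - (m : ℝ) / 2) * nuB m (l + 1)) = -nuA m l := by
  obtain ⟨k, rfl⟩ : ∃ k, l = k + 1 := ⟨l - 1, by omega⟩
  have hpi : Real.pi ^ ((m : ℝ) / 2) ≠ 0 := (Real.rpow_pos_of_pos Real.pi_pos _).ne'
  have hf : (k.factorial : ℝ) ≠ 0 := by exact_mod_cast k.factorial_ne_zero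
  have hk1 : (k + 1 : ℝ) ≠ 0 := by positivity
  have h4 : (4 : ℝ) ^ (k + 1) ≠ 0 := by positivity
  by_cases h1 : Odd m ∨ 2 * (k + 1 + 1) < m
  · have h2 : Odd m ∨ 2 * (k + 1) < m := h1.imp_right fun h => by omega
    have hne : (m : ℝ) / 2 - ((k + 1 + 1 : ℕ) : ℝ) ≠ 0 := by
      intro h
      have : (m : ℝ) = ((2 * (k + 1 + 1) : ℕ) : ℝ) := by push_cast; push_cast at h; linarith
      have : m = 2 * (k + 1 + 1) := by exact_mod_cast this
      rcases h1 with h1 | h1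
      · rw [this] at h1; exact (Nat.not_odd_iff_even.2 (even_two_mul _)) h1
      · omega
    have hG : Real.Gamma ((m : ℝ) / 2 - ((k + 1 : ℕ) : ℝ))
        = ((m : ℝ) / 2 - ((k + 1 + 1 : ℕ) : ℝ))
          * Real.Gamma ((m : ℝ) / 2 - ((k + 1 + 1 : ℕ) : ℝ)) := by
      rw [← Real.Gamma_add_one hne]; congr 1; push_cast; ring
    rw [nuA, nuB, nuA, if_pos h1, if_pos h1, if_pos h2, hG, Nat.add_sub_cancel, Nat.add_sub_cancel,
      Nat.factorial_succ, pow_succ 4 (k + 1)]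
    push_cast
    field_simp
    ring
  · rw [nuA, nuB, if_neg h1, if_neg h1, nuA]
    rw [not_or, Nat.not_odd_iff_even, not_lt] at h1
    obtain ⟨⟨q, rfl⟩, hq⟩ := h1
    have hq2 : (q + q) / 2 = q := by omega
    rw [hq2, Nat.add_sub_cancel, Nat.add_sub_cancel]
    have hqr : ((q + q : ℕ) : ℝ) / 2 = q := by push_cast; ring
    rw [hqr] at hpi ⊢
    by_cases h2 : Odd (q + q) ∨ 2 * (k + 1) < q + q
    · have h2' : q = k + 1 + 1 := by
        rcases h2 with h2 | h2
        · exact absurd ⟨q, rfl⟩ (Nat.not_even_iff_odd.2 h2)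
        · omega
      subst h2'
      rw [if_pos h2, Nat.sub_self, Nat.factorial_succ, pow_succ 4 (k + 1)]
      have : ((k + 1 + 1 : ℕ) : ℝ) - ((k + 1 : ℕ) : ℝ) = 1 := by push_cast; ring
      rw [this, Real.Gamma_one]
      push_cast at hpi ⊢
      simp only [sub_self, zero_mul, zero_add, mul_zero, add_zero, pow_one, Nat.factorial_zero]
      field_simp
      norm_num
    · rw [if_neg h2]
      rw [not_or, not_lt] at h2
      obtain ⟨p, hp⟩ : ∃ p, k + 1 = q + p := ⟨k + 1 - q, by omega⟩
      have h3 : k + 1 + 1 - q = p + 1 := by omega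
      have h4' : k + 1 - q = p := by omega
      have h5 : ((k + 1 + 1 : ℕ) : ℝ) - (q : ℝ) = p + 1 := by
        rw [hp]; push_cast; ring
      have hp1 : (p + 1 : ℝ) ≠ 0 := by positivity
      have hpf : (p.factorial : ℝ) ≠ 0 := by exact_mod_cast p.factorial_ne_zero
      rw [h5, h3, h4', Nat.factorial_succ, Nat.factorial_succ, harmonic_succ, harmonic_succ,
        pow_succ 4 (k + 1), pow_succ _ (p + 1)]
      push_cast
      field_simp
      ring

/-- The recurrence behind `∑_j ∂_j² ν_{2l+2} = -ν_{2l}`, coefficient of `log`. -/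
lemma nuB_rec (m : ℕ) {l : ℕ} (hl : 1 ≤ l) :
    4 * l * (((l + 1 : ℕ) - (m : ℝ) / 2) * nuB m (l + 1)) = -nuB m l := by
  obtain ⟨k, rfl⟩ : ∃ k, l = k + 1 := ⟨l - 1, by omega⟩
  have hpi : Real.pi ^ ((m : ℝ) / 2) ≠ 0 := (Real.rpow_pos_of_pos Real.pi_pos _).ne'
  have hf : (k.factorial : ℝ) ≠ 0 := by exact_mod_cast k.factorial_ne_zero
  have hk1 : (k + 1 : ℝ) ≠ 0 := by positivity
  have h4 : (4 : ℝ) ^ (k + 1) ≠ 0 := by positivity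
  rw [nuB, nuB]
  by_cases h1 : Odd m ∨ 2 * (k + 1 + 1) < m
  · have h2 : Odd m ∨ 2 * (k + 1) < m := h1.imp_right fun h => by omega
    simp [h1, h2]
  · rw [if_neg h1]
    rw [not_or, Nat.not_odd_iff_even, not_lt] at h1
    obtain ⟨⟨q, rfl⟩, hq⟩ := h1
    have hq2 : (q + q) / 2 = q := by omega
    rw [hq2, Nat.add_sub_cancel, Nat.add_sub_cancel]
    have hqr : ((q + q : ℕ) : ℝ) / 2 = q := by push_cast; ring
    rw [hqr] at hpi ⊢
    by_cases h2 : Odd (q + q) ∨ 2 * (k + 1) < q + q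
    · have h2' : q = k + 1 + 1 := by
        rcases h2 with h2 | h2
        · exact absurd ⟨q, rfl⟩ (Nat.not_even_iff_odd.2 h2)
        · omega
      subst h2'
      simp [h2]
    · rw [if_neg h2]
      rw [not_or, not_lt] at h2
      obtain ⟨p, hp⟩ : ∃ p, k + 1 = q + p := ⟨k + 1 - q, by omega⟩
      have h3 : k + 1 + 1 - q = p + 1 := by omega
      have h4' : k + 1 - q = p := by omega
      have h5 : ((k + 1 + 1 : ℕ) : ℝ) - (q : ℝ) = p + 1 := by
        rw [hp]; push_cast; ring
      have hp1 : (p + 1 : ℝ) ≠ 0 := by positivity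
      have hpf : (p.factorial : ℝ) ≠ 0 := by exact_mod_cast p.factorial_ne_zero
      rw [h5, h3, h4', Nat.factorial_succ, Nat.factorial_succ, pow_succ 4 (k + 1),
        pow_succ _ (p + 1)]
      push_cast
      field_simp

/-- A logarithm in `ν_2` occurs only for `m = 2`. This makes `ν_2` harmonic. -/
lemma nuB_one (m : ℕ) (hm : m ≠ 0) : (((1 : ℕ) : ℝ) - (m : ℝ) / 2) * nuB m 1 = 0 := by
  rw [nuB]
  split_ifs with h
  · simp
  · rw [not_or, Nat.not_odd_iff_even, not_lt] at h
    obtain ⟨⟨q, rfl⟩, hq⟩ := h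
    have : q = 1 := by omega
    subst this
    norm_num

/-- The normalization of `ν_2`: its flux through the unit sphere is `-1`. -/
lemma nu_flux (m : ℕ) (hm : m ≠ 0) :
    2 * ((((1 : ℕ) : ℝ) - (m : ℝ) / 2) * nuA m 1 + nuB m 1)
      * (m * volume.real (Metric.ball (0 : E m) 1)) = -1 := by
  have : Nonempty (Fin m) := ⟨⟨0, Nat.pos_of_ne_zero hm⟩⟩
  have hpi : Real.pi ^ ((m : ℝ) / 2) ≠ 0 := (Real.rpow_pos_of_pos Real.pi_pos _).ne'
  have hm' : (m : ℝ) ≠ 0 := by exact_mod_cast hm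
  have hm2 : (m : ℝ) / 2 ≠ 0 := by positivity
  have hG : Real.Gamma ((m : ℝ) / 2) ≠ 0 := (Real.Gamma_pos_of_pos (by positivity)).ne'
  have hvol : volume.real (Metric.ball (0 : E m) 1)
      = Real.pi ^ ((m : ℝ) / 2) / ((m : ℝ) / 2 * Real.Gamma ((m : ℝ) / 2)) := by
    have h1 : (√Real.pi) ^ m = Real.pi ^ ((m : ℝ) / 2) := by
      rw [Real.sqrt_eq_rpow, ← Real.rpow_natCast, ← Real.rpow_mul Real.pi_pos.le]
      congr 1; ring
    rw [Measure.real, EuclideanSpace.volume_ball, Fintype.card_fin, h1, Real.Gamma_add_one hm2]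
    simp only [ENNReal.ofReal_one, one_pow, one_mul]
    rw [ENNReal.toReal_ofReal]
    have := Real.Gamma_pos_of_pos (s := (m : ℝ) / 2) (by positivity)
    have := Real.pi_pos
    positivity
  rw [hvol, nuA, nuB]
  split_ifs with h
  · have hne : (m : ℝ) / 2 - ((1 : ℕ) : ℝ) ≠ 0 := by
      intro h0
      have : (m : ℝ) = ((2 : ℕ) : ℝ) := by push_cast; push_cast at h0; linarith
      have : m = 2 := by exact_mod_cast this
      subst this
      rcases h with h | h
      · exact absurd h (by decide)
      · omega
    have hG2 : Real.Gamma ((m : ℝ) / 2)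
        = ((m : ℝ) / 2 - ((1 : ℕ) : ℝ)) * Real.Gamma ((m : ℝ) / 2 - ((1 : ℕ) : ℝ)) := by
      rw [← Real.Gamma_add_one hne]; congr 1; push_cast; ring
    have hG3 : Real.Gamma ((m : ℝ) / 2 - ((1 : ℕ) : ℝ)) ≠ 0 := by
      intro h0; rw [h0, mul_zero] at hG2; exact hG hG2
    rw [hG2]
    push_cast at hne hG3 ⊢
    have hne' : (m : ℝ) - 2 ≠ 0 := by intro h0; apply hne; linarith
    generalize Real.Gamma ((m : ℝ) / 2 - 1) = G at hG3 ⊢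
    simp only [Nat.factorial_zero, Nat.cast_one, mul_one, pow_one, add_zero]
    field_simp
    ring
  · rw [not_or, Nat.not_odd_iff_even, not_lt] at h
    obtain ⟨⟨q, rfl⟩, hq⟩ := h
    have : q = 1 := by omega
    subst this
    norm_num at hpi ⊢
    field_simp
    norm_num

/-! ### Derivatives of the radial fundamental solutions -/

lemma hasFDerivAt_radial_norm_sq (a A B : ℝ) {x : E m} (hx : x ≠ 0) :
    HasFDerivAt (fun x : E m => radial a A B (‖x‖ ^ 2))
      (radial (a - 1) (a * A + B) (a * B) (‖x‖ ^ 2) • (2 • innerSL ℝ x)) x := by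
  have h := hasDerivAt_radial a A B (s := ‖x‖ ^ 2) (by positivity)
  exact h.comp_hasFDerivAt x (hasStrictFDerivAt_norm_sq x).hasFDerivAt

lemma contDiffAt_radial_norm_sq (a A B : ℝ) {x : E m} (hx : x ≠ 0) :
    ContDiffAt ℝ ∞ (fun x : E m => radial a A B (‖x‖ ^ 2)) x :=
  (contDiffAt_radial a A B (s := ‖x‖ ^ 2) (by positivity)).comp x (contDiff_norm_sq ℝ).contDiffAt

lemma nuEven_eventuallyEq (l : ℕ) {x : E m} (hx : x ≠ 0) :
    nuEven m l =ᶠ[𝓝 x] fun x => radial (l - m / 2) (nuA m l) (nuB m l) (‖x‖ ^ 2) := by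
  filter_upwards [isOpen_ne.mem_nhds hx] with z hz using nuEven_eq_radial l hz

lemma contDiffAt_nuEven (l : ℕ) {x : E m} (hx : x ≠ 0) : ContDiffAt ℝ ∞ (nuEven m l) x :=
  (contDiffAt_radial_norm_sq _ _ _ hx).congr_of_eventuallyEq (nuEven_eventuallyEq l hx)

/-- The first profile derivative of `ν_{2l}`. -/
def nuDeriv (m l : ℕ) (s : ℝ) : ℝ :=
  radial ((l : ℝ) - m / 2 - 1) (((l : ℝ) - m / 2) * nuA m l + nuB m l)
    (((l : ℝ) - m / 2) * nuB m l) s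

/-- The second profile derivative of `ν_{2l}`. -/
def nuDeriv₂ (m l : ℕ) (s : ℝ) : ℝ :=
  radial ((l : ℝ) - m / 2 - 1 - 1)
    (((l : ℝ) - m / 2 - 1) * (((l : ℝ) - m / 2) * nuA m l + nuB m l)
      + ((l : ℝ) - m / 2) * nuB m l)
    (((l : ℝ) - m / 2 - 1) * (((l : ℝ) - m / 2) * nuB m l)) s

lemma fderiv_nuEven (l : ℕ) {x : E m} (hx : x ≠ 0) (i : Fin m) :
    fderiv ℝ (nuEven m l) x (EuclideanSpace.single i 1) = 2 * x i * nuDeriv m l (‖x‖ ^ 2) := by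
  have h := (hasFDerivAt_radial_norm_sq (l - m / 2) (nuA m l) (nuB m l)
    hx).congr_of_eventuallyEq (nuEven_eventuallyEq l hx)
  rw [h.fderiv, nuDeriv]
  simp only [_root_.smul_apply, innerSL_apply_apply, smul_eq_mul, nsmul_eq_mul]
  rw [EuclideanSpace.inner_single_right]
  simp
  ring

lemma contDiffAt_fderiv_nuEven (l : ℕ) {x : E m} (hx : x ≠ 0) (i : Fin m) :
    ContDiffAt ℝ 1 (fun x => fderiv ℝ (nuEven m l) x (EuclideanSpace.single i 1)) x := by
  have h : ContDiffAt ℝ 1 (fun x => fderiv ℝ (nuEven m l) x) x :=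
    (contDiffAt_nuEven l hx).fderiv_right (by norm_cast)
  exact h.clm_apply contDiffAt_const

lemma fderiv_fderiv_nuEven (l : ℕ) {x : E m} (hx : x ≠ 0) (i j : Fin m) :
    fderiv ℝ (fun x => fderiv ℝ (nuEven m l) x (EuclideanSpace.single i 1)) x
        (EuclideanSpace.single j 1)
      = (if i = j then 2 * nuDeriv m l (‖x‖ ^ 2) else 0)
        + 4 * x i * x j * nuDeriv₂ m l (‖x‖ ^ 2) := by
  have hev : (fun x => fderiv ℝ (nuEven m l) x (EuclideanSpace.single i 1))
      =ᶠ[𝓝 x] fun x => 2 * (EuclideanSpace.proj i x * nuDeriv m l (‖x‖ ^ 2)) := by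
    filter_upwards [isOpen_ne.mem_nhds hx] with z hz
    rw [fderiv_nuEven l hz, mul_assoc]; rfl
  have h := (((EuclideanSpace.proj i : E m →L[ℝ] ℝ).hasFDerivAt (x := x)).mul
    (hasFDerivAt_radial_norm_sq ((l : ℝ) - m / 2 - 1) (((l : ℝ) - m / 2) * nuA m l + nuB m l)
      (((l : ℝ) - m / 2) * nuB m l) hx)).const_mul 2
  rw [(h.congr_of_eventuallyEq hev).fderiv, nuDeriv, nuDeriv₂]
  simp only [_root_.smul_apply, _root_.add_apply, innerSL_apply_apply,
    smul_eq_mul, nsmul_eq_mul]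
  rw [EuclideanSpace.inner_single_right]
  have hp (v : E m) : (EuclideanSpace.proj i : E m →L[ℝ] ℝ) v = v i := rfl
  rw [hp, hp, PiLp.single_apply, RCLike.conj_to_real]
  split_ifs <;> ring

/-- The Laplacian of `ν_{2l}` in terms of its profile. -/
lemma sum_fderiv_fderiv_nuEven (l : ℕ) {x : E m} (hx : x ≠ 0) :
    ∑ j, fderiv ℝ (fun x => fderiv ℝ (nuEven m l) x (EuclideanSpace.single j 1)) x
        (EuclideanSpace.single j 1)
      = radial ((l : ℝ) - m / 2 - 1)
          (4 * (l - 1) * (((l : ℝ) - m / 2) * nuA m l + nuB m l)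
            + 4 * (((l : ℝ) - m / 2) * nuB m l))
          (4 * (l - 1) * (((l : ℝ) - m / 2) * nuB m l)) (‖x‖ ^ 2) := by
  have hs : (0 : ℝ) < ‖x‖ ^ 2 := by positivity
  have hsum : ∑ j, x j * x j = ‖x‖ ^ 2 := by
    rw [EuclideanSpace.norm_sq_eq]; simp [pow_two]
  simp only [fderiv_fderiv_nuEven l hx, if_true, Finset.sum_add_distrib]
  have : ∑ j, 4 * x j * x j * nuDeriv₂ m l (‖x‖ ^ 2) = 4 * ‖x‖ ^ 2 * nuDeriv₂ m l (‖x‖ ^ 2) := by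
    rw [← hsum, Finset.mul_sum, Finset.sum_mul]
    simp only [mul_assoc]
  rw [this, Finset.sum_const, Finset.card_univ, Fintype.card_fin, nsmul_eq_mul, nuDeriv, nuDeriv₂,
    radial, radial, radial]
  have hp : (‖x‖ ^ 2) ^ ((l : ℝ) - m / 2 - 1)
      = (‖x‖ ^ 2) ^ ((l : ℝ) - m / 2 - 1 - 1) * ‖x‖ ^ 2 := by
    rw [← Real.rpow_add_one hs.ne', sub_add_cancel]
  rw [hp]
  ring

lemma laplacian_nuEven_one (hm : m ≠ 0) {x : E m} (hx : x ≠ 0) :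
    ∑ j, fderiv ℝ (fun x => fderiv ℝ (nuEven m 1) x (EuclideanSpace.single j 1)) x
        (EuclideanSpace.single j 1) = 0 := by
  rw [sum_fderiv_fderiv_nuEven 1 hx, nuB_one m hm, radial]
  simp

lemma laplacian_nuEven_succ {l : ℕ} (hl : 1 ≤ l) {x : E m} (hx : x ≠ 0) :
    ∑ j, fderiv ℝ (fun x => fderiv ℝ (nuEven m (l + 1)) x (EuclideanSpace.single j 1)) x
        (EuclideanSpace.single j 1) = -nuEven m l x := by
  rw [sum_fderiv_fderiv_nuEven (l + 1) hx, nuEven_eq_radial l hx]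
  have h1 := nuA_rec m hl
  have h2 := nuB_rec m hl
  have hc : ((l + 1 : ℕ) : ℝ) - 1 = l := by push_cast; ring
  rw [hc, h1, h2, radial, radial]
  have : ((l + 1 : ℕ) : ℝ) - (m : ℝ) / 2 - 1 = l - m / 2 := by push_cast; ring
  rw [this]
  ring

lemma fderiv_fderiv_nuEven_symm (l : ℕ) {x : E m} (hx : x ≠ 0) (i j : Fin m) :
    fderiv ℝ (fun x => fderiv ℝ (nuEven m l) x (EuclideanSpace.single i 1)) x
        (EuclideanSpace.single j 1)
      = fderiv ℝ (fun x => fderiv ℝ (nuEven m l) x (EuclideanSpace.single j 1)) x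
        (EuclideanSpace.single i 1) := by
  rw [fderiv_fderiv_nuEven l hx, fderiv_fderiv_nuEven l hx]
  simp only [eq_comm (a := i)]
  ring

/-! ### Behaviour at the singularity -/

lemma tendsto_norm_sq_nhdsNE : Tendsto (fun x : E m => ‖x‖ ^ 2) (𝓝[≠] 0) (𝓝[>] 0) := by
  rw [tendsto_nhdsWithin_iff]
  constructor
  · have : Continuous fun x : E m => ‖x‖ ^ 2 := by fun_prop
    simpa using (this.tendsto 0).mono_left nhdsWithin_le_nhds
  · filter_upwards [self_mem_nhdsWithin] with x hx
    have : 0 < ‖x‖ := norm_pos_iff.2 hx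
    exact pow_pos this 2

lemma norm_pow_mul_radial (k : ℕ) (a A B : ℝ) {x : E m} (hx : x ≠ 0) :
    ‖x‖ ^ k * radial a A B (‖x‖ ^ 2) = radial (a + k / 2) A B (‖x‖ ^ 2) := by
  rw [← radial_mul_rpow a A B (k / 2) (by positivity), ← Real.rpow_natCast ‖x‖ 2,
    ← Real.rpow_mul (norm_nonneg x), ← Real.rpow_natCast ‖x‖ k]
  congr 2
  push_cast; ring

lemma tendsto_norm_pow_mul_nuEven (hm : m ≠ 0) {l : ℕ} (hl : 1 ≤ l) :
    Tendsto (fun x : E m => ‖x‖ ^ (m - 1) * nuEven m l x) (𝓝[≠] 0) (𝓝 0) := by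
  have hl' : (1 : ℝ) ≤ l := by exact_mod_cast hl
  have h := (tendsto_radial_zero (a := l - 1 / 2) (by linarith) (nuA m l)
    (nuB m l)).comp (tendsto_norm_sq_nhdsNE (m := m))
  refine h.congr' ?_
  filter_upwards [self_mem_nhdsWithin] with x hx
  rw [nuEven_eq_radial l hx, norm_pow_mul_radial _ _ _ _ hx, Nat.cast_sub (Nat.pos_of_ne_zero hm)]
  change radial _ _ _ _ = _
  congr 1
  push_cast; ring

lemma norm_pow_mul_nuDeriv (l : ℕ) {x : E m} (hx : x ≠ 0) :
    ‖x‖ ^ m * nuDeriv m l (‖x‖ ^ 2) = radial (l - 1)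
      (((l : ℝ) - m / 2) * nuA m l + nuB m l) (((l : ℝ) - m / 2) * nuB m l) (‖x‖ ^ 2) := by
  rw [nuDeriv, norm_pow_mul_radial _ _ _ _ hx]
  congr 1; ring

lemma tendsto_norm_pow_mul_fderiv_nuEven (hm : m ≠ 0) {l : ℕ} (hl : 2 ≤ l) (i : Fin m) :
    Tendsto (fun x : E m => ‖x‖ ^ (m - 1) *
      fderiv ℝ (nuEven m l) x (EuclideanSpace.single i 1)) (𝓝[≠] 0) (𝓝 0) := by
  have hl' : (2 : ℝ) ≤ l := by exact_mod_cast hl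
  have h := ((tendsto_radial_zero (a := l - 1) (by linarith)
    (((l : ℝ) - m / 2) * nuA m l + nuB m l) (((l : ℝ) - m / 2) * nuB m l)).comp
    (tendsto_norm_sq_nhdsNE (m := m))).norm.const_mul 2
  rw [norm_zero, mul_zero] at h
  refine squeeze_zero_norm' ?_ h
  filter_upwards [self_mem_nhdsWithin] with x hx
  rw [fderiv_nuEven l hx, Function.comp_apply, ← norm_pow_mul_nuDeriv l hx]
  have hxi : ‖x i‖ ≤ ‖x‖ := PiLp.norm_apply_le x i
  have : ‖x‖ ^ m = ‖x‖ ^ (m - 1) * ‖x‖ := by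
    rw [← pow_succ, Nat.sub_add_cancel (Nat.pos_of_ne_zero hm)]
  rw [this, norm_mul, norm_mul, norm_mul, norm_mul, norm_mul, norm_pow, norm_norm]
  simp only [Real.norm_ofNat]
  have h3 : ‖x‖ ^ (m - 1) * ‖nuDeriv m l (‖x‖ ^ 2)‖ * ‖x i‖
      ≤ ‖x‖ ^ (m - 1) * ‖nuDeriv m l (‖x‖ ^ 2)‖ * ‖x‖ := by gcongr
  linarith

/-- The gradient of `ν_2` is `-x / (ω ‖x‖^m)`, with `ω` the surface area of the unit sphere. -/
lemma norm_pow_mul_fderiv_nuEven_one (hm : m ≠ 0) {x : E m} (hx : x ≠ 0) (i : Fin m) :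
    ‖x‖ ^ m * fderiv ℝ (nuEven m 1) x (EuclideanSpace.single i 1)
      = -(x i / (m * volume.real (Metric.ball (0 : E m) 1))) := by
  have hfl := nu_flux m hm
  have hw : (m * volume.real (Metric.ball (0 : E m) 1)) ≠ 0 := by
    intro h; rw [h, mul_zero] at hfl; norm_num at hfl
  rw [fderiv_nuEven 1 hx, mul_left_comm, norm_pow_mul_nuDeriv 1 hx, radial]
  rw [Nat.cast_one, sub_self, Real.rpow_zero, one_mul]
  have h0 := nuB_one m hm
  rw [Nat.cast_one] at h0 hfl
  rw [h0, zero_mul, add_zero, eq_neg_iff_add_eq_zero]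
  generalize (m * volume.real (Metric.ball (0 : E m) 1)) = w at hfl hw ⊢
  field_simp
  linear_combination (x i) * hfl

/-! ### The area formula for graphs -/

open Filter Topology Module
open scoped NNReal ENNReal

section Area

lemma euclideanHausdorffMeasure_image_le {X Y : Type*} [EMetricSpace X] [MeasurableSpace X]
    [BorelSpace X] [EMetricSpace Y] [MeasurableSpace Y] [BorelSpace Y] {K : ℝ≥0} {f : X → Y}
    {s : Set X} (h : LipschitzOnWith K f s) (d : ℕ) :
    μHE[d] (f '' s) ≤ (K : ℝ≥0∞) ^ d * μHE[d] s := by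
  have := h.hausdorffMeasure_image_le (d := d) (by positivity)
  rw [ENNReal.rpow_natCast] at this
  simp only [Measure.euclideanHausdorffMeasure_def, Measure.smul_apply,
    Measure.nnreal_smul_coe_apply]
  rw [mul_left_comm]
  gcongr

/-- If distances in the image of `f` are at most `K` times those in the image of `g`, then the
same holds for Hausdorff measures, up to the power `K ^ d`. -/
lemma euclideanHausdorffMeasure_image_le_image {X Y Z : Type*} [EMetricSpace X]
    [EMetricSpace Y] [MeasurableSpace Y] [BorelSpace Y] [EMetricSpace Z] [MeasurableSpace Z]
    [BorelSpace Z] {K : ℝ≥0} {f : X → Y} {g : X → Z} {s : Set X}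
    (h : ∀ a ∈ s, ∀ b ∈ s, edist (f a) (f b) ≤ K * edist (g a) (g b)) (d : ℕ) :
    μHE[d] (f '' s) ≤ (K : ℝ≥0∞) ^ d * μHE[d] (g '' s) := by
  rcases s.eq_empty_or_nonempty with rfl | ⟨x0, hx0⟩
  · simp
  have : Nonempty X := ⟨x0⟩
  have hmem : ∀ z ∈ g '' s, Function.invFunOn g s z ∈ s := fun z hz => Function.invFunOn_mem hz
  have heq : ∀ z ∈ g '' s, g (Function.invFunOn g s z) = z := fun z hz => Function.invFunOn_eq hz
  have hL : LipschitzOnWith K (fun z => f (Function.invFunOn g s z)) (g '' s) := by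
    intro a ha b hb
    have := h _ (hmem a ha) _ (hmem b hb)
    rwa [heq a ha, heq b hb] at this
  have hsub : f '' s ⊆ (fun z => f (Function.invFunOn g s z)) '' (g '' s) := by
    rintro _ ⟨x, hx, rfl⟩
    refine ⟨g x, ⟨x, hx, rfl⟩, ?_⟩
    have hgx : g x ∈ g '' s := ⟨x, hx, rfl⟩
    have := h _ (hmem _ hgx) x hx
    rw [heq _ hgx, edist_self, mul_zero] at this
    exact edist_le_zero.1 this
  exact (measure_mono hsub).trans (euclideanHausdorffMeasure_image_le hL d)

variable {U V : Type*} [NormedAddCommGroup U] [InnerProductSpace ℝ U] [FiniteDimensional ℝ U]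
  [MeasurableSpace U] [BorelSpace U] [NormedAddCommGroup V] [InnerProductSpace ℝ V]
  [MeasurableSpace V] [BorelSpace V]

/-- On small balls around a point of strict differentiability, a map with expanding derivative `L`
scales the Hausdorff measure nearly as `L` does. -/
lemma eventually_measure_image_closedBall {Φ : U → V} {L : U →L[ℝ] V} {w : U}
    (hΦ : HasStrictFDerivAt Φ L w) (hL : ∀ u, ‖u‖ ≤ ‖L u‖) {ε : ℝ≥0} (hε0 : 0 < ε) (hε : ε < 1) :
    ∀ᶠ r in 𝓝[>] (0 : ℝ),
      μHE[finrank ℝ U] (Φ '' Metric.closedBall w r)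
          ≤ ((1 + ε : ℝ≥0) : ℝ≥0∞) ^ finrank ℝ U
            * (ENNReal.ofReal L.normDet * volume (Metric.closedBall w r)) ∧
      ENNReal.ofReal L.normDet * volume (Metric.closedBall w r)
        ≤ (((1 - ε)⁻¹ : ℝ≥0) : ℝ≥0∞) ^ finrank ℝ U
          * μHE[finrank ℝ U] (Φ '' Metric.closedBall w r) := by
  have h1 : ∀ᶠ p : U × U in 𝓝 (w, w), ‖Φ p.1 - Φ p.2 - L (p.1 - p.2)‖ ≤ ε * ‖p.1 - p.2‖ :=
    hΦ.isLittleO.bound hε0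
  obtain ⟨δ, hδ, hball⟩ := Metric.eventually_nhds_iff_ball.1 h1
  filter_upwards [Ioo_mem_nhdsGT hδ] with r hr
  have hest : ∀ a ∈ Metric.closedBall w r, ∀ b ∈ Metric.closedBall w r,
      ‖Φ a - Φ b - L (a - b)‖ ≤ ε * ‖L (a - b)‖ := by
    intro a ha b hb
    have hab : (a, b) ∈ Metric.ball (w, w) δ := by
      rw [← ball_prod_same]
      exact ⟨Metric.closedBall_subset_ball hr.2 ha, Metric.closedBall_subset_ball hr.2 hb⟩
    exact (hball _ hab).trans (mul_le_mul_of_nonneg_left (hL _) ε.2)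
  have hvol : ENNReal.ofReal L.normDet * volume (Metric.closedBall w r)
      = μHE[finrank ℝ U] (L '' Metric.closedBall w r) :=
    (LinearMap.euclideanHausdorffMeasure_image_eq_normDet_mul_volume L.toLinearMap _).symm
  rw [hvol]
  have key : ∀ {x y : V} {x' y' : V} {K : ℝ≥0}, ‖x - y‖ ≤ K * ‖x' - y'‖ →
      edist x y ≤ K * edist x' y' := by
    intro x y x' y' K h
    rw [edist_nndist, edist_nndist, ← ENNReal.coe_mul, ENNReal.coe_le_coe, ← NNReal.coe_le_coe,
      NNReal.coe_mul, coe_nndist, coe_nndist, dist_eq_norm, dist_eq_norm]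
    exact h
  constructor
  · refine euclideanHausdorffMeasure_image_le_image (fun a ha b hb => key ?_) _
    have := hest a ha b hb
    rw [map_sub] at this
    have h2 := norm_add_le (Φ a - Φ b - (L a - L b)) (L a - L b)
    rw [sub_add_cancel] at h2
    push_cast
    linarith
  · refine euclideanHausdorffMeasure_image_le_image (fun a ha b hb => key ?_) _
    have := hest a ha b hb
    rw [map_sub] at this
    have h2 := norm_sub_norm_le (L a - L b) (Φ a - Φ b)
    rw [norm_sub_rev (L a - L b)] at h2
    have h1ε : (0 : ℝ) < 1 - ε := by
      have : (ε : ℝ) < 1 := by exact_mod_cast hε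
      linarith
    rw [NNReal.coe_inv, NNReal.coe_sub hε.le, NNReal.coe_one, inv_mul_eq_div, le_div_iff₀ h1ε]
    linarith

/-- The area formula for a graph, that is for a parametrization `Φ` of a surface that is inverted by
a projection `P`: `P` transports the surface measure to `J` times Lebesgue measure, with
`J` the Jacobian of `Φ`. -/
theorem map_euclideanHausdorffMeasure_graph {Φ : U → V} {P : V → U} {W : Set U} (hW : IsOpen W)
    (hP : Measurable P) (hPΦ : ∀ w ∈ W, P (Φ w) = w)
    {K : ℝ≥0} (hK : LipschitzOnWith K Φ W) {L : U → U →L[ℝ] V}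
    (hΦ : ∀ w ∈ W, HasStrictFDerivAt Φ (L w) w) (hL : ∀ w ∈ W, ∀ u, ‖u‖ ≤ ‖L w u‖) :
    Measure.map P (μHE[finrank ℝ U].restrict (Φ '' W))
      = (volume.restrict W).withDensity fun w => ENNReal.ofReal (L w).normDet := by
  -- the image measure `κ` is absolutely continuous, so it is enough to find its density at almost
  -- every point, by differentiation along balls
  set d := finrank ℝ U with hd
  set κ := Measure.map P (μHE[d].restrict (Φ '' W)) with hκ
  have hκ_apply : ∀ A, MeasurableSet A → κ A = μHE[d] (Φ '' (A ∩ W)) := by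
    intro A hA
    rw [hκ, Measure.map_apply hP hA, Measure.restrict_apply (hP hA)]
    congr 1
    ext x
    constructor
    · rintro ⟨hx, w, hw, rfl⟩
      exact ⟨w, ⟨by simpa [hPΦ w hw] using hx, hw⟩, rfl⟩
    · rintro ⟨w, ⟨hwA, hw⟩, rfl⟩
      exact ⟨by simpa [hPΦ w hw] using hwA, w, hw, rfl⟩
  have hκ_le : ∀ A, MeasurableSet A → κ A ≤ (K : ℝ≥0∞) ^ d * volume A := by
    intro A hA
    rw [hκ_apply A hA]
    refine (euclideanHausdorffMeasure_image_le (hK.mono Set.inter_subset_right) d).trans ?_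
    rw [hd, InnerProductSpace.euclideanHausdorffMeasure_eq_volume]
    gcongr
    exact Set.inter_subset_left
  have hac : κ ≪ volume := by
    refine Measure.AbsolutelyContinuous.mk fun A hA h0 => ?_
    have := hκ_le A hA
    rw [h0, mul_zero] at this
    exact le_antisymm this bot_le
  have hfin : IsLocallyFiniteMeasure κ := by
    constructor
    intro w
    refine ⟨Metric.ball w 1, Metric.ball_mem_nhds w one_pos,
      (hκ_le _ measurableSet_ball).trans_lt ?_⟩
    exact ENNReal.mul_lt_top (ENNReal.pow_lt_top ENNReal.coe_lt_top) measure_ball_lt_top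
  have hrn : ∀ᵐ w, w ∈ W → κ.rnDeriv volume w = ENNReal.ofReal (L w).normDet := by
    filter_upwards [Besicovitch.ae_tendsto_rnDeriv κ (volume : Measure U)] with w hw hwW
    have hsub : ∀ᶠ r in 𝓝[>] (0 : ℝ), Metric.closedBall w r ⊆ W := by
      obtain ⟨δ, hδ, hb⟩ := Metric.isOpen_iff.1 hW w hwW
      filter_upwards [Ioo_mem_nhdsGT hδ] with r hr
      exact (Metric.closedBall_subset_ball hr.2).trans hb
    set c := κ.rnDeriv volume w with hc
    set J := ENNReal.ofReal (L w).normDet with hJ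
    have hbounds : ∀ ε : ℝ≥0, 0 < ε → ε < 1 →
        c ≤ ((1 + ε : ℝ≥0) : ℝ≥0∞) ^ d * J ∧ J ≤ (((1 - ε)⁻¹ : ℝ≥0) : ℝ≥0∞) ^ d * c := by
      intro ε hε0 hε1
      have hev := eventually_measure_image_closedBall (hΦ w hwW) (hL w hwW) hε0 hε1
      have hpos : ∀ᶠ r in 𝓝[>] (0 : ℝ), volume (Metric.closedBall w r) ≠ 0 ∧
          volume (Metric.closedBall w r) ≠ ⊤ := by
        filter_upwards [self_mem_nhdsWithin] with r hr
        exact ⟨(Metric.measure_closedBall_pos volume w hr).ne', measure_closedBall_lt_top.ne⟩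
      constructor
      · refine le_of_tendsto hw ?_
        filter_upwards [hev, hsub, hpos] with r h1 h2 h3
        rw [hκ_apply _ measurableSet_closedBall, Set.inter_eq_left.2 h2]
        rw [ENNReal.div_le_iff h3.1 h3.2, mul_assoc]
        exact h1.1
      · refine ge_of_tendsto (ENNReal.Tendsto.const_mul hw (Or.inr
          (ENNReal.pow_ne_top ENNReal.coe_ne_top))) ?_
        filter_upwards [hev, hsub, hpos] with r h1 h2 h3
        rw [hκ_apply _ measurableSet_closedBall, Set.inter_eq_left.2 h2, ← mul_div_assoc,
          ENNReal.le_div_iff_mul_le (Or.inl h3.1) (Or.inl h3.2)]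
        exact h1.2
    have hev01 : ∀ᶠ ε in 𝓝[>] (0 : ℝ≥0), 0 < ε ∧ ε < 1 := Ioo_mem_nhdsGT one_pos
    apply le_antisymm
    · have ht : Tendsto (fun ε : ℝ≥0 => ((1 + ε : ℝ≥0) : ℝ≥0∞) ^ d * J) (𝓝[>] 0) (𝓝 J) := by
        have h1 : Tendsto (fun ε : ℝ≥0 => ((1 + ε : ℝ≥0) : ℝ≥0∞) ^ d) (𝓝[>] 0) (𝓝 1) := by
          have : Continuous fun ε : ℝ≥0 => (1 + ε) ^ d := by fun_prop
          have h2 := (this.tendsto 0).mono_left (nhdsWithin_le_nhds (s := Set.Ioi 0))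
          simpa using ENNReal.tendsto_coe.2 h2
        simpa using ENNReal.Tendsto.mul_const h1 (Or.inl one_ne_zero)
      refine ge_of_tendsto ht ?_
      filter_upwards [hev01] with ε hε using (hbounds ε hε.1 hε.2).1
    · have ht : Tendsto (fun ε : ℝ≥0 => (((1 - ε)⁻¹ : ℝ≥0) : ℝ≥0∞) ^ d * c) (𝓝[>] 0) (𝓝 c) := by
        have h1 : Tendsto (fun ε : ℝ≥0 => (((1 - ε)⁻¹ : ℝ≥0) : ℝ≥0∞) ^ d) (𝓝[>] 0) (𝓝 1) := by
          have : ContinuousAt (fun ε : ℝ≥0 => ((1 - ε)⁻¹) ^ d) 0 :=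
            ContinuousAt.pow (ContinuousAt.inv₀ (by fun_prop) (by simp)) d
          have h2 := this.tendsto.mono_left (nhdsWithin_le_nhds (s := Set.Ioi 0))
          simpa only [ENNReal.coe_pow, tsub_zero, inv_one, one_pow, ENNReal.coe_one] using
            ENNReal.tendsto_coe.2 h2
        simpa using ENNReal.Tendsto.mul_const h1 (Or.inl one_ne_zero)
      refine ge_of_tendsto ht ?_
      filter_upwards [hev01] with ε hε using (hbounds ε hε.1 hε.2).2
  have hκW : κ.restrict W = κ := by
    refine Measure.restrict_eq_self_of_ae_mem ?_
    change κ Wᶜ = 0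
    rw [hκ_apply _ hW.measurableSet.compl]
    simp
  calc κ = κ.restrict W := hκW.symm
    _ = (volume.withDensity (κ.rnDeriv volume)).restrict W := by
      rw [Measure.withDensity_rnDeriv_eq _ _ hac]
    _ = (volume.restrict W).withDensity (κ.rnDeriv volume) :=
      restrict_withDensity hW.measurableSet _
    _ = _ := withDensity_congr_ae ((ae_restrict_iff' hW.measurableSet).2 hrn)

end Area

/-! ### The half-space -/

/-- The splitting `(t, w) ↦ t v + w` of `ℝ^m` along a unit vector `v`. -/
def splitEquiv (v : E m) (hv : ‖v‖ = 1) : ℝ × (Submodule.span ℝ {v})ᗮ ≃ᵐ E m :=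
  ((LinearIsometryEquiv.toSpanUnitSingleton (𝕜 := ℝ) v hv).toHomeomorph.toMeasurableEquiv.prodCongr
    (MeasurableEquiv.refl _)).trans
    ((Submodule.span ℝ {v}).measurableEquivProd (0 : E m)).symm

lemma splitEquiv_apply (v : E m) (hv : ‖v‖ = 1) (q : ℝ × (Submodule.span ℝ {v})ᗮ) :
    splitEquiv v hv q = q.1 • v + q.2 := by
  have : splitEquiv v hv q = ((Submodule.span ℝ {v}).measurableEquivProd (0 : E m)).symm
      (LinearIsometryEquiv.toSpanUnitSingleton (𝕜 := ℝ) v hv q.1, q.2) := rfl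
  rw [this, Submodule.measurableEquivProd_symm_apply]
  simp

lemma measurePreserving_splitEquiv (v : E m) (hv : ‖v‖ = 1) :
    MeasurePreserving (splitEquiv v hv) volume volume := by
  have h1 := ((Submodule.span ℝ {v}).measurePreserving_measurableEquivProd (0 : E m)).symm
  rw [InnerProductSpace.euclideanHausdorffMeasure_eq_volume] at h1
  have h2 := (LinearIsometryEquiv.toSpanUnitSingleton (𝕜 := ℝ) v hv).measurePreserving
  exact h1.comp (h2.prod (MeasurePreserving.id volume))

lemma inner_split (v : E m) (hv : ‖v‖ = 1) (t : ℝ) (w : (Submodule.span ℝ {v})ᗮ) :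
    inner ℝ v (t • v + (w : E m)) = t := by
  have hw : inner ℝ v (w : E m) = 0 := Submodule.mem_orthogonal_singleton_iff_inner_right.1 w.2
  rw [inner_add_right, inner_smul_right, real_inner_self_eq_norm_sq, hv, hw]
  simp

/-- The divergence theorem on the half-space `{⟨v, z⟩ ≤ 0}` in the normal direction. -/
lemma integral_halfspace (v : E m) (hv : ‖v‖ = 1) {ψ : E m → ℝ} (hψ : ContDiff ℝ 1 ψ)
    (hc : HasCompactSupport ψ) :
    ∫ z in {z : E m | inner ℝ v z ≤ 0}, fderiv ℝ ψ z v = ∫ w : (Submodule.span ℝ {v})ᗮ, ψ w := by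
  have hcont : Continuous fun z => fderiv ℝ ψ z v :=
    (hψ.continuous_fderiv one_ne_zero).clm_apply continuous_const
  have hc' : HasCompactSupport fun z => fderiv ℝ ψ z v := (hc.fderiv (𝕜 := ℝ)).comp_left
    (g := fun L : E m →L[ℝ] ℝ => L v) rfl
  have hint : Integrable (fun z => fderiv ℝ ψ z v) := hcont.integrable_of_hasCompactSupport hc'
  have hmeas : MeasurableSet {z : E m | inner ℝ v z ≤ 0} :=
    (isClosed_le (by fun_prop) continuous_const).measurableSet
  have hmp := measurePreserving_splitEquiv v hv
  rw [← integral_indicator hmeas, ← hmp.integral_comp (splitEquiv v hv).measurableEmbedding]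
  have hint2 : Integrable (fun q : ℝ × (Submodule.span ℝ {v})ᗮ =>
      ({z : E m | inner ℝ v z ≤ 0}.indicator (fun z => fderiv ℝ ψ z v)) (splitEquiv v hv q)) :=
    (hmp.integrable_comp_emb (splitEquiv v hv).measurableEmbedding).2 (hint.indicator hmeas)
  rw [Measure.volume_eq_prod] at hint2 ⊢
  rw [integral_prod_symm _ hint2]
  refine integral_congr_ae (Eventually.of_forall fun w => ?_)
  simp only
  have hcurve (t : ℝ) : HasDerivAt (fun t : ℝ => t • v + (w : E m)) v t := by
    simpa using ((hasDerivAt_id t).smul_const v).add_const (w : E m)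
  have hder (t : ℝ) : HasDerivAt (fun t : ℝ => ψ (t • v + w)) (fderiv ℝ ψ (t • v + w) v) t :=
    ((hψ.differentiable one_ne_zero _).hasFDerivAt).comp_hasDerivAt t (hcurve t)
  have hcl : Topology.IsClosedEmbedding fun t : ℝ => t • v + (w : E m) := by
    refine Isometry.isClosedEmbedding (Isometry.of_dist_eq fun a b => ?_)
    rw [dist_add_right, dist_eq_norm, ← sub_smul, norm_smul, hv, mul_one, dist_eq_norm]
  have h1 : (fun t : ℝ => ({z : E m | inner ℝ v z ≤ 0}.indicator (fun z => fderiv ℝ ψ z v))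
      (splitEquiv v hv (t, w))) = (Set.Iic 0).indicator fun t => fderiv ℝ ψ (t • v + w) v := by
    funext t
    rw [splitEquiv_apply]
    simp only [Set.indicator, Set.mem_ofPred_eq, inner_split v hv, Set.mem_Iic]
  rw [h1, integral_indicator measurableSet_Iic]
  have h2 := integral_Iic_of_hasDerivAt_of_tendsto (a := (0 : ℝ)) (m := (0 : ℝ))
    (f := fun t : ℝ => ψ (t • v + w)) (f' := fun t => fderiv ℝ ψ (t • v + w) v)
    (hder 0).continuousAt.continuousWithinAt (fun t _ => hder t) ?_ ?_
  · rw [h2]; simp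
  · exact ((hcont.comp hcl.continuous).integrable_of_hasCompactSupport
      (hc'.comp_isClosedEmbedding hcl)).integrableOn
  · have h3 : HasCompactSupport fun t : ℝ => ψ (t • v + w) := hc.comp_isClosedEmbedding hcl
    refine tendsto_const_nhds.congr' ?_
    have := hasCompactSupport_iff_eventuallyEq.1 h3
    rw [coclosedCompact_eq_cocompact, cocompact_eq_atBot_atTop] at this
    exact (this.filter_mono le_sup_left).symm

/-! ### Flattening the boundary -/

/-- The map that flattens the level sets of `ρ`: it moves points along `v` such that the
`v`-coordinate becomes `ρ`. -/
def flat (ρ : E m → ℝ) (v x : E m) : E m := x + (ρ x - inner ℝ v x) • v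

lemma inner_flat (ρ : E m → ℝ) {v : E m} (hv : ‖v‖ = 1) (x : E m) :
    inner ℝ v (flat ρ v x) = ρ x := by
  rw [flat, inner_add_right, inner_smul_right, real_inner_self_eq_norm_sq, hv]
  ring

/-- The derivative of `flat ρ v`. -/
def flatDeriv (ρ : E m → ℝ) (v x : E m) : E m →L[ℝ] E m :=
  ContinuousLinearMap.id ℝ (E m) + (fderiv ℝ ρ x - innerSL ℝ v).smulRight v

lemma flatDeriv_apply (ρ : E m → ℝ) (v x u : E m) :
    flatDeriv ρ v x u = u + (fderiv ℝ ρ x u - inner ℝ v u) • v := by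
  simp [flatDeriv]

lemma det_flatDeriv (ρ : E m → ℝ) {v : E m} (hv : ‖v‖ = 1) (x : E m) :
    (flatDeriv ρ v x).det = fderiv ℝ ρ x v := by
  have : (flatDeriv ρ v x : E m →ₗ[ℝ] E m)
      = LinearMap.transvection ((fderiv ℝ ρ x - innerSL ℝ v : E m →L[ℝ] ℝ) : E m →ₗ[ℝ] ℝ) v := by
    ext1 u
    change flatDeriv ρ v x u = u + _
    rw [flatDeriv_apply]
    simp
  rw [ContinuousLinearMap.det, this, LinearMap.transvection.det]
  simp [hv]

lemma hasStrictFDerivAt_flat {ρ : E m → ℝ} (v : E m) {x : E m} (hρ : ContDiffAt ℝ ∞ ρ x) :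
    HasStrictFDerivAt (flat ρ v) (flatDeriv ρ v x) x := by
  have h1 := hρ.hasStrictFDerivAt (by simp)
  have h2 := (innerSL ℝ v).hasStrictFDerivAt (x := x)
  exact (hasStrictFDerivAt_id x).add ((h1.sub h2).smul_const v)

lemma contDiffAt_flat {ρ : E m → ℝ} (v : E m) {x : E m} (hρ : ContDiffAt ℝ ∞ ρ x) :
    ContDiffAt ℝ 1 (flat ρ v) x := by
  have h1 : ContDiffAt ℝ 1 ρ x := hρ.of_le (by norm_cast)
  have h2 : ContDiffAt ℝ 1 (fun x => inner ℝ v x) x := contDiffAt_const.inner ℝ contDiffAt_id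
  exact contDiffAt_id.add ((h1.sub h2).smul contDiffAt_const)

/-- The derivative of `flat ρ v` as a linear equivalence, where `ρ` increases in direction `v`. -/
def flatEquiv (ρ : E m → ℝ) {v : E m} (hv : ‖v‖ = 1) {x : E m} (h : 0 < fderiv ℝ ρ x v) :
    E m ≃L[ℝ] E m :=
  (flatDeriv ρ v x).toContinuousLinearEquivOfDetNeZero (by rw [det_flatDeriv ρ hv]; exact h.ne')

lemma coe_flatEquiv (ρ : E m → ℝ) {v : E m} (hv : ‖v‖ = 1) {x : E m} (h : 0 < fderiv ℝ ρ x v) :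
    (flatEquiv ρ hv h : E m →L[ℝ] E m) = flatDeriv ρ v x :=
  ContinuousLinearMap.coe_toContinuousLinearEquivOfDetNeZero _ _

/-- A flattening chart `e` of direction `v` for the level sets of `ρ`. The inverse is required to be
Lipschitz and the target bounded so that the boundary in the chart has finite surface measure. -/
structure IsFlatChart (ρ : E m → ℝ) (v : E m) (e : OpenPartialHomeomorph (E m) (E m)) : Prop where
  norm_eq : ‖v‖ = 1
  coe_eq : ∀ x, e x = flat ρ v x
  contDiffAt : ∀ x ∈ e.source, ContDiffAt ℝ ∞ ρ x
  pos : ∀ x ∈ e.source, 0 < fderiv ℝ ρ x v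
  lipschitz : ∃ K, LipschitzOnWith K e.symm e.target
  bounded : Bornology.IsBounded e.target

/-- Flattening charts exist at points where `ρ` increases in the direction `v`, by the inverse
function theorem. -/
lemma exists_isFlatChart {ρ : E m → ℝ} {U : Set (E m)} (hU : IsOpen U) (hρ : ContDiffOn ℝ ∞ ρ U)
    {p v : E m} (hp : p ∈ U) (hv : ‖v‖ = 1) (hpos : 0 < fderiv ℝ ρ p v) :
    ∃ e : OpenPartialHomeomorph (E m) (E m), p ∈ e.source ∧ e.source ⊆ U ∧ IsFlatChart ρ v e := by
  have hρp : ContDiffAt ℝ ∞ ρ p := hρ.contDiffAt (hU.mem_nhds hp)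
  have hd : HasFDerivAt (flat ρ v) (flatEquiv ρ hv hpos : E m →L[ℝ] E m) p := by
    rw [coe_flatEquiv]; exact (hasStrictFDerivAt_flat v hρp).hasFDerivAt
  set e₀ := (contDiffAt_flat v hρp).toOpenPartialHomeomorph _ hd one_ne_zero with he₀
  have hcoe : (e₀ : E m → E m) = flat ρ v := rfl
  have hp₀ : p ∈ e₀.source :=
    (contDiffAt_flat v hρp).mem_toOpenPartialHomeomorph_source hd one_ne_zero
  have hsymm : ContDiffAt ℝ 1 e₀.symm (e₀ p) := by
    refine e₀.contDiffAt_symm (f₀' := flatEquiv ρ hv hpos) (e₀.map_source hp₀) ?_ ?_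
    · rw [e₀.left_inv hp₀]; exact hd
    · rw [e₀.left_inv hp₀]; exact contDiffAt_flat v hρp
  obtain ⟨K, t, ht, hK⟩ := hsymm.exists_lipschitzOnWith
  have hfc : ContinuousAt (fun x => fderiv ℝ ρ x v) p :=
    ((hρp.fderiv_right (m := 0) (by norm_cast)).continuousAt).clm_apply continuousAt_const
  have hN : {x | 0 < fderiv ℝ ρ x v} ∩ U ∩ e₀ ⁻¹' (t ∩ Metric.ball (e₀ p) 1) ∈ 𝓝 p := by
    refine inter_mem (inter_mem (hfc.eventually (lt_mem_nhds hpos)) (hU.mem_nhds hp)) ?_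
    exact (e₀.continuousAt hp₀).preimage_mem_nhds (inter_mem ht (Metric.ball_mem_nhds _ one_pos))
  set N := {x | 0 < fderiv ℝ ρ x v} ∩ U ∩ e₀ ⁻¹' (t ∩ Metric.ball (e₀ p) 1) with hNdef
  have hsrc : (e₀.restr N).source = e₀.source ∩ interior N := e₀.restr_source N
  have hsub : (e₀.restr N).source ⊆ N := hsrc ▸ fun x hx => interior_subset hx.2
  have htgt : (e₀.restr N).target ⊆ t ∩ Metric.ball (e₀ p) 1 := by
    intro z hz
    have h1 := hsub ((e₀.restr N).map_target hz)
    have h2 := (e₀.restr N).right_inv hz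
    have h3 := h1.2
    rw [Set.mem_preimage] at h3
    have h4 : e₀ ((e₀.restr N).symm z) = z := h2
    rwa [h4] at h3
  refine ⟨e₀.restr N, ?_, fun x hx => (hsub hx).1.2, hv, fun x => rfl, fun x hx => ?_,
    fun x hx => ?_, ⟨K, ?_⟩, ?_⟩
  · rw [hsrc]; exact ⟨hp₀, mem_interior_iff_mem_nhds.2 hN⟩
  · exact hρ.contDiffAt (hU.mem_nhds (hsub hx).1.2)
  · exact (hsub hx).1.1
  · exact hK.mono fun z hz => (htgt hz).1
  · exact Metric.isBounded_ball.subset fun z hz => (htgt hz).2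

namespace IsFlatChart

variable {ρ : E m → ℝ} {v : E m} {e : OpenPartialHomeomorph (E m) (E m)}

lemma hasStrictFDerivAt (h : IsFlatChart ρ v e) {x : E m} (hx : x ∈ e.source) :
    HasStrictFDerivAt e (flatDeriv ρ v x) x := by
  have : (e : E m → E m) = flat ρ v := funext h.coe_eq
  rw [this]
  exact hasStrictFDerivAt_flat v (h.contDiffAt x hx)

lemma hasStrictFDerivAt_symm (h : IsFlatChart ρ v e) {z : E m} (hz : z ∈ e.target) :
    HasStrictFDerivAt e.symm
      ((flatEquiv ρ h.norm_eq (h.pos _ (e.map_target hz))).symm : E m →L[ℝ] E m) z := by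
  refine e.hasStrictFDerivAt_symm hz ?_
  rw [coe_flatEquiv]
  exact h.hasStrictFDerivAt (e.map_target hz)

lemma contDiffAt_symm (h : IsFlatChart ρ v e) {z : E m} (hz : z ∈ e.target) :
    ContDiffAt ℝ 1 e.symm z := by
  refine e.contDiffAt_symm (f₀' := flatEquiv ρ h.norm_eq (h.pos _ (e.map_target hz))) hz ?_ ?_
  · rw [coe_flatEquiv]
    exact (h.hasStrictFDerivAt (e.map_target hz)).hasFDerivAt
  · have : (e : E m → E m) = flat ρ v := funext h.coe_eq
    rw [this]
    exact contDiffAt_flat v (h.contDiffAt _ (e.map_target hz))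

lemma inner_coe (h : IsFlatChart ρ v e) (x : E m) : inner ℝ v (e x) = ρ x := by
  rw [h.coe_eq, inner_flat ρ h.norm_eq]

/-- A function with support in the chart, in the flattened coordinates, extended by zero. -/
def push (e : OpenPartialHomeomorph (E m) (E m)) (f : E m → ℝ) : E m → ℝ :=
  e.target.indicator (f ∘ e.symm)

lemma push_apply_of_mem (f : E m → ℝ) {x : E m} (hx : x ∈ e.source) : push e f (e x) = f x := by
  rw [push, Set.indicator_of_mem (e.map_source hx), Function.comp_apply, e.left_inv hx]

lemma push_eq_zero {f : E m → ℝ} {z : E m} (hz : z ∉ e '' tsupport f) : push e f z = 0 := by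
  by_cases ht : z ∈ e.target
  · rw [push, Set.indicator_of_mem ht, Function.comp_apply]
    refine image_eq_zero_of_notMem_tsupport fun hmem => hz ⟨_, hmem, e.right_inv ht⟩
  · exact Set.indicator_of_notMem ht _

lemma isCompact_image {f : E m → ℝ} (hc : HasCompactSupport f)
    (hsupp : tsupport f ⊆ e.source) : IsCompact (e '' tsupport f) :=
  IsCompact.image_of_continuousOn hc (e.continuousOn.mono hsupp)

lemma hasCompactSupport_push {f : E m → ℝ} (hc : HasCompactSupport f)
    (hsupp : tsupport f ⊆ e.source) : HasCompactSupport (push e f) :=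
  HasCompactSupport.intro (isCompact_image hc hsupp) fun _ hz => push_eq_zero hz

lemma contDiff_push (h : IsFlatChart ρ v e) {f : E m → ℝ} (hf : ContDiff ℝ 1 f)
    (hc : HasCompactSupport f) (hsupp : tsupport f ⊆ e.source) : ContDiff ℝ 1 (push e f) := by
  rw [contDiff_iff_contDiffAt]
  intro z
  by_cases hz : z ∈ e.target
  · refine (hf.contDiffAt.comp z (h.contDiffAt_symm hz)).congr_of_eventuallyEq ?_
    filter_upwards [e.open_target.mem_nhds hz] with z' hz'
    exact Set.indicator_of_mem hz' _
  · have hz' : z ∉ e '' tsupport f := by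
      rintro ⟨x, hx, rfl⟩
      exact hz (e.map_source (hsupp hx))
    refine (contDiffAt_const (c := (0 : ℝ))).congr_of_eventuallyEq ?_
    filter_upwards [(isCompact_image hc hsupp).isClosed.isOpen_compl.mem_nhds hz'] with z' h'
    exact push_eq_zero h'

/-- In a flattening chart of direction `v`, the integral of `∂_v f` over `{ρ ≤ 0}` is an integral
over the flattened boundary. -/
lemma setIntegral_fderiv (h : IsFlatChart ρ v e) {S : Set (E m)} (hSm : MeasurableSet S)
    (hS : ∀ x ∈ e.source, x ∈ S ↔ ρ x ≤ 0) {f : E m → ℝ} (hf : ContDiff ℝ 1 f)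
    (hc : HasCompactSupport f) (hsupp : tsupport f ⊆ e.source) :
    ∫ x in S, fderiv ℝ f x v = ∫ w : (Submodule.span ℝ {v})ᗮ, push e f w := by
  have hψ := h.contDiff_push hf hc hsupp
  have hψc := hasCompactSupport_push hc hsupp
  rw [← integral_halfspace v h.norm_eq hψ hψc]
  have hmeas : MeasurableSet {z : E m | inner ℝ v z ≤ 0} :=
    (isClosed_le (by fun_prop) continuous_const).measurableSet
  have hzero : ∀ z, z ∉ e.target → fderiv ℝ (push e f) z v = 0 := by
    intro z hz
    have : z ∉ tsupport (push e f) := by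
      intro hmem
      have hsub : tsupport (push e f) ⊆ e '' tsupport f :=
        closure_minimal (fun z' hz' => by
          by_contra hcon
          exact hz' (push_eq_zero hcon)) (isCompact_image hc hsupp).isClosed
      obtain ⟨x, hx, rfl⟩ := hsub hmem
      exact hz (e.map_source (hsupp hx))
    rw [fderiv_of_notMem_tsupport ℝ this]
    rfl
  have hzero' : ∀ x, x ∉ e.source → fderiv ℝ f x v = 0 := by
    intro x hx
    rw [fderiv_of_notMem_tsupport ℝ fun hmem => hx (hsupp hmem)]
    rfl
  have hR : ∫ z in {z : E m | inner ℝ v z ≤ 0}, fderiv ℝ (push e f) z v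
      = ∫ z in e.target, {z : E m | inner ℝ v z ≤ 0}.indicator
        (fun z => fderiv ℝ (push e f) z v) z := by
    rw [← integral_indicator hmeas]
    refine (setIntegral_eq_integral_of_forall_compl_eq_zero fun z hz => ?_).symm
    simp only [Set.indicator, hzero z hz, ite_self]
  have hLhs : ∫ x in S, fderiv ℝ f x v
      = ∫ x in e.source, S.indicator (fun x => fderiv ℝ f x v) x := by
    rw [← integral_indicator hSm]
    refine (setIntegral_eq_integral_of_forall_compl_eq_zero fun x hx => ?_).symm
    simp only [Set.indicator, hzero' x hx, ite_self]
  rw [hLhs, hR, ← e.image_source_eq_target,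
    integral_image_eq_integral_abs_det_fderiv_smul volume e.open_source.measurableSet
      (fun x hx => (h.hasStrictFDerivAt hx).hasFDerivAt.hasFDerivWithinAt) e.injOn]
  refine setIntegral_congr_fun e.open_source.measurableSet fun x hx => ?_
  have hev : f =ᶠ[𝓝 x] (push e f) ∘ e := by
    filter_upwards [e.open_source.mem_nhds hx] with x' hx'
    rw [Function.comp_apply, push_apply_of_mem f hx']
  -- the derivative of the chart maps `v` to `(∂_v ρ) v`, and its determinant is also `∂_v ρ`
  have hder : fderiv ℝ f x v = fderiv ℝ ρ x v * fderiv ℝ (push e f) (e x) v := by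
    have h1 := ((hψ.differentiable one_ne_zero (e x)).hasFDerivAt.comp x
      (h.hasStrictFDerivAt hx).hasFDerivAt).congr_of_eventuallyEq hev
    rw [h1.fderiv, ContinuousLinearMap.comp_apply, flatDeriv_apply, real_inner_self_eq_norm_sq,
      h.norm_eq]
    have : v + (fderiv ℝ ρ x v - 1 ^ 2) • v = fderiv ℝ ρ x v • v := by module
    rw [this, map_smul, smul_eq_mul]
  simp only [Set.indicator, Set.mem_ofPred_eq, h.inner_coe, hS x hx, det_flatDeriv ρ h.norm_eq,
    abs_of_pos (h.pos x hx), smul_eq_mul]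
  split_ifs
  · exact hder
  · simp

end IsFlatChart

/-! ### The outward unit normal -/

/-- `ρ` is a smooth defining function of `S` on the open set `U`. -/
structure IsDefining (S : Set (E m)) (ρ : E m → ℝ) (U : Set (E m)) : Prop where
  isOpen : IsOpen U
  contDiffOn : ContDiffOn ℝ ∞ ρ U
  mem_iff : ∀ x ∈ U, x ∈ S ↔ ρ x ≤ 0

namespace IsDefining

variable {S U : Set (E m)} {ρ : E m → ℝ}

lemma contDiffAt (h : IsDefining S ρ U) {x : E m} (hx : x ∈ U) : ContDiffAt ℝ ∞ ρ x :=
  h.contDiffOn.contDiffAt (h.isOpen.mem_nhds hx)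

lemma hasFDerivAt (h : IsDefining S ρ U) {x : E m} (hx : x ∈ U) :
    HasFDerivAt ρ (fderiv ℝ ρ x) x :=
  ((h.contDiffAt hx).differentiableAt (by simp)).hasFDerivAt

lemma eq_zero_of_mem_frontier (h : IsDefining S ρ U) {x : E m} (hx : x ∈ U)
    (hf : x ∈ frontier S) : ρ x = 0 := by
  have hc := (h.contDiffAt hx).continuousAt
  rcases lt_trichotomy (ρ x) 0 with h0 | h0 | h0
  · exfalso
    refine hf.2 (mem_interior_iff_mem_nhds.2 ?_)
    filter_upwards [h.isOpen.mem_nhds hx, hc.eventually (gt_mem_nhds h0)] with z hz hz'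
    exact (h.mem_iff z hz).2 hz'.le
  · exact h0
  · exfalso
    have : ∀ᶠ z in 𝓝 x, z ∉ S := by
      filter_upwards [h.isOpen.mem_nhds hx, hc.eventually (lt_mem_nhds h0)] with z hz hz'
      exact fun hzS => absurd ((h.mem_iff z hz).1 hzS) (not_le.2 hz')
    exact (mem_closure_iff_frequently.1 hf.1) this

lemma hasDerivAt_line (h : IsDefining S ρ U) {x : E m} (hx : x ∈ U) (u : E m) :
    HasDerivAt (fun t : ℝ => ρ (x + t • u)) (fderiv ℝ ρ x u) 0 := by
  have h1 : HasDerivAt (fun t : ℝ => x + t • u) u 0 := by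
    simpa using ((hasDerivAt_id (0 : ℝ)).smul_const u).const_add x
  have h2 : HasFDerivAt ρ (fderiv ℝ ρ x) (x + (0 : ℝ) • u) := by simpa using h.hasFDerivAt hx
  exact h2.comp_hasDerivAt (0 : ℝ) h1

/-- Moving from a zero of `ρ` in a direction in which `ρ` decreases leads into `S`. -/
lemma eventually_mem (h : IsDefining S ρ U) {x u : E m} (hx : x ∈ U) (h0 : ρ x = 0)
    (hu : fderiv ℝ ρ x u < 0) : ∀ᶠ t in 𝓝[>] (0 : ℝ), x + t • u ∈ S := by
  have hd := (hasDerivAt_iff_tendsto_slope.1 (h.hasDerivAt_line hx u)).mono_left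
    (nhdsGT_le_nhdsNE 0)
  have hU : ∀ᶠ t in 𝓝[>] (0 : ℝ), x + t • u ∈ U := by
    have hc : ContinuousAt (fun t : ℝ => x + t • u) 0 := by fun_prop
    exact (hc.eventually (by simpa using h.isOpen.mem_nhds hx)).filter_mono nhdsWithin_le_nhds
  filter_upwards [hd.eventually (gt_mem_nhds hu), hU, self_mem_nhdsWithin] with t ht hxt ht0
  refine (h.mem_iff _ hxt).2 ?_
  simp only [slope_def_field, zero_smul, add_zero, h0, sub_zero] at ht
  have h3 := mul_neg_of_neg_of_pos ht (Set.mem_Ioi.1 ht0)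
  rw [div_mul_cancel₀ _ (Set.mem_Ioi.1 ht0).ne'] at h3
  exact h3.le

lemma fderiv_nonpos (h : IsDefining S ρ U) {x u : E m} (hx : x ∈ U) (h0 : ρ x = 0)
    (hu : ∀ᶠ t in 𝓝[>] (0 : ℝ), x + t • u ∈ S) : fderiv ℝ ρ x u ≤ 0 := by
  have hd := (hasDerivAt_iff_tendsto_slope.1 (h.hasDerivAt_line hx u)).mono_left
    (nhdsGT_le_nhdsNE 0)
  have hU : ∀ᶠ t in 𝓝[>] (0 : ℝ), x + t • u ∈ U := by
    have hc : ContinuousAt (fun t : ℝ => x + t • u) 0 := by fun_prop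
    exact (hc.eventually (by simpa using h.isOpen.mem_nhds hx)).filter_mono nhdsWithin_le_nhds
  refine le_of_tendsto hd ?_
  filter_upwards [hu, hU, self_mem_nhdsWithin] with t ht hxt ht0
  simp only [slope_def_field, zero_smul, add_zero, h0, sub_zero]
  exact div_nonpos_of_nonpos_of_nonneg ((h.mem_iff _ hxt).1 ht) (Set.mem_Ioi.1 ht0).le

lemma mem_frontier_iff (h : IsDefining S ρ U) {x : E m} (hx : x ∈ U)
    (hd : fderiv ℝ ρ x ≠ 0) : x ∈ frontier S ↔ ρ x = 0 := by
  refine ⟨h.eq_zero_of_mem_frontier hx, fun h0 => ⟨subset_closure ((h.mem_iff x hx).2 h0.le), ?_⟩⟩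
  intro hint
  refine hd (ContinuousLinearMap.ext fun u => ?_)
  have key : ∀ u, fderiv ℝ ρ x u ≤ 0 := by
    intro u
    refine h.fderiv_nonpos hx h0 ?_
    have hc : ContinuousAt (fun t : ℝ => x + t • u) 0 := by fun_prop
    refine (hc.eventually (p := fun z => z ∈ S) ?_).filter_mono nhdsWithin_le_nhds
    simpa using mem_interior_iff_mem_nhds.1 hint
  refine le_antisymm (key u) ?_
  have := key (-u)
  rw [map_neg] at this
  simpa using this

end IsDefining

lemma fderiv_eq_inner_gradient (ρ : E m → ℝ) (x u : E m) :
    fderiv ℝ ρ x u = inner ℝ (gradient ρ x) u := inner_gradient_left.symm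

/-- The outward unit normal at a boundary point is unique. Two different unit normals `a` and `b`
would give a direction `b - a` that enters `S` according to `a` and leaves it according to `b`. -/
lemma IsOuterUnitNormal.eq {S : Set (E m)} {p a b : E m} (hp : p ∈ frontier S)
    (ha : IsOuterUnitNormal S p a) (hb : IsOuterUnitNormal S p b) : a = b := by
  obtain ⟨U, ρ, hU, hpU, hρ, hS, hne, rfl⟩ := ha
  obtain ⟨U', ρ', hU', hpU', hρ', hS', hne', rfl⟩ := hb
  have h : IsDefining S ρ U := ⟨hU, hρ, hS⟩
  have h' : IsDefining S ρ' U' := ⟨hU', hρ', hS'⟩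
  have h0 := h.eq_zero_of_mem_frontier hpU hp
  have h0' := h'.eq_zero_of_mem_frontier hpU' hp
  set a := ‖gradient ρ p‖⁻¹ • gradient ρ p with ha
  set b := ‖gradient ρ' p‖⁻¹ • gradient ρ' p with hb
  have hna : ‖a‖ = 1 := norm_smul_inv_norm (𝕜 := ℝ) hne
  have hnb : ‖b‖ = 1 := norm_smul_inv_norm (𝕜 := ℝ) hne'
  have hga : gradient ρ p = ‖gradient ρ p‖ • a := by
    rw [ha, smul_smul, mul_inv_cancel₀ (norm_ne_zero_iff.2 hne), one_smul]
  have hgb : gradient ρ' p = ‖gradient ρ' p‖ • b := by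
    rw [hb, smul_smul, mul_inv_cancel₀ (norm_ne_zero_iff.2 hne'), one_smul]
  by_contra hab
  have hlt : inner ℝ a b < 1 := inner_lt_one_iff_real_of_norm_eq_one hna hnb |>.2 hab
  have h1 : fderiv ℝ ρ p (b - a) < 0 := by
    rw [fderiv_eq_inner_gradient, hga, inner_smul_left, inner_sub_right,
      real_inner_self_eq_norm_sq, hna]
    exact mul_neg_of_pos_of_neg (norm_pos_iff.2 hne) (by linarith)
  have h2 := h'.fderiv_nonpos hpU' h0' (h.eventually_mem hpU h0 h1)
  rw [fderiv_eq_inner_gradient, hgb, inner_smul_left, inner_sub_right,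
    real_inner_self_eq_norm_sq, hnb, real_inner_comm] at h2
  have h3 : 0 < ‖gradient ρ' p‖ * (1 ^ 2 - inner ℝ a b) :=
    mul_pos (norm_pos_iff.2 hne') (by linarith)
  exact absurd h2 (not_le.2 h3)

lemma IsDefining.outerNormal_eq {S U : Set (E m)} {ρ : E m → ℝ} (h : IsDefining S ρ U) {x : E m}
    (hx : x ∈ U) (hd : gradient ρ x ≠ 0) (hf : x ∈ frontier S) :
    outerNormal S x = ‖gradient ρ x‖⁻¹ • gradient ρ x := by
  have hn : IsOuterUnitNormal S x (‖gradient ρ x‖⁻¹ • gradient ρ x) :=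
    ⟨U, ρ, h.isOpen, hx, h.contDiffOn, h.mem_iff, hd, rfl⟩
  have hex : ∃ v, IsOuterUnitNormal S x v := ⟨_, hn⟩
  rw [outerNormal, dif_pos hex]
  exact hex.choose_spec.eq hf hn

lemma continuousAt_gradient {ρ : E m → ℝ} {x : E m} (h : ContDiffAt ℝ ∞ ρ x) :
    ContinuousAt (gradient ρ) x :=
  (LinearIsometryEquiv.continuous _).continuousAt.comp
    (h.fderiv_right (m := 0) (by norm_cast)).continuousAt

/-- Boundary points have a neighbourhood with a defining function whose gradient does not vanish
at the point. -/
lemma IsCompactSmoothDomain.exists_isDefining {S : Set (E m)} (hS : IsCompactSmoothDomain S)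
    {p : E m} (hp : p ∈ frontier S) :
    ∃ U ρ, IsDefining S ρ U ∧ p ∈ U ∧ gradient ρ p ≠ 0 := by
  obtain ⟨v, U, ρ, hU, hpU, hρ, hmem, hne, -⟩ := hS.smooth_boundary p hp
  exact ⟨U, ρ, ⟨hU, hρ, hmem⟩, hpU, hne⟩

lemma IsCompactSmoothDomain.continuousOn_outerNormal {S : Set (E m)}
    (hS : IsCompactSmoothDomain S) : ContinuousOn (outerNormal S) (frontier S) := by
  intro p hp
  obtain ⟨U, ρ, h, hpU, hne⟩ := hS.exists_isDefining hp
  have hg := continuousAt_gradient (h.contDiffAt hpU)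
  have hc : ContinuousAt (fun x => ‖gradient ρ x‖⁻¹ • gradient ρ x) p :=
    (hg.norm.inv₀ (norm_ne_zero_iff.2 hne)).smul hg
  refine hc.continuousWithinAt.congr_of_eventuallyEq ?_ (h.outerNormal_eq hpU hne hp)
  filter_upwards [self_mem_nhdsWithin, nhdsWithin_le_nhds (h.isOpen.mem_nhds hpU),
    nhdsWithin_le_nhds (hg.eventually_ne hne)] with x hx hxU hxne
  exact h.outerNormal_eq hxU hxne hx

/-! ### The boundary in a flattening chart -/

/-- The Jacobian of a graph with slope `c` is `√(1 + |c|²)`. -/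
lemma normDet_sq_graph {v : E m} (hv : ‖v‖ = 1) (c : (Submodule.span ℝ {v})ᗮ)
    {L : (Submodule.span ℝ {v})ᗮ →L[ℝ] E m} (hL : ∀ u, L u = (u : E m) + (inner ℝ c u : ℝ) • v) :
    L.normDet ^ 2 = 1 + ‖c‖ ^ 2 := by
  have h1 := L.normDet_sq
  have hperp : ∀ u : (Submodule.span ℝ {v})ᗮ, inner ℝ v (u : E m) = 0 := fun u =>
    Submodule.mem_orthogonal_singleton_iff_inner_right.1 u.2
  have h2 : ((ContinuousLinearMap.adjoint L ∘L L : _ →L[ℝ] _) :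
      (Submodule.span ℝ {v})ᗮ →ₗ[ℝ] (Submodule.span ℝ {v})ᗮ)
      = LinearMap.transvection (innerSL ℝ c : _ →L[ℝ] ℝ).toLinearMap c := by
    ext1 u
    refine ext_inner_right ℝ fun u' => ?_
    change inner ℝ (ContinuousLinearMap.adjoint L (L u)) u' = inner ℝ (u + (inner ℝ c u : ℝ) • c) u'
    rw [ContinuousLinearMap.adjoint_inner_left, hL, hL, inner_add_left, inner_add_right,
      inner_add_right, inner_add_left, inner_smul_left, inner_smul_left, inner_smul_right,
      inner_smul_right, inner_smul_left, hperp u', real_inner_self_eq_norm_sq, hv,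
      real_inner_comm v (u : E m), hperp u]
    simp
  rw [ContinuousLinearMap.det, h2, LinearMap.transvection.det] at h1
  have h3 : L.normDet ^ 2 = 1 + inner ℝ c c := h1
  rw [h3, real_inner_self_eq_norm_sq]

namespace IsFlatChart

variable {ρ : E m → ℝ} {v : E m} {e : OpenPartialHomeomorph (E m) (E m)} {S : Set (E m)}

/-- The flattened boundary, an open subset of the hyperplane orthogonal to `v`. -/
def flatBoundary (v : E m) (e : OpenPartialHomeomorph (E m) (E m)) :
    Set (Submodule.span ℝ {v})ᗮ := {w | (w : E m) ∈ e.target}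

lemma isOpen_flatBoundary : IsOpen (flatBoundary v e) :=
  e.open_target.preimage continuous_subtype_val

lemma rho_symm (h : IsFlatChart ρ v e) {w : (Submodule.span ℝ {v})ᗮ}
    (hw : w ∈ flatBoundary v e) : ρ (e.symm w) = 0 := by
  rw [← h.inner_coe, e.right_inv hw]
  exact Submodule.mem_orthogonal_singleton_iff_inner_right.1 w.2

lemma gradient_ne_zero (h : IsFlatChart ρ v e) {x : E m} (hx : x ∈ e.source) :
    gradient ρ x ≠ 0 := by
  intro h0
  have := h.pos x hx
  rw [fderiv_eq_inner_gradient, h0, inner_zero_left] at this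
  exact lt_irrefl _ this

lemma isDefining (h : IsFlatChart ρ v e) (hS : ∀ x ∈ e.source, x ∈ S ↔ ρ x ≤ 0) :
    IsDefining S ρ e.source :=
  ⟨e.open_source, fun x hx => (h.contDiffAt x hx).contDiffWithinAt, hS⟩

lemma mem_frontier_iff (h : IsFlatChart ρ v e) (hS : ∀ x ∈ e.source, x ∈ S ↔ ρ x ≤ 0) {x : E m}
    (hx : x ∈ e.source) : x ∈ frontier S ↔ ρ x = 0 := by
  refine (h.isDefining hS).mem_frontier_iff hx fun h0 => ?_
  have := h.pos x hx
  rw [h0] at this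
  exact lt_irrefl _ this

lemma image_flatBoundary (h : IsFlatChart ρ v e) (hS : ∀ x ∈ e.source, x ∈ S ↔ ρ x ≤ 0) :
    (fun w : (Submodule.span ℝ {v})ᗮ => e.symm w) '' flatBoundary v e = frontier S ∩ e.source := by
  ext x
  constructor
  · rintro ⟨w, hw, rfl⟩
    have hx := e.map_target hw
    exact ⟨(h.mem_frontier_iff hS hx).2 (h.rho_symm hw), hx⟩
  · rintro ⟨hf, hx⟩
    have h0 := (h.mem_frontier_iff hS hx).1 hf
    have hmem : e x ∈ (Submodule.span ℝ {v})ᗮ :=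
      Submodule.mem_orthogonal_singleton_iff_inner_right.2 (by rw [h.inner_coe, h0])
    exact ⟨⟨e x, hmem⟩, e.map_source hx, e.left_inv hx⟩

lemma finrank_orthogonal (h : IsFlatChart ρ v e) (hm : m ≠ 0) :
    finrank ℝ (Submodule.span ℝ {v})ᗮ = m - 1 := by
  have : Fact (finrank ℝ (E m) = (m - 1) + 1) := ⟨by
    rw [finrank_euclideanSpace_fin]; omega⟩
  refine Submodule.finrank_orthogonal_span_singleton ?_
  rintro rfl
  simpa using h.norm_eq

lemma surfaceMeasure_lt_top (h : IsFlatChart ρ v e) (hm : m ≠ 0)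
    (hS : ∀ x ∈ e.source, x ∈ S ↔ ρ x ≤ 0) : surfaceMeasure m (frontier S ∩ e.source) < ⊤ := by
  obtain ⟨K, hK⟩ := h.lipschitz
  have hK' : LipschitzOnWith K (fun w : (Submodule.span ℝ {v})ᗮ => e.symm w)
      (flatBoundary v e) := fun a ha b hb => hK ha hb
  rw [← h.image_flatBoundary hS, surfaceMeasure, ← h.finrank_orthogonal hm]
  refine (euclideanHausdorffMeasure_image_le hK' _).trans_lt ?_
  rw [InnerProductSpace.euclideanHausdorffMeasure_eq_volume]
  refine ENNReal.mul_lt_top (by simp) (Bornology.IsBounded.measure_lt_top ?_)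
  obtain ⟨C, hC⟩ := isBounded_iff_forall_norm_le.1 h.bounded
  exact isBounded_iff_forall_norm_le.2 ⟨C, fun w hw => hC _ hw⟩

/-- The derivative of the parametrization `e.symm` of the boundary. -/
def boundaryDeriv (ρ : E m → ℝ) (e : OpenPartialHomeomorph (E m) (E m))
    (w : (Submodule.span ℝ {v})ᗮ) :
    (Submodule.span ℝ {v})ᗮ →L[ℝ] E m :=
  (Submodule.span ℝ {v})ᗮ.subtypeL
    + (innerSL ℝ (-(fderiv ℝ ρ (e.symm w) v)⁻¹ •
      (Submodule.span ℝ {v})ᗮ.orthogonalProjectionOnto (gradient ρ (e.symm w)))).smulRight v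

lemma boundaryDeriv_apply (w u : (Submodule.span ℝ {v})ᗮ) :
    boundaryDeriv ρ e w u = (u : E m) + (inner ℝ (-(fderiv ℝ ρ (e.symm w) v)⁻¹ •
      (Submodule.span ℝ {v})ᗮ.orthogonalProjectionOnto (gradient ρ (e.symm w))) u : ℝ) • v := rfl

lemma hasStrictFDerivAt_boundary (h : IsFlatChart ρ v e) {w : (Submodule.span ℝ {v})ᗮ}
    (hw : w ∈ flatBoundary v e) :
    HasStrictFDerivAt (fun w : (Submodule.span ℝ {v})ᗮ => e.symm w) (boundaryDeriv ρ e w) w := by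
  have h1 := (h.hasStrictFDerivAt_symm hw).comp w
    ((Submodule.span ℝ {v})ᗮ.subtypeL.hasStrictFDerivAt (x := w))
  refine h1.congr_fderiv ?_
  ext1 u
  symm
  rw [ContinuousLinearMap.comp_apply, Submodule.subtypeL_apply]
  change _ = (flatEquiv ρ h.norm_eq (h.pos _ (e.map_target hw))).symm (u : E m)
  rw [ContinuousLinearEquiv.eq_symm_apply]
  have hp := (h.pos _ (e.map_target hw)).ne'
  have hu : inner ℝ v (u : E m) = 0 := Submodule.mem_orthogonal_singleton_iff_inner_right.1 u.2
  change (flatEquiv ρ h.norm_eq (h.pos _ (e.map_target hw)) : E m →L[ℝ] E m) _ = _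
  rw [coe_flatEquiv, flatDeriv_apply, boundaryDeriv_apply, inner_smul_left,
    Submodule.inner_orthogonalProjectionOnto_eq_of_mem_right, map_add, map_smul,
    ← fderiv_eq_inner_gradient, inner_add_right, inner_smul_right, hu, real_inner_self_eq_norm_sq,
    h.norm_eq]
  simp only [conj_trivial, smul_eq_mul]
  rw [add_assoc, ← add_smul]
  have : -(fderiv ℝ ρ (e.symm ↑w) v)⁻¹ * fderiv ℝ ρ (e.symm ↑w) ↑u +
      (fderiv ℝ ρ (e.symm ↑w) ↑u + -(fderiv ℝ ρ (e.symm ↑w) v)⁻¹ * fderiv ℝ ρ (e.symm ↑w) ↑u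
        * fderiv ℝ ρ (e.symm ↑w) v
        - (0 + -(fderiv ℝ ρ (e.symm ↑w) v)⁻¹ * fderiv ℝ ρ (e.symm ↑w) ↑u * 1 ^ 2)) = 0 := by
    field_simp
    ring
  rw [this, zero_smul, add_zero]

lemma norm_le_boundaryDeriv (w u : (Submodule.span ℝ {v})ᗮ) :
    ‖u‖ ≤ ‖boundaryDeriv ρ e w u‖ := by
  rw [boundaryDeriv_apply]
  set c : ℝ := inner ℝ (-(fderiv ℝ ρ (e.symm w) v)⁻¹ •
      (Submodule.span ℝ {v})ᗮ.orthogonalProjectionOnto (gradient ρ (e.symm w))) u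
  have hu : inner ℝ (u : E m) v = 0 := Submodule.mem_orthogonal_singleton_iff_inner_left.1 u.2
  have h2 : ‖(u : E m) + c • v‖ * ‖(u : E m) + c • v‖
      = ‖(u : E m)‖ * ‖(u : E m)‖ + ‖c • v‖ * ‖c • v‖ :=
    norm_add_sq_eq_norm_sq_add_norm_sq_real (by rw [inner_smul_right, hu, mul_zero])
  change ‖(u : E m)‖ ≤ _
  refine abs_le_of_sq_le_sq' (a := ‖(u : E m)‖) ?_ (norm_nonneg _) |>.2
  nlinarith [mul_self_nonneg ‖c • v‖]

/-- The Jacobian of the parametrization of the boundary is `1 / ⟨n, v⟩`. -/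
lemma normDet_boundaryDeriv (h : IsFlatChart ρ v e) {w : (Submodule.span ℝ {v})ᗮ}
    (hw : w ∈ flatBoundary v e) : (boundaryDeriv ρ e w).normDet
      = ‖gradient ρ (e.symm w)‖ / inner ℝ (gradient ρ (e.symm w)) v := by
  have hsq := normDet_sq_graph h.norm_eq _ (boundaryDeriv_apply (ρ := ρ) (e := e) w)
  have hp := h.pos _ (e.map_target hw)
  rw [fderiv_eq_inner_gradient] at hp hsq
  set N := gradient ρ (e.symm w)
  have hN : ‖(Submodule.span ℝ {v})ᗮ.orthogonalProjectionOnto N‖ ^ 2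
      = ‖N‖ ^ 2 - inner ℝ N v ^ 2 := by
    have h1 := Submodule.norm_sq_eq_add_norm_sq_projection N (Submodule.span ℝ {v})
    have h2 : ‖(Submodule.span ℝ {v}).orthogonalProjectionOnto N‖ = |inner ℝ N v| := by
      rw [← Submodule.norm_coe, ← Submodule.starProjection_apply,
        Submodule.starProjection_unit_singleton ℝ h.norm_eq, norm_smul, h.norm_eq, mul_one,
        real_inner_comm, Real.norm_eq_abs]
    rw [h2, sq_abs] at h1
    linarith
  rw [norm_smul, mul_pow, hN] at hsq
  have h3 : (boundaryDeriv ρ e w).normDet ^ 2 = (‖N‖ / inner ℝ N v) ^ 2 := by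
    rw [hsq, norm_neg, norm_inv, Real.norm_eq_abs, inv_pow, sq_abs]
    field_simp
    ring
  exact (sq_eq_sq₀ (LinearMap.normDet_nonneg _) (by positivity)).1 h3

/-- The flux of `f v` through the part of the boundary in a chart: the factor `⟨n, v⟩` cancels the
Jacobian of the parametrization. -/
lemma setIntegral_frontier (h : IsFlatChart ρ v e) (hm : m ≠ 0)
    (hS : ∀ x ∈ e.source, x ∈ S ↔ ρ x ≤ 0) {f : E m → ℝ} (hf : Continuous f)
    (hsupp : tsupport f ⊆ e.source) :
    ∫ x in frontier S, f x * inner ℝ (outerNormal S x) v ∂surfaceMeasure m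
      = ∫ w : (Submodule.span ℝ {v})ᗮ, push e f w := by
  set W := flatBoundary v e with hW
  set Φ : (Submodule.span ℝ {v})ᗮ → E m := fun w => e.symm w with hΦ
  set P : E m → (Submodule.span ℝ {v})ᗮ := (Submodule.span ℝ {v})ᗮ.orthogonalProjectionOnto
    with hPdef
  have hP : Measurable P := (ContinuousLinearMap.continuous _).measurable
  have hPΦ : ∀ w ∈ W, P (Φ w) = w := by
    intro w hw
    have h1 : (w : E m) = flat ρ v (Φ w) := by rw [← h.coe_eq, e.right_inv hw]
    have h2 : Φ w = (w : E m) + (inner ℝ v (Φ w) - ρ (Φ w)) • v := by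
      rw [h1, flat]; module
    have hv : P v = 0 := Submodule.orthogonalProjectionOnto_orthogonalComplement_singleton_eq_zero v
    have h3 : P (w : E m) = w := Submodule.orthogonalProjectionOnto_mem_subspace_eq_self w
    rw [h2]
    rw [hPdef, map_add, map_smul]
    change P (w : E m) + _ • P v = w
    rw [h3, hv, smul_zero, add_zero]
  obtain ⟨K, hK⟩ := h.lipschitz
  have hK' : LipschitzOnWith K Φ W := fun a ha b hb => hK ha hb
  have hWm : MeasurableSet W := isOpen_flatBoundary.measurableSet
  have harea := map_euclideanHausdorffMeasure_graph isOpen_flatBoundary hP hPΦ hK'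
    (fun w hw => h.hasStrictFDerivAt_boundary hw) fun w _ => norm_le_boundaryDeriv w
  rw [h.image_flatBoundary hS, h.finrank_orthogonal hm] at harea
  set F : (Submodule.span ℝ {v})ᗮ → ℝ := fun w => f (Φ w) *
    (inner ℝ (gradient ρ (Φ w)) v / ‖gradient ρ (Φ w)‖) with hF
  have hgc : ContinuousOn (fun w => gradient ρ (Φ w)) W := by
    intro w hw
    have hsrc : Φ w ∈ e.source := e.map_target hw
    have hcΦ : ContinuousWithinAt Φ W w :=
      (hK.continuousOn (w : E m) hw).comp (t := e.target) continuous_subtype_val.continuousWithinAt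
        fun _ h => h
    exact (continuousAt_gradient (h.contDiffAt _ hsrc)).comp_continuousWithinAt hcΦ
  have hFc : ContinuousOn F W := by
    refine (hf.comp_continuousOn hK'.continuousOn).mul
      ((hgc.inner continuousOn_const).div hgc.norm fun w hw => ?_)
    exact norm_ne_zero_iff.2 (h.gradient_ne_zero (e.map_target hw))
  have hJc : ContinuousOn (fun w => ENNReal.ofReal
      (‖gradient ρ (Φ w)‖ / inner ℝ (gradient ρ (Φ w)) v)) W := by
    refine ENNReal.continuous_ofReal.comp_continuousOn
      (hgc.norm.div (hgc.inner continuousOn_const) fun w hw => ?_)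
    have := h.pos _ (e.map_target hw)
    rw [fderiv_eq_inner_gradient] at this
    exact this.ne'
  have hdens :
      (volume.restrict W).withDensity (fun w => ENNReal.ofReal (boundaryDeriv ρ e w).normDet)
      = (volume.restrict W).withDensity fun w => ENNReal.ofReal
        (‖gradient ρ (Φ w)‖ / inner ℝ (gradient ρ (Φ w)) v) := by
    refine withDensity_congr_ae ?_
    filter_upwards [ae_restrict_mem hWm] with w hw
    rw [h.normDet_boundaryDeriv hw]
  rw [hdens] at harea
  have hmeas : MeasurableSet (frontier S ∩ e.source) :=
    isClosed_frontier.measurableSet.inter e.open_source.measurableSet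
  have hf0 : ∀ x, x ∉ e.source → f x = 0 := fun x hx =>
    image_eq_zero_of_notMem_tsupport fun hmem => hx (hsupp hmem)
  have step1 : ∫ x in frontier S, f x * inner ℝ (outerNormal S x) v ∂surfaceMeasure m
      = ∫ x in frontier S ∩ e.source, F (P x) ∂surfaceMeasure m := by
    rw [setIntegral_eq_of_subset_of_forall_sdiff_eq_zero isClosed_frontier.measurableSet
      (Set.inter_subset_left : frontier S ∩ e.source ⊆ frontier S)
      (f := fun x => f x * inner ℝ (outerNormal S x) v)]
    · refine setIntegral_congr_fun hmeas fun x hx => ?_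
      obtain ⟨w, hw, rfl⟩ := (h.image_flatBoundary hS).symm ▸ hx
      change f (Φ w) * inner ℝ (outerNormal S (Φ w)) v = F (P (Φ w))
      rw [hPΦ w hw, (h.isDefining hS).outerNormal_eq hx.2 (h.gradient_ne_zero hx.2) hx.1,
        inner_smul_left]
      simp only [hF, conj_trivial]
      ring
    · intro x hx
      rw [hf0 x fun hs => hx.2 ⟨hx.1, hs⟩, zero_mul]
  have step2 : ∫ x in frontier S ∩ e.source, F (P x) ∂surfaceMeasure m
      = ∫ w, F w ∂(Measure.map P ((surfaceMeasure m).restrict (frontier S ∩ e.source))) := by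
    refine (integral_map hP.aemeasurable ?_).symm
    rw [surfaceMeasure, harea]
    exact (hFc.aestronglyMeasurable hWm).mono_ac (withDensity_absolutelyContinuous _ _)
  rw [step1, step2, surfaceMeasure, harea, integral_withDensity_eq_integral_toReal_smul₀
    (hJc.aemeasurable hWm) (by simp)]
  rw [← setIntegral_eq_integral_of_forall_compl_eq_zero (s := W)
    (f := fun w : (Submodule.span ℝ {v})ᗮ => push e f w) fun w hw =>
    Set.indicator_of_notMem (s := e.target) hw _]
  refine setIntegral_congr_fun hWm fun w hw => ?_
  have hw' : (w : E m) ∈ e.target := hw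
  have hp := h.pos _ (e.map_target hw')
  have hg := norm_ne_zero_iff.2 (h.gradient_ne_zero (e.map_target hw'))
  rw [fderiv_eq_inner_gradient] at hp
  change (ENNReal.ofReal (‖gradient ρ (e.symm w)‖ / inner ℝ (gradient ρ (e.symm w)) v)).toReal •
    (f (e.symm w) * (inner ℝ (gradient ρ (e.symm w)) v / ‖gradient ρ (e.symm w)‖)) = push e f w
  rw [ENNReal.toReal_ofReal (by positivity), push, Set.indicator_of_mem hw', smul_eq_mul,
    Function.comp_apply]
  have := hp.ne'
  field_simp

end IsFlatChart

/-! ### The divergence theorem -/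

lemma IsCompactSmoothDomain.isCompact_frontier {S : Set (E m)} (hS : IsCompactSmoothDomain S) :
    IsCompact (frontier S) :=
  hS.isCompact.of_isClosed_subset isClosed_frontier hS.isCompact.isClosed.frontier_subset

lemma IsDefining.exists_isFlatChart {S U : Set (E m)} {ρ : E m → ℝ} (h : IsDefining S ρ U)
    {p v : E m} (hp : p ∈ U) (hv : ‖v‖ = 1) (hpos : 0 < inner ℝ (gradient ρ p) v) :
    ∃ e : OpenPartialHomeomorph (E m) (E m), p ∈ e.source ∧ IsFlatChart ρ v e ∧
      ∀ x ∈ e.source, x ∈ S ↔ ρ x ≤ 0 := by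
  rw [← fderiv_eq_inner_gradient] at hpos
  obtain ⟨e, hpe, heU, he⟩ := SuperCauchy.exists_isFlatChart h.isOpen h.contDiffOn hp hv hpos
  exact ⟨e, hpe, he, fun x hx => h.mem_iff x (heU hx)⟩

lemma IsCompactSmoothDomain.surfaceMeasure_frontier_lt_top {S : Set (E m)}
    (hS : IsCompactSmoothDomain S) (hm : m ≠ 0) : surfaceMeasure m (frontier S) < ⊤ := by
  refine hS.isCompact_frontier.measure_lt_top_of_nhdsWithin fun p hp => ?_
  obtain ⟨U, ρ, h, hpU, hne⟩ := hS.exists_isDefining hp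
  have hpos : 0 < inner ℝ (gradient ρ p) (‖gradient ρ p‖⁻¹ • gradient ρ p) := by
    rw [inner_smul_right, real_inner_self_eq_norm_sq]
    have := norm_pos_iff.2 hne
    positivity
  obtain ⟨e, hpe, he, heS⟩ := h.exists_isFlatChart hpU (norm_smul_inv_norm (𝕜 := ℝ) hne) hpos
  exact ⟨frontier S ∩ e.source,
    inter_mem self_mem_nhdsWithin (mem_nhdsWithin_of_mem_nhds (e.open_source.mem_nhds hpe)),
    he.surfaceMeasure_lt_top hm heS⟩

lemma IsCompactSmoothDomain.integrableOn_frontier {S : Set (E m)} (hS : IsCompactSmoothDomain S)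
    (hm : m ≠ 0) {f : E m → ℝ} (hf : ContinuousOn f (frontier S)) :
    IntegrableOn f (frontier S) (surfaceMeasure m) := by
  obtain ⟨C, hC⟩ := hS.isCompact_frontier.exists_bound_of_continuousOn hf
  have : IsFiniteMeasure ((surfaceMeasure m).restrict (frontier S)) :=
    ⟨by simpa using hS.surfaceMeasure_frontier_lt_top hm⟩
  refine Integrable.of_bound (hf.aestronglyMeasurable isClosed_frontier.measurableSet) C ?_
  filter_upwards [ae_restrict_mem isClosed_frontier.measurableSet] with x hx using hC x hx

/-- The Gauss formula `∫_S ∂_u f = ∫_{∂S} f ⟨n, u⟩` for test functions supported in `O`. -/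
def HasGauss (S : Set (E m)) (u : E m) (O : Set (E m)) : Prop :=
  ∀ f : E m → ℝ, ContDiff ℝ 1 f → HasCompactSupport f → tsupport f ⊆ O →
    ∫ x in S, fderiv ℝ f x u
      = ∫ x in frontier S, f x * inner ℝ (outerNormal S x) u ∂surfaceMeasure m

lemma HasGauss.mono {S O O' : Set (E m)} {u : E m} (h : HasGauss S u O) (hO : O' ⊆ O) :
    HasGauss S u O' := fun f hf hc hs => h f hf hc (hs.trans hO)

lemma integrable_fderiv_apply {f : E m → ℝ} (hf : ContDiff ℝ 1 f) (hc : HasCompactSupport f)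
    (u : E m) : Integrable fun x => fderiv ℝ f x u :=
  ((hf.continuous_fderiv one_ne_zero).clm_apply continuous_const).integrable_of_hasCompactSupport
    ((hc.fderiv (𝕜 := ℝ)).comp_left (g := fun L : E m →L[ℝ] ℝ => L u) rfl)

lemma IsCompactSmoothDomain.integrableOn_flux {S : Set (E m)} (hS : IsCompactSmoothDomain S)
    (hm : m ≠ 0) {f : E m → ℝ} (hf : ContinuousOn f (frontier S)) (u : E m) :
    IntegrableOn (fun x => f x * inner ℝ (outerNormal S x) u) (frontier S) (surfaceMeasure m) :=
  hS.integrableOn_frontier hm (hf.mul (hS.continuousOn_outerNormal.inner continuousOn_const))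

/-- The Gauss formula is linear in the direction. -/
lemma IsCompactSmoothDomain.hasGauss_sub_smul {S O : Set (E m)} (hS : IsCompactSmoothDomain S)
    (hm : m ≠ 0) {u w : E m} (hu : HasGauss S u O) (hw : HasGauss S w O) (a b : ℝ) :
    HasGauss S (a • u - b • w) O := by
  intro f hf hc hs
  have h1 := integrable_fderiv_apply hf hc
  have h2 := hS.integrableOn_flux hm (hf.continuous.continuousOn (s := frontier S))
  simp only [map_sub, map_smul, inner_sub_right, inner_smul_right, mul_sub, smul_eq_mul]
  rw [integral_sub ((h1 u).integrableOn.const_mul a) ((h1 w).integrableOn.const_mul b)]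
  simp only [mul_left_comm _ a, mul_left_comm _ b]
  rw [integral_sub ((h2 u).const_mul a) ((h2 w).const_mul b)]
  simp only [integral_const_mul]
  rw [hu f hf hc hs, hw f hf hc hs]

lemma integral_fderiv_eq_zero {f : E m → ℝ} (hf : ContDiff ℝ 1 f) (hc : HasCompactSupport f)
    (u : E m) : ∫ x, fderiv ℝ f x u = 0 := by
  have h := integral_mul_fderiv_eq_neg_fderiv_mul_of_integrable (μ := (volume : Measure (E m)))
    (f := fun _ : E m => (1 : ℝ)) (g := f) (v := u) (by simp)
    (by simpa using integrable_fderiv_apply hf hc u)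
    (by simpa using hf.continuous.integrable_of_hasCompactSupport hc)
    (by fun_prop)
    fun x _ => hf.differentiable one_ne_zero x
  simpa using h

lemma hasGauss_interior (S : Set (E m)) (u : E m) : HasGauss S u (interior S) := by
  intro f hf hc hs
  have h1 : ∫ x in S, fderiv ℝ f x u = ∫ x, fderiv ℝ f x u := by
    refine setIntegral_eq_integral_of_forall_compl_eq_zero fun x hx => ?_
    rw [fderiv_of_notMem_tsupport ℝ fun h => hx (interior_subset (hs h))]
    rfl
  have h2 : ∫ x in frontier S, f x * inner ℝ (outerNormal S x) u ∂surfaceMeasure m = 0 := by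
    refine setIntegral_eq_zero_of_forall_eq_zero fun x hx => ?_
    rw [image_eq_zero_of_notMem_tsupport fun h => hx.2 (hs h), zero_mul]
  rw [h1, h2, integral_fderiv_eq_zero hf hc]

lemma hasGauss_compl {S : Set (E m)} (hS : IsClosed S) (u : E m) : HasGauss S u Sᶜ := by
  intro f hf hc hs
  have h1 : ∫ x in S, fderiv ℝ f x u = 0 := by
    refine setIntegral_eq_zero_of_forall_eq_zero fun x hx => ?_
    rw [fderiv_of_notMem_tsupport ℝ fun h => hs h hx]
    rfl
  have h2 : ∫ x in frontier S, f x * inner ℝ (outerNormal S x) u ∂surfaceMeasure m = 0 := by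
    refine setIntegral_eq_zero_of_forall_eq_zero fun x hx => ?_
    rw [image_eq_zero_of_notMem_tsupport fun h => hs h (hS.frontier_subset hx), zero_mul]
  rw [h1, h2]

/-- The Gauss formula near a boundary point. Every direction is a combination of two directions
that leave `S` transversally, and for these there are flattening charts. -/
lemma IsCompactSmoothDomain.exists_hasGauss_of_mem_frontier {S : Set (E m)}
    (hS : IsCompactSmoothDomain S) (hm : m ≠ 0) (u : E m) {p : E m} (hp : p ∈ frontier S) :
    ∃ O, IsOpen O ∧ p ∈ O ∧ HasGauss S u O := by
  obtain ⟨U, ρ, h, hpU, hne⟩ := hS.exists_isDefining hp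
  set N := gradient ρ p with hN
  have hNpos := norm_pos_iff.2 hne
  have key : ∀ v : E m, ‖v‖ = 1 → 0 < inner ℝ N v → ∃ O, IsOpen O ∧ p ∈ O ∧ HasGauss S v O := by
    intro v hv hpos
    obtain ⟨e, hpe, he, heS⟩ := h.exists_isFlatChart hpU hv hpos
    refine ⟨e.source, e.open_source, hpe, fun f hf hc hs => ?_⟩
    rw [he.setIntegral_fderiv hS.isCompact.measurableSet heS hf hc hs,
      he.setIntegral_frontier hm heS hf.continuous hs]
  set v₀ := ‖N‖⁻¹ • N with hv₀
  have hv₀n : ‖v₀‖ = 1 := norm_smul_inv_norm (𝕜 := ℝ) hne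
  have hNv₀ : N = ‖N‖ • v₀ := by rw [hv₀, smul_smul, mul_inv_cancel₀ hNpos.ne', one_smul]
  -- adding this multiple of the normal `v₀` to `u` gives a vector with normal component `1`
  set t := 1 - inner ℝ v₀ u with ht
  have h1 : inner ℝ v₀ (u + t • v₀) = 1 := by
    rw [inner_add_right, inner_smul_right, real_inner_self_eq_norm_sq, hv₀n, ht]; ring
  have hw0 : u + t • v₀ ≠ 0 := by
    intro h0
    rw [h0, inner_zero_right] at h1
    exact zero_ne_one h1
  have hwpos := norm_pos_iff.2 hw0
  obtain ⟨O₁, hO₁, hp₁, hg₁⟩ := key v₀ hv₀n (by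
    rw [hNv₀, inner_smul_left, real_inner_self_eq_norm_sq, hv₀n]; simpa using hne)
  obtain ⟨O₂, hO₂, hp₂, hg₂⟩ := key (‖u + t • v₀‖⁻¹ • (u + t • v₀))
    (norm_smul_inv_norm (𝕜 := ℝ) hw0) (by
      rw [hNv₀, inner_smul_left, inner_smul_right, h1]; simp; positivity)
  refine ⟨O₁ ∩ O₂, hO₁.inter hO₂, ⟨hp₁, hp₂⟩, ?_⟩
  have := hS.hasGauss_sub_smul hm (hg₂.mono (Set.inter_subset_right (s := O₁)))
    (hg₁.mono (Set.inter_subset_left (t := O₂))) ‖u + t • v₀‖ t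
  rw [smul_smul, mul_inv_cancel₀ hwpos.ne', one_smul, add_sub_cancel_right] at this
  exact this

/-- A smooth cut-off function for a compact set inside an open set. -/
lemma exists_cutoff {K O : Set (E m)} (hK : IsCompact K) (hO : IsOpen O) (hKO : K ⊆ O) :
    ∃ χ : E m → ℝ, ContDiff ℝ 1 χ ∧ HasCompactSupport χ ∧ tsupport χ ⊆ O ∧
      ∀ᶠ x in 𝓝ˢ K, χ x = 1 := by
  obtain ⟨T, hT, hKT, hTO⟩ := exists_compact_between hK hO hKO
  obtain ⟨χ, h1, h0, -⟩ := exists_contMDiffMap_one_nhds_of_subset_interior (n := 1)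
    (modelWithCornersSelf ℝ (E m)) hK.isClosed hKT
  have hsupp : tsupport χ ⊆ T := closure_minimal (fun x hx => by
    by_contra hcon
    exact hx (h0 x hcon)) hT.isClosed
  exact ⟨χ, χ.contMDiff.contDiff, hT.of_isClosed_subset (isClosed_tsupport _) hsupp,
    hsupp.trans hTO, h1⟩

lemma contDiff_cutoff_mul {O : Set (E m)} (hO : IsOpen O) {χ f : E m → ℝ} (hχ : ContDiff ℝ 1 χ)
    (hs : tsupport χ ⊆ O) (hf : ContDiffOn ℝ 1 f O) : ContDiff ℝ 1 fun x => χ x * f x := by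
  rw [contDiff_iff_contDiffAt]
  intro x
  by_cases hx : x ∈ O
  · exact hχ.contDiffAt.mul (hf.contDiffAt (hO.mem_nhds hx))
  · refine (contDiffAt_const (c := (0 : ℝ))).congr_of_eventuallyEq ?_
    filter_upwards [(isClosed_tsupport χ).isOpen_compl.mem_nhds fun h => hx (hs h)] with z hz
    rw [image_eq_zero_of_notMem_tsupport hz, zero_mul]

lemma IsCompactSmoothDomain.hasGauss_union {S O₁ O₂ : Set (E m)} (hS : IsCompactSmoothDomain S)
    (hm : m ≠ 0) {u : E m} (hO₁ : IsOpen O₁) (hO₂ : IsOpen O₂) (h₁ : HasGauss S u O₁)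
    (h₂ : HasGauss S u O₂) : HasGauss S u (O₁ ∪ O₂) := by
  intro f hf hc hs
  have hK : IsCompact (tsupport f \ O₂) := IsCompact.diff hc hO₂
  obtain ⟨χ, hχ, -, hχs, hχ1⟩ := exists_cutoff hK hO₁ fun x hx => (hs hx.1).resolve_right hx.2
  have hd1 : ContDiff ℝ 1 fun x => χ x * f x := hχ.mul hf
  have hd2 : ContDiff ℝ 1 fun x => (1 - χ x) * f x := (contDiff_const.sub hχ).mul hf
  have hc1 : HasCompactSupport fun x => χ x * f x := hc.mul_left
  have hc2 : HasCompactSupport fun x => (1 - χ x) * f x := hc.mul_left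
  have e1 := h₁ _ hd1 hc1 ((tsupport_mul_subset_left (f := χ) (g := f)).trans hχs)
  have e2 := h₂ _ hd2 hc2 (by
    intro x hx
    have hxf := tsupport_mul_subset_right (f := fun x => 1 - χ x) (g := f) hx
    by_contra hx2
    refine (notMem_tsupport_iff_eventuallyEq.2 ?_) hx
    filter_upwards [(eventually_nhdsSet_iff_forall.1 hχ1) x ⟨hxf, hx2⟩] with z hz
    simp [hz])
  have hsum : ∀ x, fderiv ℝ f x u
      = fderiv ℝ (fun x => χ x * f x) x u + fderiv ℝ (fun x => (1 - χ x) * f x) x u := by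
    intro x
    have : f = (fun x => χ x * f x) + fun x => (1 - χ x) * f x := by
      funext x; simp only [Pi.add_apply]; ring
    conv_lhs => rw [this]
    rw [fderiv_add (hd1.differentiable one_ne_zero x) (hd2.differentiable one_ne_zero x)]
    rfl
  simp only [hsum]
  rw [integral_add (integrable_fderiv_apply hd1 hc1 u).integrableOn
    (integrable_fderiv_apply hd2 hc2 u).integrableOn, e1, e2,
    ← integral_add (hS.integrableOn_flux hm hd1.continuous.continuousOn u)
      (hS.integrableOn_flux hm hd2.continuous.continuousOn u)]
  congr 1
  funext x
  ring

lemma IsCompactSmoothDomain.hasGauss_univ {S : Set (E m)} (hS : IsCompactSmoothDomain S)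
    (hm : m ≠ 0) (u : E m) : HasGauss S u Set.univ := by
  intro f hf hc _
  have hloc : ∀ p : E m, ∃ O, IsOpen O ∧ p ∈ O ∧ HasGauss S u O := by
    intro p
    by_cases hp : p ∈ S
    · by_cases hi : p ∈ interior S
      · exact ⟨_, isOpen_interior, hi, hasGauss_interior S u⟩
      · exact hS.exists_hasGauss_of_mem_frontier hm u ⟨subset_closure hp, hi⟩
    · exact ⟨Sᶜ, hS.isCompact.isClosed.isOpen_compl, hp, hasGauss_compl hS.isCompact.isClosed u⟩
  obtain ⟨O, -, hO, hG⟩ := IsCompact.induction_on (s := tsupport f)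
    (p := fun T => ∃ O, IsOpen O ∧ T ⊆ O ∧ HasGauss S u O) hc
    ⟨_, isOpen_interior, Set.empty_subset _, hasGauss_interior S u⟩
    (fun s t hst ⟨O, h1, h2, h3⟩ => ⟨O, h1, hst.trans h2, h3⟩)
    (fun s t ⟨O, h1, h2, h3⟩ ⟨O', h1', h2', h3'⟩ => ⟨O ∪ O', h1.union h1',
      Set.union_subset_union h2 h2', hS.hasGauss_union hm h1 h1' h3 h3'⟩)
    (fun p _ => by
      obtain ⟨O, h1, h2, h3⟩ := hloc p
      exact ⟨O, mem_nhdsWithin_of_mem_nhds (h1.mem_nhds h2), O, h1, subset_rfl, h3⟩)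
  exact hG f hf hc hO

/-- **Gauss's theorem** for a compact domain with smooth boundary. -/
theorem IsCompactSmoothDomain.setIntegral_fderiv {S Ω : Set (E m)} (hS : IsCompactSmoothDomain S)
    (hm : m ≠ 0) (hΩ : IsOpen Ω) (hSΩ : S ⊆ Ω) {f : E m → ℝ} (hf : ContDiffOn ℝ 1 f Ω)
    (u : E m) : ∫ x in S, fderiv ℝ f x u
      = ∫ x in frontier S, f x * inner ℝ (outerNormal S x) u ∂surfaceMeasure m := by
  obtain ⟨χ, hχ, hχc, hχs, hχ1⟩ := exists_cutoff hS.isCompact hΩ hSΩ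
  have key := hS.hasGauss_univ hm u _ (contDiff_cutoff_mul hΩ hχ hχs hf) hχc.mul_right
    (Set.subset_univ _)
  have hev : ∀ x ∈ S, (fun x => χ x * f x) =ᶠ[𝓝 x] f := by
    intro x hx
    filter_upwards [(eventually_nhdsSet_iff_forall.1 hχ1) x hx] with z hz
    rw [hz, one_mul]
  have h1 : ∫ x in S, fderiv ℝ f x u = ∫ x in S, fderiv ℝ (fun x => χ x * f x) x u :=
    setIntegral_congr_fun hS.isCompact.measurableSet fun x hx => by
      rw [(hev x hx).fderiv_eq]
  rw [h1, key]
  refine setIntegral_congr_fun isClosed_frontier.measurableSet fun x hx => ?_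
  rw [(hev x (hS.isCompact.isClosed.frontier_subset hx)).eq_of_nhds]

/-! ### Gauss's theorem with a point singularity -/

/-- A radial profile that vanishes near `0` and is `1` from `ε` on. -/
def cutProfile (ε r : ℝ) : ℝ := Real.smoothTransition (2 * r ^ 2 / ε ^ 2 - 1)

/-- The derivative of `cutProfile ε`. -/
def cutProfileDeriv (ε r : ℝ) : ℝ :=
  deriv Real.smoothTransition (2 * r ^ 2 / ε ^ 2 - 1) * (4 * r / ε ^ 2)

lemma hasDerivAt_smoothTransition (t : ℝ) :
    HasDerivAt Real.smoothTransition (deriv Real.smoothTransition t) t :=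
  ((Real.smoothTransition.contDiff (n := 1)).differentiable one_ne_zero t).hasDerivAt

lemma hasDerivAt_cutProfile (ε r : ℝ) :
    HasDerivAt (cutProfile ε) (cutProfileDeriv ε r) r := by
  have h1 : HasDerivAt (fun r : ℝ => 2 * r ^ 2 / ε ^ 2 - 1) (4 * r / ε ^ 2) r := by
    have := ((((hasDerivAt_id r).pow 2).const_mul 2).div_const (ε ^ 2)).sub_const 1
    refine this.congr_deriv ?_
    simp only [id_eq, Nat.cast_ofNat, mul_one]
    ring
  exact (hasDerivAt_smoothTransition _).comp r h1

lemma cutProfile_nonneg (ε r : ℝ) : 0 ≤ cutProfile ε r := Real.smoothTransition.nonneg _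

lemma cutProfile_le_one (ε r : ℝ) : cutProfile ε r ≤ 1 := Real.smoothTransition.le_one _

lemma one_le_profile_arg {ε r : ℝ} (hε : 0 < ε) (hr : ε ≤ r) : 1 ≤ 2 * r ^ 2 / ε ^ 2 - 1 := by
  have : 2 ≤ 2 * r ^ 2 / ε ^ 2 := by
    rw [le_div_iff₀ (by positivity)]
    nlinarith
  linarith

lemma cutProfile_of_le {ε r : ℝ} (hε : 0 < ε) (hr : ε ≤ r) : cutProfile ε r = 1 :=
  Real.smoothTransition.one_of_one_le (one_le_profile_arg hε hr)

lemma cutProfile_of_sq_le {ε r : ℝ} (hε : 0 < ε) (hr : 2 * r ^ 2 ≤ ε ^ 2) :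
    cutProfile ε r = 0 := by
  refine Real.smoothTransition.zero_iff_nonpos.2 ?_
  have : 2 * r ^ 2 / ε ^ 2 ≤ 1 := by
    rw [div_le_one (by positivity)]; exact hr
  linarith

lemma cutProfileDeriv_of_le {ε r : ℝ} (hε : 0 < ε) (hr : ε ≤ r) : cutProfileDeriv ε r = 0 := by
  have h : IsLocalMax Real.smoothTransition (2 * r ^ 2 / ε ^ 2 - 1) :=
    Eventually.of_forall fun t => by
      rw [Real.smoothTransition.one_of_one_le (one_le_profile_arg hε hr)]
      exact Real.smoothTransition.le_one t
  rw [cutProfileDeriv, h.deriv_eq_zero, zero_mul]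

lemma cutProfileDeriv_nonneg (ε : ℝ) {r : ℝ} (hr : 0 ≤ r) : 0 ≤ cutProfileDeriv ε r :=
  mul_nonneg Real.smoothTransition.monotone.deriv_nonneg (by positivity)

lemma tendsto_cutProfile {ε : ℝ} (hε : 0 < ε) : Tendsto (cutProfile ε) atTop (𝓝 1) :=
  tendsto_const_nhds.congr' (by
    filter_upwards [eventually_ge_atTop ε] with r hr using (cutProfile_of_le hε hr).symm)

/-- The surface area `m |B_1|` of the unit sphere of `ℝ^m`. -/
def sphereArea (m : ℕ) : ℝ := m * volume.real (Metric.ball (0 : E m) 1)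

/-- The mollifier `|x|^{1-m} ∂_r (cutProfile ε)`, an approximation of `sphereArea m • δ`. -/
def mollifier (m : ℕ) (ε r : ℝ) : ℝ := cutProfileDeriv ε r / r ^ (m - 1)

lemma mollifier_nonneg (m : ℕ) (ε : ℝ) {r : ℝ} (hr : 0 ≤ r) : 0 ≤ mollifier m ε r :=
  div_nonneg (cutProfileDeriv_nonneg ε hr) (by positivity)

lemma nontrivial_E (hm : m ≠ 0) : Nontrivial (E m) :=
  have : Nonempty (Fin m) := ⟨⟨0, Nat.pos_of_ne_zero hm⟩⟩
  inferInstance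

lemma integrable_mollifier (hm : m ≠ 0) {ε : ℝ} (hε : 0 < ε) (y : E m) :
    Integrable fun x : E m => mollifier m ε ‖x - y‖ := by
  have := nontrivial_E hm
  refine Integrable.comp_sub_right (f := fun x : E m => mollifier m ε ‖x‖) ?_ y
  rw [integrable_fun_norm_addHaar volume (f := mollifier m ε), finrank_euclideanSpace_fin]
  have h := integrableOn_Ioi_deriv_of_nonneg (a := 0)
    (hasDerivAt_cutProfile ε 0).continuousAt.continuousWithinAt
    (fun r _ => hasDerivAt_cutProfile ε r)
    (fun r hr => cutProfileDeriv_nonneg ε (le_of_lt hr)) (tendsto_cutProfile hε)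
  refine h.congr_fun (fun r hr => ?_) measurableSet_Ioi
  have : r ^ (m - 1) ≠ 0 := pow_ne_zero _ (ne_of_gt hr)
  simp only [mollifier, smul_eq_mul]
  field_simp

lemma integral_mollifier (hm : m ≠ 0) {ε : ℝ} (hε : 0 < ε) (y : E m) :
    ∫ x : E m, mollifier m ε ‖x - y‖ = sphereArea m := by
  have := nontrivial_E hm
  rw [integral_sub_right_eq_self (fun x : E m => mollifier m ε ‖x‖) y,
    integral_fun_norm_addHaar volume (mollifier m ε), finrank_euclideanSpace_fin]
  have h := integral_Ioi_of_hasDerivAt_of_nonneg (a := 0)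
    (hasDerivAt_cutProfile ε 0).continuousAt.continuousWithinAt
    (fun r _ => hasDerivAt_cutProfile ε r)
    (fun r hr => cutProfileDeriv_nonneg ε (le_of_lt hr)) (tendsto_cutProfile hε)
  have h2 : ∫ r in Set.Ioi (0 : ℝ), r ^ (m - 1) • mollifier m ε r = 1 := by
    rw [cutProfile_of_sq_le hε (by simp; positivity), sub_zero] at h
    rw [← h]
    refine setIntegral_congr_fun measurableSet_Ioi fun r hr => ?_
    have : r ^ (m - 1) ≠ 0 := pow_ne_zero _ (ne_of_gt hr)
    simp only [mollifier, smul_eq_mul]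
    field_simp
  rw [h2, sphereArea]
  simp

lemma contDiff_cutoff (ε : ℝ) (y : E m) : ContDiff ℝ 1 fun x : E m => cutProfile ε ‖x - y‖ := by
  have h1 : ContDiff ℝ 1 fun x : E m => 2 * ‖x - y‖ ^ 2 / ε ^ 2 - 1 :=
    ((contDiff_const.mul ((contDiff_id.sub contDiff_const).norm_sq ℝ)).div_const _).sub
      contDiff_const
  exact (Real.smoothTransition.contDiff (n := 1)).comp h1

lemma fderiv_cutoff (ε : ℝ) {x y : E m} (hx : x ≠ y) (u : E m) :
    fderiv ℝ (fun x : E m => cutProfile ε ‖x - y‖) x u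
      = cutProfileDeriv ε ‖x - y‖ * (inner ℝ (x - y) u / ‖x - y‖) := by
  have hr : ‖x - y‖ ≠ 0 := norm_ne_zero_iff.2 (sub_ne_zero.2 hx)
  have h0 : HasFDerivAt (fun x : E m => ‖x - y‖ ^ 2) (2 • (innerSL ℝ (x - y))) x := by
    simpa using ((hasFDerivAt_id x).sub_const y).norm_sq
  have h1 : HasFDerivAt (fun x : E m => 2 * ‖x - y‖ ^ 2 / ε ^ 2 - 1)
      ((2 / ε ^ 2) • (2 • (innerSL ℝ (x - y)))) x := by
    refine ((h0.const_mul (2 / ε ^ 2)).sub_const 1).congr_of_eventuallyEq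
      (Eventually.of_forall fun z => ?_)
    simp only
    ring
  have h2 := (hasDerivAt_smoothTransition (2 * ‖x - y‖ ^ 2 / ε ^ 2 - 1)).comp_hasFDerivAt x h1
  have h3 : fderiv ℝ (fun x : E m => cutProfile ε ‖x - y‖) x = _ := h2.fderiv
  rw [h3, cutProfileDeriv]
  simp only [smul_apply, nsmul_eq_mul, Nat.cast_ofNat, smul_eq_mul, innerSL_apply_apply]
  field_simp
  ring

/-- Gauss's theorem for a vector field. -/
theorem IsCompactSmoothDomain.setIntegral_div {S Ω : Set (E m)} (hS : IsCompactSmoothDomain S)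
    (hm : m ≠ 0) (hΩ : IsOpen Ω) (hSΩ : S ⊆ Ω) {F : Fin m → E m → ℝ}
    (hF : ∀ j, ContDiffOn ℝ 1 (F j) Ω) :
    ∫ x in S, ∑ j, fderiv ℝ (F j) x (EuclideanSpace.single j 1)
      = ∫ x in frontier S, ∑ j, F j x * outerNormal S x j ∂surfaceMeasure m := by
  have hinner : ∀ (j : Fin m) (x : E m),
      inner ℝ (outerNormal S x) (EuclideanSpace.single j (1 : ℝ)) = outerNormal S x j := by
    intro j x
    rw [EuclideanSpace.inner_single_right]
    simp
  have hflux := fun j => hS.integrableOn_flux hm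
    ((hF j).continuousOn.mono (hS.isCompact.isClosed.frontier_subset.trans hSΩ))
      (EuclideanSpace.single j 1)
  have hdiv : ∀ j, IntegrableOn (fun x => fderiv ℝ (F j) x (EuclideanSpace.single j 1)) S :=
    fun j => ((((hF j).continuousOn_fderiv_of_isOpen hΩ le_rfl).clm_apply
      continuousOn_const).mono hSΩ).integrableOn_compact hS.isCompact
  simp only [hinner] at hflux
  rw [integral_finsetSum _ fun j _ => hdiv j, integral_finsetSum _ fun j _ => hflux j]
  refine Finset.sum_congr rfl fun j _ => ?_
  rw [hS.setIntegral_fderiv hm hΩ hSΩ (hF j)]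
  simp only [hinner]

/-- Gauss's theorem for a vector field with a point singularity at `y`: if the flux density
`|x-y|^{m-1} ⟨F, (x-y)/|x-y|⟩` tends to `L` at `y`, the singularity contributes `L` times the area
of the unit sphere. -/
theorem IsCompactSmoothDomain.setIntegral_div_of_singular {S Ω : Set (E m)}
    (hS : IsCompactSmoothDomain S) (hm : m ≠ 0) (hΩ : IsOpen Ω) (hSΩ : S ⊆ Ω) {y : E m}
    (hy : y ∈ interior S) {F : Fin m → E m → ℝ} (hF : ∀ j, ContDiffOn ℝ 1 (F j) (Ω \ {y}))
    (hdiv : IntegrableOn (fun x => ∑ j, fderiv ℝ (F j) x (EuclideanSpace.single j 1)) S) {L : ℝ}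
    (hL : Tendsto (fun x => ∑ j, (x j - y j) / ‖x - y‖ * (‖x - y‖ ^ (m - 1) * F j x)) (𝓝[≠] y)
      (𝓝 L)) :
    (∫ x in frontier S, ∑ j, F j x * outerNormal S x j ∂surfaceMeasure m)
      - (∫ x in S, ∑ j, fderiv ℝ (F j) x (EuclideanSpace.single j 1)) = sphereArea m * L := by
  have := nontrivial_E hm
  set D : E m → ℝ := fun x => ∑ j, fderiv ℝ (F j) x (EuclideanSpace.single j 1) with hD
  set A := ∫ x in frontier S, ∑ j, F j x * outerNormal S x j ∂surfaceMeasure m with hA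
  set θ : ℝ → E m → ℝ := fun ε x => cutProfile ε ‖x - y‖ with hθ
  set H : E m → ℝ := fun x => ∑ j, (x j - y j) / ‖x - y‖ * (‖x - y‖ ^ (m - 1) * F j x) with hH
  have hSm := hS.isCompact.measurableSet
  have hne : ∀ᵐ x ∂volume.restrict S, x ≠ y :=
    ae_restrict_of_ae (Measure.ae_ne volume y)
  have hθle : ∀ ε x, ‖θ ε x‖ ≤ 1 := fun ε x => by
    rw [Real.norm_of_nonneg (cutProfile_nonneg _ _)]; exact cutProfile_le_one _ _
  have hΩy : IsOpen (Ω \ {y}) := hΩ.sdiff isClosed_singleton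
  obtain ⟨R, hR, hRS⟩ := Metric.mem_nhds_iff.1 (mem_interior_iff_mem_nhds.1 hy)
  -- the cut-off `θ ε` equals `1` on the boundary, so `θ ε • F` has the same flux as `F`; its
  -- divergence is `θ ε • div F` plus the flux density `H` weighted with the mollifier
  have hcut : ∀ ε, 0 < ε → ε < R → IntegrableOn (fun x => mollifier m ε ‖x - y‖ * H x) S ∧
      A = (∫ x in S, θ ε x * D x) + ∫ x in S, mollifier m ε ‖x - y‖ * H x := by
    intro ε hε hεR
    have hθd := contDiff_cutoff ε y
    have hzero : ∀ᶠ x in 𝓝 y, θ ε x = 0 := by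
      have h1 : ContinuousAt (fun x : E m => 2 * ‖x - y‖ ^ 2) y := by fun_prop
      filter_upwards [h1.eventually (gt_mem_nhds (show 2 * ‖y - y‖ ^ 2 < ε ^ 2 by
        simp; positivity))] with x hx
      exact cutProfile_of_sq_le hε hx.le
    have hGd : ∀ j, ContDiffOn ℝ 1 (fun x => θ ε x * F j x) Ω := by
      intro j x hx
      by_cases hxy : x = y
      · subst hxy
        refine ((contDiffAt_const (c := (0 : ℝ))).congr_of_eventuallyEq ?_).contDiffWithinAt
        filter_upwards [hzero] with z hz
        rw [hz, zero_mul]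
      · exact (hθd.contDiffAt.mul ((hF j).contDiffAt (hΩy.mem_nhds ⟨hx, hxy⟩))).contDiffWithinAt
    have hGi : IntegrableOn (fun x => ∑ j, fderiv ℝ (fun x => θ ε x * F j x) x
        (EuclideanSpace.single j 1)) S :=
      integrable_finsetSum _ fun j _ => ((((hGd j).continuousOn_fderiv_of_isOpen hΩ le_rfl).clm_apply
        continuousOn_const).mono hSΩ).integrableOn_compact hS.isCompact
    have hpt : ∀ x ∈ S, x ≠ y → ∑ j, fderiv ℝ (fun x => θ ε x * F j x) x
        (EuclideanSpace.single j 1) = θ ε x * D x + mollifier m ε ‖x - y‖ * H x := by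
      intro x hx hxy
      have hr : ‖x - y‖ ≠ 0 := norm_ne_zero_iff.2 (sub_ne_zero.2 hxy)
      rw [hD, hH]
      simp only [Finset.mul_sum]
      rw [← Finset.sum_add_distrib]
      refine Finset.sum_congr rfl fun j _ => ?_
      have hFx : DifferentiableAt ℝ (F j) x :=
        ((hF j).contDiffAt (hΩy.mem_nhds ⟨hSΩ hx, hxy⟩)).differentiableAt one_ne_zero
      rw [fderiv_fun_mul (hθd.differentiable one_ne_zero x) hFx, add_apply,
        smul_apply, smul_apply, hθ]
      simp only
      rw [fderiv_cutoff ε hxy, EuclideanSpace.inner_single_right, mollifier]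
      simp only [smul_eq_mul, conj_trivial, one_mul, PiLp.sub_apply]
      field_simp
    have hae : (fun x => ∑ j, fderiv ℝ (fun x => θ ε x * F j x) x (EuclideanSpace.single j 1))
        =ᵐ[volume.restrict S] fun x => θ ε x * D x + mollifier m ε ‖x - y‖ * H x := by
      filter_upwards [hne, ae_restrict_mem hSm] with x hx hxS using hpt x hxS hx
    have hθD : IntegrableOn (fun x => θ ε x * D x) S :=
      hdiv.bdd_mul hθd.continuous.aestronglyMeasurable (Eventually.of_forall fun x => hθle ε x)
    have hκ : IntegrableOn (fun x => mollifier m ε ‖x - y‖ * H x) S := by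
      refine ((hGi.congr hae).sub hθD).congr (Eventually.of_forall fun x => ?_)
      simp
    refine ⟨hκ, ?_⟩
    rw [← integral_add hθD hκ, ← integral_congr_ae hae, hS.setIntegral_div hm hΩ hSΩ hGd]
    refine setIntegral_congr_fun isClosed_frontier.measurableSet fun x hx => ?_
    have hxR : ε ≤ ‖x - y‖ := by
      by_contra hcon
      refine hx.2 (mem_interior_iff_mem_nhds.2 ?_)
      refine mem_of_superset (Metric.isOpen_ball.mem_nhds (?_ : x ∈ Metric.ball y R)) hRS
      rw [Metric.mem_ball, dist_eq_norm]
      linarith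
    simp only [hθ, cutProfile_of_le hε hxR, one_mul]
  have hlim1 : Tendsto (fun ε => ∫ x in S, θ ε x * D x) (𝓝[>] 0) (𝓝 (∫ x in S, D x)) := by
    refine tendsto_integral_filter_of_dominated_convergence (fun x => ‖D x‖) ?_ ?_ hdiv.norm ?_
    · exact Eventually.of_forall fun ε =>
        ((contDiff_cutoff ε y).continuous.aestronglyMeasurable).mul hdiv.aestronglyMeasurable
    · refine Eventually.of_forall fun ε => Eventually.of_forall fun x => ?_
      rw [norm_mul]
      exact mul_le_of_le_one_left (norm_nonneg _) (hθle ε x)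
    · filter_upwards [hne] with x hx
      have hr : 0 < ‖x - y‖ := norm_pos_iff.2 (sub_ne_zero.2 hx)
      refine tendsto_const_nhds.congr' ?_
      filter_upwards [Ioc_mem_nhdsGT hr] with ε hε
      simp only [hθ, cutProfile_of_le hε.1 hε.2, one_mul]
  have hlim2 : Tendsto (fun ε => ∫ x in S, mollifier m ε ‖x - y‖ * H x) (𝓝[>] 0)
      (𝓝 (sphereArea m * L)) := by
    rw [Metric.tendsto_nhds]
    intro δ hδ
    have hω : 0 ≤ sphereArea m := by unfold sphereArea; positivity
    -- the mollifier has mass `sphereArea m`; the summand `1` makes the final estimate strict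
    set δ' := δ / (sphereArea m + 1) with hδ'
    have hδ'0 : 0 < δ' := by positivity
    obtain ⟨r, hr, hrH⟩ :=
      Metric.mem_nhdsWithin_iff.1 (hL.eventually (Metric.closedBall_mem_nhds L hδ'0))
    filter_upwards [Ioo_mem_nhdsGT (lt_min hr hR)] with ε hε
    obtain ⟨hε0, hε1⟩ := hε
    have hεr := hε1.trans_le (min_le_left _ _)
    have hεR := hε1.trans_le (min_le_right _ _)
    obtain ⟨hκ, -⟩ := hcut ε hε0 hεR
    have hmol := integrable_mollifier hm hε0 y
    have hint : ∫ x in S, mollifier m ε ‖x - y‖ = sphereArea m := by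
      rw [← integral_mollifier hm hε0 y]
      refine setIntegral_eq_integral_of_forall_compl_eq_zero fun x hx => ?_
      have : ε ≤ ‖x - y‖ := by
        by_contra hcon
        refine hx (hRS ?_)
        rw [Metric.mem_ball, dist_eq_norm]
        linarith
      rw [mollifier, cutProfileDeriv_of_le hε0 this, zero_div]
    have hdiff : (∫ x in S, mollifier m ε ‖x - y‖ * H x) - sphereArea m * L
        = ∫ x in S, mollifier m ε ‖x - y‖ * (H x - L) := by
      rw [← hint, ← integral_mul_const, ← integral_sub hκ (hmol.integrableOn.mul_const L)]
      simp only [mul_sub]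
    rw [dist_eq_norm, hdiff]
    have hbound : ‖∫ x in S, mollifier m ε ‖x - y‖ * (H x - L)‖
        ≤ ∫ x in S, mollifier m ε ‖x - y‖ * δ' := by
      refine norm_integral_le_of_norm_le (hmol.integrableOn.mul_const δ') ?_
      filter_upwards [hne] with x hx
      rw [norm_mul, Real.norm_of_nonneg (mollifier_nonneg m ε (norm_nonneg _))]
      by_cases hxε : ε ≤ ‖x - y‖
      · rw [mollifier, cutProfileDeriv_of_le hε0 hxε, zero_div, zero_mul, zero_mul]
      · refine mul_le_mul_of_nonneg_left ?_ (mollifier_nonneg m ε (norm_nonneg _))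
        have : x ∈ Metric.ball y r ∩ {y}ᶜ := by
          refine ⟨?_, hx⟩
          rw [Metric.mem_ball, dist_eq_norm]
          linarith
        have := hrH this
        rwa [← dist_eq_norm]
    refine hbound.trans_lt ?_
    rw [integral_mul_const, hint, hδ', ← mul_div_assoc, div_lt_iff₀ (by positivity)]
    nlinarith
  have hlim : Tendsto (fun _ : ℝ => A) (𝓝[>] 0) (𝓝 ((∫ x in S, D x) + sphereArea m * L)) := by
    refine (hlim1.add hlim2).congr' ?_
    filter_upwards [Ioo_mem_nhdsGT hR] with ε hε using ((hcut ε hε.1 hε.2).2).symm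
  have := tendsto_nhds_unique tendsto_const_nhds hlim
  rw [this]
  ring

/-! ### The scalar coefficients of the kernel -/

/-- The scalar functions that make up the Cauchy kernel: `ν_{2k+2}` for `k < n` and
`∂_i ν_{2k+2}` for `k ≤ n`. -/
def kerCoeff (m n : ℕ) : Fin n ⊕ (Fin (n + 1) × Fin m) → E m → ℝ
  | .inl k => nuEven m (k + 1)
  | .inr p => fun x => fderiv ℝ (nuEven m (p.1 + 1)) x (EuclideanSpace.single p.2 1)

lemma contDiffAt_kerCoeff (κ : Fin n ⊕ (Fin (n + 1) × Fin m)) {x : E m} (hx : x ≠ 0) :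
    ContDiffAt ℝ 1 (kerCoeff m n κ) x := by
  rcases κ with k | p
  · exact (contDiffAt_nuEven _ hx).of_le (by norm_cast)
  · exact contDiffAt_fderiv_nuEven _ hx _

lemma sphereArea_pos (hm : m ≠ 0) : 0 < sphereArea m := by
  have := nontrivial_E hm
  have h1 : 0 < volume.real (Metric.ball (0 : E m) 1) :=
    ENNReal.toReal_pos (Metric.measure_ball_pos _ _ one_pos).ne' measure_ball_lt_top.ne
  have h2 : (0 : ℝ) < m := by exact_mod_cast Nat.pos_of_ne_zero hm
  exact mul_pos h2 h1

lemma norm_pow_mul_kerCoeff_inr_zero (hm : m ≠ 0) (i : Fin m) {x : E m} (hx : x ≠ 0) :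
    ‖x‖ ^ (m - 1) * kerCoeff m n (.inr (0, i)) x = -(x i / ‖x‖ / sphereArea m) := by
  have h := norm_pow_mul_fderiv_nuEven_one hm hx i
  have hr : ‖x‖ ≠ 0 := norm_ne_zero_iff.2 hx
  have hω := (sphereArea_pos hm).ne'
  rw [← sphereArea, ← mul_pow_sub_one hm] at h
  have h2 : ‖x‖ ^ (m - 1) * kerCoeff m n (.inr (0, i)) x
      = ‖x‖⁻¹ * (‖x‖ * ‖x‖ ^ (m - 1) * fderiv ℝ (nuEven m 1) x (EuclideanSpace.single i 1)) := by
    simp only [kerCoeff, Fin.val_zero, zero_add]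
    field_simp
  rw [h2, h]
  field_simp

lemma tendsto_norm_pow_mul_kerCoeff (hm : m ≠ 0) (κ : Fin n ⊕ (Fin (n + 1) × Fin m))
    (hκ : ∀ i, κ ≠ .inr (0, i)) :
    Tendsto (fun x => ‖x‖ ^ (m - 1) * kerCoeff m n κ x) (𝓝[≠] 0) (𝓝 0) := by
  rcases κ with k | ⟨k, i⟩
  · exact tendsto_norm_pow_mul_nuEven hm (by omega)
  · refine tendsto_norm_pow_mul_fderiv_nuEven hm ?_ i
    have : k ≠ 0 := fun h => hκ i (by rw [h])
    have h1 : 0 < (k : ℕ) := Nat.pos_of_ne_zero (Fin.val_ne_zero_iff.2 this)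
    exact Nat.succ_le_succ h1

lemma eventually_norm_kerCoeff_le (hm : m ≠ 0) (κ : Fin n ⊕ (Fin (n + 1) × Fin m)) :
    ∃ C, ∀ᶠ x in 𝓝[≠] (0 : E m), ‖‖x‖ ^ (m - 1) * kerCoeff m n κ x‖ ≤ C := by
  by_cases hκ : ∀ i, κ ≠ .inr (0, i)
  · refine ⟨1, ?_⟩
    have := (tendsto_norm_pow_mul_kerCoeff hm κ hκ).norm
    rw [norm_zero] at this
    filter_upwards [this.eventually (gt_mem_nhds one_pos)] with x hx using hx.le
  · push Not at hκ
    obtain ⟨i, rfl⟩ := hκ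
    refine ⟨1 / sphereArea m, ?_⟩
    filter_upwards [self_mem_nhdsWithin] with x hx
    have hω := sphereArea_pos hm
    have hr : 0 < ‖x‖ := norm_pos_iff.2 hx
    rw [norm_pow_mul_kerCoeff_inr_zero hm i hx, norm_neg, norm_div, norm_div, norm_norm,
      Real.norm_of_nonneg hω.le]
    gcongr
    rw [div_le_one hr]
    exact PiLp.norm_apply_le x i

/-- A function that is continuous off the origin and `O(|x|^{1-m})` at the origin is integrable on
compact sets. -/
lemma integrableOn_of_norm_pow_mul_bounded (hm : m ≠ 0) {f : E m → ℝ} (hf : ContinuousOn f {0}ᶜ)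
    {C : ℝ} (hC : ∀ᶠ x in 𝓝[≠] (0 : E m), ‖‖x‖ ^ (m - 1) * f x‖ ≤ C) {T : Set (E m)}
    (hT : IsCompact T) : IntegrableOn f T := by
  have := nontrivial_E hm
  obtain ⟨r, hr, hrC⟩ := Metric.mem_nhdsWithin_iff.1 hC
  have hball : IntegrableOn f (Metric.ball 0 r) := by
    have hg : IntegrableOn (fun x : E m => C / ‖x‖ ^ (m - 1)) (Metric.ball 0 r) := by
      refine (integrableOn_fun_norm_addHaar volume (f := fun s => C / s ^ (m - 1))).2 ?_
      rw [finrank_euclideanSpace_fin]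
      have hconst : IntegrableOn (fun _ : ℝ => C) (Set.Ioo 0 r) := by simp
      refine hconst.congr_fun (fun s hs => ?_) measurableSet_Ioo
      have : s ^ (m - 1) ≠ 0 := pow_ne_zero _ hs.1.ne'
      simp only [smul_eq_mul]
      field_simp
    refine hg.mono' ?_ ?_
    · have h := hf.aestronglyMeasurable (μ := volume) (measurableSet_singleton (0 : E m)).compl
      rw [restrict_compl_singleton] at h
      exact h.restrict
    · filter_upwards [ae_restrict_mem measurableSet_ball, ae_restrict_of_ae
        (Measure.ae_ne volume (0 : E m))] with x hx hx0
      have h1 : ‖‖x‖ ^ (m - 1) * f x‖ ≤ C := hrC ⟨hx, hx0⟩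
      have hpos : 0 < ‖x‖ ^ (m - 1) := pow_pos (norm_pos_iff.2 hx0) _
      rw [norm_mul, Real.norm_of_nonneg hpos.le] at h1
      rw [le_div_iff₀ hpos, mul_comm]
      exact h1
  have hcpt : IntegrableOn f (T \ Metric.ball 0 r) := by
    refine (hf.mono fun x hx h0 => hx.2 ?_).integrableOn_compact (hT.diff Metric.isOpen_ball)
    rw [Set.mem_singleton_iff.1 h0]
    exact Metric.mem_ball_self hr
  refine (hball.union hcpt).mono_set fun x hx => ?_
  by_cases h : x ∈ Metric.ball 0 r
  · exact Or.inl h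
  · exact Or.inr ⟨hx, h⟩

lemma integrableOn_kerCoeff (hm : m ≠ 0) (κ : Fin n ⊕ (Fin (n + 1) × Fin m)) (y : E m)
    {T : Set (E m)} (hT : IsCompact T) : IntegrableOn (fun x => kerCoeff m n κ (x - y)) T := by
  obtain ⟨C, hC⟩ := eventually_norm_kerCoeff_le hm κ
  have hc : ContinuousOn (kerCoeff m n κ) {0}ᶜ := fun x hx =>
    (contDiffAt_kerCoeff κ hx).continuousAt.continuousWithinAt
  have h := integrableOn_of_norm_pow_mul_bounded hm hc hC (hT.image (continuous_sub_right y))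
  have h2 := (measurePreserving_sub_right volume y).integrableOn_comp_preimage
    (Homeomorph.subRight y).measurableEmbedding |>.2 h
  rwa [Set.preimage_image_eq _ (sub_left_injective)] at h2

/-! ### The kernel as a finite sum -/

lemma integral_sum_smul {A : Type*} [AddCommGroup A] [Module ℝ A] {ι : Type*} [Fintype ι]
    {μ : Measure (E m)} {s : Set (E m)} {c : ι → E m → ℝ} (w : ι → A)
    (hc : ∀ i, IntegrableOn (c i) s μ) (ℓ : A →ₗ[ℝ] ℝ) :
    IntegrableOn (fun x => ℓ (∑ i, c i x • w i)) s μ ∧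
      ∫ x in s, ℓ (∑ i, c i x • w i) ∂μ = ℓ (∑ i, (∫ x in s, c i x ∂μ) • w i) := by
  simp only [map_sum, map_smul, smul_eq_mul]
  refine ⟨integrable_finsetSum _ fun i _ => (hc i).mul_const _, ?_⟩
  rw [integral_finsetSum _ fun i _ => (hc i).mul_const _]
  simp only [integral_mul_const]

namespace SuperCalculus

variable {A : Type*} [Ring A] [Algebra ℝ A] (D : SuperCalculus m n A)

/-- The elements of the algebra that go with the scalar coefficients of the kernel. -/
def kerVec : Fin n ⊕ (Fin (n + 1) × Fin m) → A
  | .inl k => (Real.pi ^ n * (2 * (4 ^ (k : ℕ) * ((k : ℕ).factorial : ℝ)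
      / ((n - k - 1).factorial : ℝ)))) • (D.q ^ (n - k - 1) * D.zF)
  | .inr p => (-(Real.pi ^ n * (4 ^ (p.1 : ℕ) * ((p.1 : ℕ).factorial : ℝ)
      / ((n - p.1).factorial : ℝ)))) • (D.eB p.2 * D.q ^ (n - p.1))

lemma kernel_eq_sum (N : ℕ → ℝ) (dN : ℕ → Fin m → ℝ) :
    D.kernel N dN = ∑ κ, (Sum.elim (fun k : Fin n => N k)
      (fun p : Fin (n + 1) × Fin m => dN p.1 p.2) κ) • D.kerVec κ := by
  rw [kernel_eq, Fintype.sum_sum_type, Fintype.sum_prod_type, Finset.sum_range, Finset.sum_range,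
    Finset.smul_sum, Finset.smul_sum]
  congr 1
  · refine Finset.sum_congr rfl fun k _ => ?_
    simp only [Sum.elim_inl, kerVec, smul_smul]
    congr 1
    ring
  · refine Finset.sum_congr rfl fun k _ => ?_
    simp only [Sum.elim_inr, kerVec, neg_mul, Finset.sum_mul, smul_neg, Finset.smul_sum,
      smul_mul_assoc, smul_smul, neg_smul, Finset.sum_neg_distrib]
    congr 1
    refine Finset.sum_congr rfl fun i _ => ?_
    congr 1
    ring

/-- The Cauchy kernel as a function of the bosonic difference. -/
def cauchy (x : E m) : A :=
  D.kernel (fun k => nuEven m (k + 1) x)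
    (fun k j => fderiv ℝ (nuEven m (k + 1)) x (EuclideanSpace.single j 1))

/-- The partial derivative `∂_j` of the Cauchy kernel. -/
def cauchyDeriv (j : Fin m) (x : E m) : A :=
  D.kernel (fun k => fderiv ℝ (nuEven m (k + 1)) x (EuclideanSpace.single j 1))
    (fun k i => fderiv ℝ (fun x => fderiv ℝ (nuEven m (k + 1)) x (EuclideanSpace.single i 1)) x
      (EuclideanSpace.single j 1))

lemma cauchy_eq_sum (x : E m) : D.cauchy x = ∑ κ, kerCoeff m n κ x • D.kerVec κ := by
  rw [cauchy, kernel_eq_sum]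
  refine Finset.sum_congr rfl fun κ _ => ?_
  rcases κ with k | p <;> rfl

lemma cauchyDeriv_eq_sum (j : Fin m) (x : E m) : D.cauchyDeriv j x
    = ∑ κ, fderiv ℝ (kerCoeff m n κ) x (EuclideanSpace.single j 1) • D.kerVec κ := by
  rw [cauchyDeriv, kernel_eq_sum]
  refine Finset.sum_congr rfl fun κ _ => ?_
  rcases κ with k | p <;> rfl

/-- The monomial `ξ_B`. -/
def mon (ξ : Fin (2 * n) → A) (B : Finset (Fin (2 * n))) : A :=
  ((B.sort (· ≤ ·)).map ξ).prod

/-- The value of a superfunction at the bosonic point `x` and the fermionic variables `ξ`. -/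
def evalAt (ξ : Fin (2 * n) → A) (g : SuperFun m n) (x : E m) : A := ∑ B, g B x • mon ξ B

lemma diracF_sum_smul {ι : Type*} [Fintype ι] (c : ι → ℝ) (w : ι → A) :
    D.diracF (∑ i, c i • w i) = ∑ i, c i • D.diracF (w i) := by
  simp only [diracF, map_sum, map_smul, Finset.mul_sum, mul_smul_comm, Finset.smul_sum,
    ← Finset.sum_sub_distrib, smul_sub]
  rw [Finset.sum_comm]
  simp only [smul_comm (2 : ℝ)]

/-- The super Dirac operator applied to a superfunction. -/
def diracAt (g : SuperFun m n) (x : E m) : A :=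
  D.diracF (evalAt D.x g x) - ∑ j, D.eB j * evalAt D.x (SuperFun.dB j g) x

/-- The vector field whose flux is the boundary integrand, tested against the functional `ℓ`. -/
def fluxField (ℓ : A →ₗ[ℝ] ℝ) (g : SuperFun m n) (y : E m) (j : Fin m) (x : E m) : ℝ :=
  ℓ (D.ber (D.cauchy (x - y) * D.eB j * evalAt D.x g x))

lemma fluxField_eq (ℓ : A →ₗ[ℝ] ℝ) (g : SuperFun m n) (y : E m) (j : Fin m) (x : E m) :
    D.fluxField ℓ g y j x = ∑ B, ∑ κ, (g B x * kerCoeff m n κ (x - y))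
      * ℓ (D.ber (D.kerVec κ * D.eB j * mon D.x B)) := by
  simp only [fluxField, evalAt, cauchy_eq_sum, Finset.mul_sum, Finset.sum_mul, mul_smul_comm,
    smul_mul_assoc, map_sum, map_smul, smul_eq_mul, mul_assoc]

lemma fluxTerm_contDiffAt {Ω : Set (E m)} (hΩ : IsOpen Ω) {g : SuperFun m n} (hg : g.IsC1On Ω)
    {x y : E m} (hx : x ∈ Ω) (hxy : x ≠ y) (B : Finset (Fin (2 * n)))
    (κ : Fin n ⊕ (Fin (n + 1) × Fin m)) :
    ContDiffAt ℝ 1 (fun x => g B x * kerCoeff m n κ (x - y)) x :=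
  ((hg B).contDiffAt (hΩ.mem_nhds hx)).mul
    ((contDiffAt_kerCoeff κ (sub_ne_zero.2 hxy)).comp x (contDiffAt_id.sub contDiffAt_const))

lemma contDiffOn_fluxField {Ω : Set (E m)} (hΩ : IsOpen Ω) {g : SuperFun m n} (hg : g.IsC1On Ω)
    (ℓ : A →ₗ[ℝ] ℝ) (y : E m) (j : Fin m) : ContDiffOn ℝ 1 (D.fluxField ℓ g y j) (Ω \ {y}) := by
  intro x hx
  have h : D.fluxField ℓ g y j = fun x => ∑ B, ∑ κ, (g B x * kerCoeff m n κ (x - y))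
      * ℓ (D.ber (D.kerVec κ * D.eB j * mon D.x B)) := funext (D.fluxField_eq ℓ g y j)
  rw [h]
  exact (ContDiffAt.sum fun B _ => ContDiffAt.sum fun κ _ =>
    (fluxTerm_contDiffAt hΩ hg hx.1 hx.2 B κ).mul contDiffAt_const).contDiffWithinAt

lemma fderiv_fluxField {Ω : Set (E m)} (hΩ : IsOpen Ω) {g : SuperFun m n} (hg : g.IsC1On Ω)
    (ℓ : A →ₗ[ℝ] ℝ) {x y : E m} (hx : x ∈ Ω) (hxy : x ≠ y) (j : Fin m) :
    fderiv ℝ (D.fluxField ℓ g y j) x (EuclideanSpace.single j 1)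
      = ℓ (D.ber (D.cauchyDeriv j (x - y) * D.eB j * evalAt D.x g x))
        + ℓ (D.ber (D.cauchy (x - y) * (D.eB j * evalAt D.x (SuperFun.dB j g) x))) := by
  have h : D.fluxField ℓ g y j = fun x => ∑ B, ∑ κ, (g B x * kerCoeff m n κ (x - y))
      * ℓ (D.ber (D.kerVec κ * D.eB j * mon D.x B)) := funext (D.fluxField_eq ℓ g y j)
  have hgB : ∀ B, DifferentiableAt ℝ (g B) x := fun B =>
    ((hg B).contDiffAt (hΩ.mem_nhds hx)).differentiableAt one_ne_zero
  have hk : ∀ κ, DifferentiableAt ℝ (fun x => kerCoeff m n κ (x - y)) x := fun κ =>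
    ((contDiffAt_kerCoeff κ (sub_ne_zero.2 hxy)).differentiableAt one_ne_zero).comp x
      (differentiableAt_id.sub_const y)
  have hterm : ∀ B κ, HasFDerivAt (fun x => (g B x * kerCoeff m n κ (x - y))
      * ℓ (D.ber (D.kerVec κ * D.eB j * mon D.x B)))
      (ℓ (D.ber (D.kerVec κ * D.eB j * mon D.x B)) • (g B x • fderiv ℝ (kerCoeff m n κ) (x - y)
        + kerCoeff m n κ (x - y) • fderiv ℝ (g B) x)) x := by
    intro B κ
    have h1 := (hgB B).hasFDerivAt.mul (hk κ).hasFDerivAt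
    rw [fderiv_comp_sub] at h1
    exact h1.mul_const _
  rw [h, (HasFDerivAt.fun_sum fun B _ => HasFDerivAt.fun_sum fun κ _ => hterm B κ).fderiv]
  simp only [sum_apply, smul_apply, add_apply, smul_eq_mul,
    cauchy_eq_sum, cauchyDeriv_eq_sum, evalAt, SuperFun.dB, Finset.mul_sum, Finset.sum_mul,
    mul_smul_comm, smul_mul_assoc, map_sum, map_smul, smul_eq_mul, mul_assoc]
  rw [← Finset.sum_add_distrib]
  refine Finset.sum_congr rfl fun B _ => ?_
  rw [← Finset.sum_add_distrib]
  refine Finset.sum_congr rfl fun κ _ => ?_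
  ring

/-- Off the singularity, the divergence of the flux field is the volume integrand up to sign: both
one-sided products of the Cauchy kernel with the Dirac operator cancel. -/
lemma div_fluxField (hm : m ≠ 0) {Ω : Set (E m)} (hΩ : IsOpen Ω) {g : SuperFun m n}
    (hg : g.IsC1On Ω) (ℓ : A →ₗ[ℝ] ℝ) {x y : E m} (hx : x ∈ Ω) (hxy : x ≠ y) :
    ∑ j, fderiv ℝ (D.fluxField ℓ g y j) x (EuclideanSpace.single j 1)
      = -ℓ (D.ber (D.cauchy (x - y) * D.diracAt g x)) := by
  have hxy' : x - y ≠ 0 := sub_ne_zero.2 hxy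
  have key := D.ber_kernel_diracF (fun k => nuEven m (k + 1) (x - y))
    (fun k j => fderiv ℝ (nuEven m (k + 1)) (x - y) (EuclideanSpace.single j 1))
    (fun k i j => fderiv ℝ (fun x => fderiv ℝ (nuEven m (k + 1)) x (EuclideanSpace.single i 1))
      (x - y) (EuclideanSpace.single j 1))
    (fun k i j => fderiv_fderiv_nuEven_symm (k + 1) hxy' i j)
    (laplacian_nuEven_one hm hxy')
    (fun k => laplacian_nuEven_succ (Nat.le_add_left 1 k) hxy') (evalAt D.x g x)
  have key' : D.ber (D.cauchy (x - y) * D.diracF (evalAt D.x g x))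
      = -D.ber ((∑ j, D.cauchyDeriv j (x - y) * D.eB j) * evalAt D.x g x) := by
    refine key.trans ?_
    congr 3
  rw [diracAt, mul_sub, map_sub, key', map_sub, map_neg, Finset.sum_mul, Finset.mul_sum]
  simp only [map_sum]
  rw [Finset.sum_congr rfl fun j _ => D.fderiv_fluxField hΩ hg ℓ hx hxy j, Finset.sum_add_distrib]
  ring

/-- The flux density of the Cauchy kernel at its singularity. -/
lemma tendsto_fluxField (hm : m ≠ 0) {Ω : Set (E m)} (hΩ : IsOpen Ω) {g : SuperFun m n}
    (hg : g.IsC1On Ω) (ℓ : A →ₗ[ℝ] ℝ) {y : E m} (hy : y ∈ Ω) :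
    Tendsto (fun x => ∑ j, (x j - y j) / ‖x - y‖ * (‖x - y‖ ^ (m - 1) * D.fluxField ℓ g y j x))
      (𝓝[≠] y) (𝓝 (-(ℓ (evalAt D.y g y)) / sphereArea m)) := by
  have hω := (sphereArea_pos hm).ne'
  set τ : Fin m → Finset (Fin (2 * n)) → Fin n ⊕ (Fin (n + 1) × Fin m) → ℝ :=
    fun j B κ => ℓ (D.ber (D.kerVec κ * D.eB j * mon D.x B)) with hτ
  have hsub : Tendsto (fun x : E m => x - y) (𝓝[≠] y) (𝓝[≠] 0) := by
    refine tendsto_nhdsWithin_of_tendsto_nhds_of_eventually_within _ ?_ ?_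
    · have : ContinuousAt (fun x : E m => x - y) y := by fun_prop
      simpa using this.tendsto.mono_left nhdsWithin_le_nhds
    · filter_upwards [self_mem_nhdsWithin] with x hx using sub_ne_zero.2 hx
  -- `∇ν_2` is radial, so the unit vector `v = (x - y) / |x - y|` enters quadratically, once through
  -- the surface element and once through the kernel; `kernel_zero_part` evaluates this
  have hmain : ∀ B (v : Fin m → ℝ), ∑ j, ∑ i, v j * v i * τ j B (.inr (0, i))
      = (∑ j, v j * v j) * ℓ (mon D.y B) := by
    intro B v
    have h1 := congrArg ℓ (D.kernel_zero_part v (B.sort (· ≤ ·)))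
    rw [map_smul, smul_eq_mul] at h1
    rw [mon, ← h1]
    simp only [hτ, kerVec, mon, map_sum, map_smul, smul_mul_assoc, neg_mul, Finset.sum_mul,
      Finset.smul_sum, smul_eq_mul, map_neg, smul_neg, neg_smul, Finset.sum_neg_distrib, mul_neg]
    congr 1
    refine Finset.sum_congr rfl fun j _ => Finset.sum_congr rfl fun i _ => ?_
    simp
    ring
  have hrest : ∀ j B κ, (∀ i, κ ≠ .inr (0, i)) →
      Tendsto (fun x => (x j - y j) / ‖x - y‖
        * (‖x - y‖ ^ (m - 1) * kerCoeff m n κ (x - y)) * τ j B κ) (𝓝[≠] y) (𝓝 0) := by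
    intro j B κ hκ
    have h1 := (tendsto_norm_pow_mul_kerCoeff hm κ hκ).comp hsub
    have h2 : Tendsto (fun x : E m => (x j - y j) / ‖x - y‖
        * (‖x - y‖ ^ (m - 1) * kerCoeff m n κ (x - y))) (𝓝[≠] y) (𝓝 0) := by
      have h0 : Tendsto (fun x : E m => ‖‖x - y‖ ^ (m - 1) * kerCoeff m n κ (x - y)‖) (𝓝[≠] y)
          (𝓝 0) := by
        rw [← norm_zero (E := ℝ)]
        exact h1.norm
      refine squeeze_zero_norm' ?_ h0
      filter_upwards [self_mem_nhdsWithin] with x hx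
      have hr : 0 < ‖x - y‖ := norm_pos_iff.2 (sub_ne_zero.2 hx)
      rw [norm_mul]
      refine mul_le_of_le_one_left (norm_nonneg _) ?_
      rw [norm_div, norm_norm, div_le_one hr, ← PiLp.sub_apply]
      exact PiLp.norm_apply_le _ j
    simpa using h2.mul_const (τ j B κ)
  have hgc : ∀ B, Tendsto (g B) (𝓝[≠] y) (𝓝 (g B y)) := fun B =>
    ((hg B).contDiffAt (hΩ.mem_nhds hy)).continuousAt.tendsto.mono_left nhdsWithin_le_nhds
  have hsum : Tendsto (fun x => ∑ B, g B x * (-(ℓ (mon D.y B)) / sphereArea m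
      + ∑ j, (∑ k : Fin n, (x j - y j) / ‖x - y‖
          * (‖x - y‖ ^ (m - 1) * kerCoeff m n (.inl k) (x - y)) * τ j B (.inl k)
        + ∑ k : Fin n, ∑ i, (x j - y j) / ‖x - y‖
          * (‖x - y‖ ^ (m - 1) * kerCoeff m n (.inr (k.succ, i)) (x - y))
            * τ j B (.inr (k.succ, i)))))
      (𝓝[≠] y) (𝓝 (∑ B, g B y * (-(ℓ (mon D.y B)) / sphereArea m
        + ∑ _j : Fin m, (∑ _k : Fin n, 0 + ∑ _k : Fin n, ∑ _i : Fin m, 0)))) := by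
    refine tendsto_finsetSum _ fun B _ => (hgc B).mul (tendsto_const_nhds.add
      (tendsto_finsetSum _ fun j _ => (tendsto_finsetSum _ fun k _ => ?_).add
        (tendsto_finsetSum _ fun k _ => tendsto_finsetSum _ fun i _ => ?_)))
    · exact hrest j B _ fun i => by simp
    · exact hrest j B _ fun i' => by simp [Fin.succ_ne_zero]
  have hlim : ∑ B, g B y * (-(ℓ (mon D.y B)) / sphereArea m
        + ∑ _j : Fin m, (∑ _k : Fin n, 0 + ∑ _k : Fin n, ∑ _i : Fin m, 0))
      = -(ℓ (evalAt D.y g y)) / sphereArea m := by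
    simp only [Finset.sum_const_zero, add_zero, evalAt, map_sum, map_smul, smul_eq_mul,
      neg_div, Finset.sum_div, mul_neg, Finset.sum_neg_distrib, mul_div_assoc]
  rw [hlim] at hsum
  refine hsum.congr' ?_
  filter_upwards [self_mem_nhdsWithin] with x hx
  have hr : ‖x - y‖ ≠ 0 := norm_ne_zero_iff.2 (sub_ne_zero.2 hx)
  have hv : ∑ j, (x j - y j) / ‖x - y‖ * ((x j - y j) / ‖x - y‖) = 1 := by
    have h1 : ∑ j, (x j - y j) * (x j - y j) = ‖x - y‖ ^ 2 := by
      rw [EuclideanSpace.real_norm_sq_eq]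
      exact Finset.sum_congr rfl fun j _ => by simp [sq]
    simp only [div_mul_div_comm]
    rw [← Finset.sum_div, h1, sq, div_self (mul_ne_zero hr hr)]
  have hm2 : ∀ B, -(ℓ (mon D.y B)) / sphereArea m = ∑ j, ∑ i, (x j - y j) / ‖x - y‖
      * (‖x - y‖ ^ (m - 1) * kerCoeff m n (.inr (0, i)) (x - y)) * τ j B (.inr (0, i)) := by
    intro B
    have h1 := hmain B fun j => (x j - y j) / ‖x - y‖
    rw [hv, one_mul] at h1
    rw [← h1, neg_div, Finset.sum_div, ← Finset.sum_neg_distrib]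
    refine Finset.sum_congr rfl fun j _ => ?_
    rw [Finset.sum_div, ← Finset.sum_neg_distrib]
    refine Finset.sum_congr rfl fun i _ => ?_
    rw [norm_pow_mul_kerCoeff_inr_zero hm i (sub_ne_zero.2 hx), PiLp.sub_apply]
    ring
  set φ : Fin m → Finset (Fin (2 * n)) → Fin n ⊕ (Fin (n + 1) × Fin m) → ℝ := fun j B κ =>
    (x j - y j) / ‖x - y‖ * (‖x - y‖ ^ (m - 1) * kerCoeff m n κ (x - y)) * τ j B κ with hφ
  have hsplit : ∀ j B, ∑ κ, φ j B κ = ∑ i, φ j B (.inr (0, i))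
      + (∑ k : Fin n, φ j B (.inl k) + ∑ k : Fin n, ∑ i, φ j B (.inr (k.succ, i))) := by
    intro j B
    rw [Fintype.sum_sum_type, Fintype.sum_prod_type, Fin.sum_univ_succ]
    ring
  have hL : ∀ B, -(ℓ (mon D.y B)) / sphereArea m
      + ∑ j, (∑ k : Fin n, φ j B (.inl k) + ∑ k : Fin n, ∑ i, φ j B (.inr (k.succ, i)))
      = ∑ j, ∑ κ, φ j B κ := by
    intro B
    rw [hm2 B, ← Finset.sum_add_distrib]
    exact Finset.sum_congr rfl fun j _ => (hsplit j B).symm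
  refine (Finset.sum_congr rfl fun B _ => congrArg (g B x * ·) (hL B)).trans ?_
  simp only [fluxField_eq, Finset.mul_sum]
  rw [Finset.sum_comm]
  refine Finset.sum_congr rfl fun j _ => Finset.sum_congr rfl fun B _ =>
    Finset.sum_congr rfl fun κ _ => ?_
  simp only [hφ, hτ]
  ring

end SuperCalculus

/-! ### The Cauchy–Pompeiu formula -/

namespace SuperCalculus

variable {A : Type*} [Ring A] [Algebra ℝ A] (D : SuperCalculus m n A)

/-- The boundary integrand. -/
def boundaryIntegrand (S : Set (E m)) (g : SuperFun m n) (y x : E m) : A :=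
  D.ber (D.cauchy (x - y) * (∑ j, outerNormal S x j • D.eB j) * evalAt D.x g x)

/-- The volume integrand. -/
def volumeIntegrand (g : SuperFun m n) (y x : E m) : A :=
  D.ber (D.cauchy (x - y) * D.diracAt g x)

lemma boundaryIntegrand_eq_sum (S : Set (E m)) (g : SuperFun m n) (y x : E m) :
    D.boundaryIntegrand S g y x = ∑ p : (Fin n ⊕ (Fin (n + 1) × Fin m)) × Fin m ×
        Finset (Fin (2 * n)), (kerCoeff m n p.1 (x - y) * outerNormal S x p.2.1 * g p.2.2 x)
      • D.ber (D.kerVec p.1 * D.eB p.2.1 * mon D.x p.2.2) := by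
  rw [boundaryIntegrand, cauchy_eq_sum, evalAt, Finset.sum_mul_sum, Finset.sum_mul, map_sum,
    Fintype.sum_prod_type]
  refine Finset.sum_congr rfl fun κ _ => ?_
  rw [Finset.sum_mul_sum, map_sum, Fintype.sum_prod_type]
  refine Finset.sum_congr rfl fun j _ => ?_
  rw [map_sum]
  refine Finset.sum_congr rfl fun B _ => ?_
  rw [smul_mul_smul_comm, smul_mul_smul_comm, map_smul]

lemma apply_boundaryIntegrand (ℓ : A →ₗ[ℝ] ℝ) (S : Set (E m)) (g : SuperFun m n) (y x : E m) :
    ℓ (D.boundaryIntegrand S g y x) = ∑ j, D.fluxField ℓ g y j x * outerNormal S x j := by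
  simp only [boundaryIntegrand, fluxField, Finset.mul_sum, Finset.sum_mul, map_sum, mul_smul_comm,
    smul_mul_assoc, map_smul, smul_eq_mul]
  exact Finset.sum_congr rfl fun j _ => mul_comm _ _

/-- The scalar coefficients of `∂_x g`. -/
def diracCoeff (g : SuperFun m n) :
    Finset (Fin (2 * n)) ⊕ (Fin m × Finset (Fin (2 * n))) → E m → ℝ
  | .inl B => g B
  | .inr p => SuperFun.dB p.1 g p.2

lemma diracAt_eq_sum (g : SuperFun m n) (x : E m) :
    D.diracAt g x = ∑ p, diracCoeff g p x • Sum.elim (fun B => D.diracF (mon D.x B))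
      (fun p : Fin m × Finset (Fin (2 * n)) => -(D.eB p.1 * mon D.x p.2)) p := by
  rw [diracAt, evalAt, diracF_sum_smul, Fintype.sum_sum_type, Fintype.sum_prod_type, sub_eq_add_neg]
  congr 1
  simp only [evalAt, Finset.mul_sum, Sum.elim_inr, smul_neg, Finset.sum_neg_distrib, mul_smul_comm,
    diracCoeff]

lemma volumeIntegrand_eq_sum (g : SuperFun m n) (y x : E m) :
    D.volumeIntegrand g y x = ∑ p : (Fin n ⊕ (Fin (n + 1) × Fin m)) ×
        (Finset (Fin (2 * n)) ⊕ (Fin m × Finset (Fin (2 * n)))),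
      (kerCoeff m n p.1 (x - y) * diracCoeff g p.2 x)
        • D.ber (D.kerVec p.1 * Sum.elim (fun B => D.diracF (mon D.x B))
      (fun p : Fin m × Finset (Fin (2 * n)) => -(D.eB p.1 * mon D.x p.2)) p.2) := by
  rw [volumeIntegrand, cauchy_eq_sum, diracAt_eq_sum, Finset.sum_mul_sum, map_sum,
    Fintype.sum_prod_type]
  simp only [map_sum, smul_mul_smul_comm, map_smul]

/-- A weak integral over the boundary, for `y` off the boundary. -/
lemma exists_boundaryIntegral (hm : m ≠ 0) {S Ω : Set (E m)}
    (hS : IsCompactSmoothDomain S) (hSΩ : S ⊆ Ω) {g : SuperFun m n} (hg : g.IsC1On Ω) {y : E m}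
    (hy : y ∉ frontier S) : ∃ a : A, ∀ ℓ : A →ₗ[ℝ] ℝ,
      IntegrableOn (fun x => ℓ (D.boundaryIntegrand S g y x)) (frontier S) (surfaceMeasure m) ∧
      ∫ x in frontier S, ℓ (D.boundaryIntegrand S g y x) ∂surfaceMeasure m = ℓ a := by
  simp only [boundaryIntegrand_eq_sum]
  refine ⟨_, fun ℓ => integral_sum_smul _ (fun p => hS.integrableOn_frontier hm ?_) ℓ⟩
  refine ContinuousOn.mul (ContinuousOn.mul (fun x hx => ?_) ?_) ?_
  · have hxy : x - y ≠ 0 := sub_ne_zero.2 fun h => hy (h ▸ hx)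
    exact ((contDiffAt_kerCoeff p.1 hxy).continuousAt.comp
      (f := fun x : E m => x - y) (by fun_prop)).continuousWithinAt
  · exact (PiLp.continuous_apply 2 (fun _ : Fin m => ℝ) p.2.1).comp_continuousOn
      hS.continuousOn_outerNormal
  · exact (hg p.2.2).continuousOn.mono (hS.isCompact.isClosed.frontier_subset.trans hSΩ)

/-- A weak integral over the domain; the kernel is locally integrable. -/
lemma exists_volumeIntegral (hm : m ≠ 0) {S Ω : Set (E m)} (hΩ : IsOpen Ω)
    (hS : IsCompactSmoothDomain S) (hSΩ : S ⊆ Ω) {g : SuperFun m n} (hg : g.IsC1On Ω) (y : E m) :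
    ∃ b : A, ∀ ℓ : A →ₗ[ℝ] ℝ, IntegrableOn (fun x => ℓ (D.volumeIntegrand g y x)) S ∧
      ∫ x in S, ℓ (D.volumeIntegrand g y x) = ℓ b := by
  simp only [volumeIntegrand_eq_sum]
  refine ⟨_, fun ℓ => integral_sum_smul _ (fun p => ?_) ℓ⟩
  refine (integrableOn_kerCoeff hm p.1 y hS.isCompact).mul_continuousOn ?_ hS.isCompact
  rcases p.2 with B | q
  · exact (hg B).continuousOn.mono hSΩ
  · exact ((((hg q.2).continuousOn_fderiv_of_isOpen hΩ le_rfl).clm_apply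
      continuousOn_const).mono hSΩ)

lemma div_fluxField_ae (hm : m ≠ 0) {S Ω : Set (E m)} (hΩ : IsOpen Ω)
    (hS : IsCompactSmoothDomain S) (hSΩ : S ⊆ Ω) {g : SuperFun m n} (hg : g.IsC1On Ω) (y : E m)
    (ℓ : A →ₗ[ℝ] ℝ) :
    (fun x => ∑ j, fderiv ℝ (D.fluxField ℓ g y j) x (EuclideanSpace.single j 1))
      =ᵐ[volume.restrict S] fun x => -ℓ (D.volumeIntegrand g y x) := by
  have := nontrivial_E hm
  filter_upwards [ae_restrict_mem hS.isCompact.measurableSet,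
    ae_restrict_of_ae (Measure.ae_ne volume y)] with x hx hxy
  exact D.div_fluxField hm hΩ hg ℓ (hSΩ hx) hxy

lemma eq_of_forall_dual {V : Type*} [AddCommGroup V] [Module ℝ V] {v w : V}
    (h : ∀ ℓ : V →ₗ[ℝ] ℝ, ℓ v = ℓ w) : v = w := by
  refine sub_eq_zero.1 ((Module.forall_dual_apply_eq_zero_iff ℝ (v - w)).1 fun ℓ => ?_)
  rw [map_sub, h, sub_self]

/-- The Cauchy–Pompeiu formula in an arbitrary algebra with the calculus `D`, the integrals being
tested against linear functionals. -/
theorem cauchyPompeiu (hm : m ≠ 0) {S Ω : Set (E m)} (hΩ : IsOpen Ω)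
    (hS : IsCompactSmoothDomain S) (hSΩ : S ⊆ Ω) {g : SuperFun m n} (hg : g.IsC1On Ω) :
    (∀ y ∈ interior S, ∃ a b : A,
      (∀ ℓ : A →ₗ[ℝ] ℝ,
        IntegrableOn (fun x => ℓ (D.boundaryIntegrand S g y x)) (frontier S) (surfaceMeasure m) ∧
        ∫ x in frontier S, ℓ (D.boundaryIntegrand S g y x) ∂surfaceMeasure m = ℓ a) ∧
      (∀ ℓ : A →ₗ[ℝ] ℝ, IntegrableOn (fun x => ℓ (D.volumeIntegrand g y x)) S ∧
        ∫ x in S, ℓ (D.volumeIntegrand g y x) = ℓ b) ∧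
      a + b = -evalAt D.y g y) ∧
    (∀ y ∈ Ω \ S, ∃ a b : A,
      (∀ ℓ : A →ₗ[ℝ] ℝ,
        IntegrableOn (fun x => ℓ (D.boundaryIntegrand S g y x)) (frontier S) (surfaceMeasure m) ∧
        ∫ x in frontier S, ℓ (D.boundaryIntegrand S g y x) ∂surfaceMeasure m = ℓ a) ∧
      (∀ ℓ : A →ₗ[ℝ] ℝ, IntegrableOn (fun x => ℓ (D.volumeIntegrand g y x)) S ∧
        ∫ x in S, ℓ (D.volumeIntegrand g y x) = ℓ b) ∧
      a + b = 0) := by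
  refine ⟨fun y hy => ?_, fun y hy => ?_⟩
  · obtain ⟨a, ha⟩ := D.exists_boundaryIntegral hm hS hSΩ hg fun h => h.2 hy
    obtain ⟨b, hb⟩ := D.exists_volumeIntegral hm hΩ hS hSΩ hg y
    refine ⟨a, b, ha, hb, eq_of_forall_dual fun ℓ => ?_⟩
    have hae := D.div_fluxField_ae hm hΩ hS hSΩ hg y ℓ
    have key := hS.setIntegral_div_of_singular hm hΩ hSΩ hy
      (D.contDiffOn_fluxField hΩ hg ℓ y) ((hb ℓ).1.neg.congr hae.symm)
      (D.tendsto_fluxField hm hΩ hg ℓ (hSΩ (interior_subset hy)))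
    simp only [← apply_boundaryIntegrand] at key
    rw [integral_congr_ae hae, integral_neg, (ha ℓ).2, (hb ℓ).2,
      mul_div_cancel₀ _ (sphereArea_pos hm).ne', sub_neg_eq_add] at key
    rw [map_add, key, map_neg]
  · obtain ⟨a, ha⟩ := D.exists_boundaryIntegral hm hS hSΩ hg fun h =>
      hy.2 (hS.isCompact.isClosed.frontier_subset h)
    obtain ⟨b, hb⟩ := D.exists_volumeIntegral hm hΩ hS hSΩ hg y
    refine ⟨a, b, ha, hb, eq_of_forall_dual fun ℓ => ?_⟩
    have hae := D.div_fluxField_ae hm hΩ hS hSΩ hg y ℓ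
    have key := hS.setIntegral_div hm (hΩ.sdiff isClosed_singleton)
      (fun x hx => ⟨hSΩ hx, fun h => hy.2 ((show x = y from h) ▸ hx)⟩)
      (D.contDiffOn_fluxField hΩ hg ℓ y)
    simp only [← apply_boundaryIntegrand] at key
    rw [integral_congr_ae hae, integral_neg, (ha ℓ).2, (hb ℓ).2] at key
    rw [map_add, ← key, neg_add_cancel, map_zero]

end SuperCalculus

lemma berezin_boundary (S : Set (E m)) (g : SuperFun m n) (y x : E m) :
    berezin (cauchyKernel x y * vecB (outerNormal S x) * g.eval x xVar)
      = (superCalculus m n).boundaryIntegrand S g y x := by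
  rw [berezin_eq_ber, cauchyKernel_eq]
  rfl

lemma berezin_volume (g : SuperFun m n) (y x : E m) :
    berezin (cauchyKernel x y * g.dirac x) = (superCalculus m n).volumeIntegrand g y x := by
  rw [berezin_eq_ber, cauchyKernel_eq]
  rfl

end SuperCauchy

end

theorem theorem4p4 (m n : ℕ) (hm : m ≠ 0)
    (Ω S : Set (SuperCauchy.E m)) (hΩ : IsOpen Ω)
    (hS : SuperCauchy.IsCompactSmoothDomain S) (hSΩ : S ⊆ Ω)
    (g : SuperCauchy.SuperFun m n) (hg : g.IsC1On Ω) :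
    (∀ y ∈ interior S, ∃ a b : SuperCauchy.SuperAlg m n,
      SuperCauchy.HasBoundaryIntegral S g y a ∧ SuperCauchy.HasVolumeIntegral S g y b ∧
        a + b = -g.eval y SuperCauchy.yVar) ∧
    (∀ y ∈ Ω \ S, ∃ a b : SuperCauchy.SuperAlg m n,
      SuperCauchy.HasBoundaryIntegral S g y a ∧ SuperCauchy.HasVolumeIntegral S g y b ∧
        a + b = 0) := by
  simp only [SuperCauchy.HasBoundaryIntegral, SuperCauchy.HasVolumeIntegral,
    SuperCauchy.HasIntegralOn, SuperCauchy.berezin_boundary, SuperCauchy.berezin_volume]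
  exact (SuperCauchy.superCalculus m n).cauchyPompeiu hm hΩ hS hSΩ hg
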